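/- Let $m\ge 2$ parties have vote proportions $p=(p_1,\dots,p_m)$ in the simplex $S_m=\{p\in(0,1)^m:\sum_i p_i=1\}$. For a house of $N$ seats let $s_i$ be the number of seats of party $i$ (so $\sum_i s_i=N$) and $\Delta_i=s_i-Np_i$ its seat excess. An $\alpha$-rounding of $x\in\mathbb R$ is an integer $[x]_\alpha$ with $x-\alpha\le[x]_\alpha\le x-\alpha+1$ (two values are allowed when $x-\alpha\in\mathbb Z$). For real $\beta$, the *$\beta$-linear divisor method* takes $s_i=[p_i/D]_\beta$ (replaced by $0$ if negative), where $D>0$ is chosen such that $\sum_i s_i=N$. For real $\gamma$, the *$\gamma$-quota method* takes $s_i=[(N+\gamma)p_i]_\alpha$, where $\alpha$ is chosen such that $\sum_i s_i=N$ (negative values, possible only for $\gamma>1$, may be kept or replaced by $0$). Ties may be resolved in any (possibly random) way, and an allocation by the method is needed only for all large $N$. Let $\tilde U_0,\tilde U_1,\dots$ be uniform on $(-\frac12,\frac12)$, independent of each other and of $p$. Let $p$ be random, and let $N\to\infty$ with $N$ deterministic. **A.** Suppose that the law of $p$ is absolutely continuous on $S_m$ (with respect to $(m-1)$-dimensional Lebesgue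 measure). (i) For the $\beta$-linear divisor method, for each $i$, $$\Delta_i\xrightarrow{d}(\beta-\tfrac12)(mp_i-1)+\tilde U_0+p_i\sum_{k=1}^{m-2}\tilde U_k .$$ Moreover, jointly for $i=1,\dots,m$, $\Delta_i\xrightarrow{d}X_i=p_i\sum_{j=1}^mV_j-V_i+(\beta-1)(mp_i-1)$, where $V_i=\mathbf 1\{J\ne i\}U_i$, the variables $U_1,\dots,U_m$ are uniform on $(0,1)$, independent of each other and of $(p,J)$, and $\mathbb P(J=j\mid p)=p_j$. (ii) For the $\gamma$-quota method, for each $i$, $$\Delta_i\xrightarrow{d}Y_i=\gamma\Bigl(p_i-\frac1m\Bigr)+\tilde U_0+\frac1m\sum_{k=1}^{m-2}\tilde U_k .$$ Moreover, there is an exchangeable probability law $\nu$ on $\mathbb R^m$, depending only on $m$ and $\gamma$ (not on the law of $p$), such that, if $Z=(Z_1,\dots,Z_m)$ has law $\nu$ and is independent of $p$, and $\overline Y_i=Z_i+\gamma p_i$, then $\Delta_i\xrightarrow{d}\overline Y_i$ jointly for $i=1,\dots,m$, and $\overline Y_i$ has the same distribution as $Y_i$ for each $i$. **B.** Suppose that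 $p$ is uniformly distributed on $S_m$. Let $p_{(1)}\ge\dots\ge p_{(m)}$ be the proportions in decreasing order and $\Delta_{(1)},\dots,\Delta_{(m)}$ the seat excesses of the parties in the same order. Let $1\le j\le m$, $h_j=\sum_{i=j}^m\frac1i$ and $g_j=\sum_{i=j}^m\frac1{i^2}$. (i) For the $\beta$-linear divisor method, $$\Delta_{(j)}\xrightarrow{d}\hat X_j=(\beta-\tfrac12)(mp_{(j)}-1)+\tilde U_0+p_{(j)}\sum_{k=1}^{m-2}\tilde U_k,$$ $$\mathbb E\Delta_{(j)}\to\mathbb E\hat X_j=(\beta-\tfrac12)(m\,\mathbb Ep_{(j)}-1)=(\beta-\tfrac12)(h_j-1),$$ $$\operatorname{Var}\Delta_{(j)}\to\operatorname{Var}\hat X_j=\tfrac1{12}\bigl(1+(m-2)\mathbb Ep_{(j)}^2\bigr)+(\beta-\tfrac12)^2m^2\operatorname{Var}p_{(j)}$$ $$=\frac1{12}+\frac{m-2}{12m(m+1)}g_j+\frac{m-2}{12m(m+1)}h_j^2+(\beta-\tfrac12)^2\Bigl(\frac m{m+1}g_j-\frac1{m+1}h_j^2\Bigr).$$ (ii)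 For the $\gamma$-quota method, $$\Delta_{(j)}\xrightarrow{d}\hat Y_j=\gamma\Bigl(p_{(j)}-\frac1m\Bigr)+\tilde U_0+\frac1m\sum_{k=1}^{m-2}\tilde U_k,$$ $$\mathbb E\Delta_{(j)}\to\mathbb E\hat Y_j=\gamma\Bigl(\mathbb Ep_{(j)}-\frac1m\Bigr)=\frac\gamma m(h_j-1),$$ $$\operatorname{Var}\Delta_{(j)}\to\operatorname{Var}\hat Y_j=\tfrac1{12}\Bigl(1+\frac{m-2}{m^2}\Bigr)+\gamma^2\operatorname{Var}p_{(j)}=\frac{(m+2)(m-1)}{12m^2}+\gamma^2\Bigl(\frac{g_j}{m(m+1)}-\frac{h_j^2}{m^2(m+1)}\Bigr).$$ In B, $\Delta_{(j)}$ (for all large $N$), $\hat X_j$ and $\hat Y_j$ are square integrable. -/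

import Mathlib

open MeasureTheory ProbabilityTheory Filter Topology

universe u v

/-- `n` is an (accepted) `α`-rounding of the real number `x`. When `x - α` is an integer, both
`x - α` and `x - α + 1` are accepted. -/
def IsRounding (α x : ℝ) (n : ℤ) : Prop :=
  x - α ≤ n ∧ (n : ℝ) ≤ x - α + 1

/-- `s` is a possible outcome of the `β`-linear divisor method for vote proportions `p` and house
size `N`: for some divisor `D > 0`, party `i` gets the `β`-rounding of `p i / D` seats, and the
total is `N`. A negative rounding (which can occur only if `β > 1`, for a very small party) is
replaced by `0`. All ways of resolving ties are accepted. -/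
def IsDivisorAllocation {m : ℕ} (β : ℝ) (N : ℕ) (p : Fin m → ℝ) (s : Fin m → ℤ) : Prop :=
  ∑ i, s i = N ∧
    ∃ D : ℝ, 0 < D ∧ ∀ i, ∃ n : ℤ, IsRounding β (p i / D) n ∧ s i = max n 0

/-- `s` is a possible outcome of the `γ`-quota method for vote proportions `p` and house
size `N`: for some `α`, party `i` gets the `α`-rounding of `(N + γ) * p i` seats, and the total
is `N`. Negative roundings can occur only if `γ > 1`, for very small parties; the outcome is
accepted both when these values are kept, and when they are replaced by `0` (which is the
outcome of the sequential award of the seats by largest difference `(N + γ) * p i - s i`).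
All ways of resolving ties are accepted. -/
def IsQuotaAllocation {m : ℕ} (γ : ℝ) (N : ℕ) (p : Fin m → ℝ) (s : Fin m → ℤ) : Prop :=
  ∑ i, s i = N ∧
    ((∃ α : ℝ, ∀ i, IsRounding α ((N + γ) * p i) (s i)) ∨
      (∃ α : ℝ, ∀ i, ∃ n : ℤ, IsRounding α ((N + γ) * p i) n ∧ s i = max n 0))

/-- The seat excess of party `i`. -/
noncomputable def seatExcess {m : ℕ} (N : ℕ) (p : Fin m → ℝ) (s : Fin m → ℤ) (i : Fin m) : ℝ :=
  s i - N * p i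

/-- The open simplex of all possible vote proportions. -/
def shareSimplex (m : ℕ) : Set (Fin m → ℝ) :=
  {p | (∀ i, p i ∈ Set.Ioo (0 : ℝ) 1) ∧ ∑ i, p i = 1}

/-- The `(m - 1)`-dimensional Lebesgue measure on the simplex, normalised by using the first
`m - 1` coordinates as a chart. -/
noncomputable def shareVolume : (m : ℕ) → Measure (Fin m → ℝ)
  | 0 => 0
  | n + 1 =>
    ((volume : Measure (Fin n → ℝ)).map
      (fun x => (Fin.snoc (α := fun _ => ℝ) x (1 - ∑ i, x i) : Fin (n + 1) → ℝ))).restrict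
        (shareSimplex (n + 1))

/-- The permutation that lists the parties in order of decreasing size. -/
noncomputable def decreasingOrder {m : ℕ} (p : Fin m → ℝ) : Equiv.Perm (Fin m) :=
  Tuple.sort (fun i => -p i)

theorem antitone_decreasingOrder {m : ℕ} (p : Fin m → ℝ) :
    Antitone (fun j => p (decreasingOrder p j)) := by
  intro i j hij
  have h := Tuple.monotone_sort (fun i => -p i) hij
  simpa [decreasingOrder] using h

/-- The proportion of the `j`:th largest party (with `j = 0` for the largest one). -/
noncomputable def orderedShare {m : ℕ} (p : Fin m → ℝ) (j : Fin m) : ℝ :=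
  p (decreasingOrder p j)

/-- The seat excess of the `j`:th largest party (with `j = 0` for the largest one). -/
noncomputable def orderedExcess {m : ℕ} (N : ℕ) (p : Fin m → ℝ) (s : Fin m → ℤ) (j : Fin m) : ℝ :=
  seatExcess N p s (decreasingOrder p j)

/-- `T 0, T 1, …` are uniformly distributed on `(-1/2, 1/2)`, independent of each other
and of `p`. -/
structure IsCentredUniforms {Ω : Type*} [MeasurableSpace Ω] (μ : Measure Ω) {m : ℕ}
    (p : Ω → Fin m → ℝ) (T : ℕ → Ω → ℝ) : Prop where
  uniform : ∀ k, pdf.IsUniform (T k) (Set.Ioo (-1 / 2 : ℝ) (1 / 2)) μ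
  indep : iIndepFun T μ
  indep_share : IndepFun p (fun ω k => T k ω) μ

/-- `U i`, one for each party, are uniformly distributed on `(0, 1)`, independent of each other
and of `(p, J)`, where `J` is a random party that equals `j` with conditional probability `p j`
given `p`. -/
structure IsDivisorSource {Ω : Type*} [MeasurableSpace Ω] (μ : Measure Ω) {m : ℕ}
    (p : Ω → Fin m → ℝ) (U : Fin m → Ω → ℝ) (J : Ω → Fin m) : Prop where
  uniform : ∀ i, pdf.IsUniform (U i) (Set.Ioo (0 : ℝ) 1) μ
  indep : iIndepFun U μ
  indep_share : IndepFun (fun ω => (p ω, J ω)) (fun ω i => U i ω) μ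
  measurable_index : Measurable J
  cond_index : ∀ j, μ⟦J ⁻¹' {j} | MeasurableSpace.comap p inferInstance⟧ =ᵐ[μ] fun ω => p ω j

/-- The limit of the seat excess of a single party of size `x`, for the `β`-linear divisor
method with `m` parties, as a function of the values `t` of the uniform variables. -/
noncomputable def divisorLimit (β : ℝ) (m : ℕ) (x : ℝ) (t : ℕ → ℝ) : ℝ :=
  (β - 1 / 2) * (m * x - 1) + t 0 + x * ∑ k ∈ Finset.Icc 1 (m - 2), t k

/-- The joint limit of the seat excesses for the `β`-linear divisor method: with
`V i = 1_{J ≠ i} U i`, it is `p i * ∑ j, V j - V i + (β - 1) * (m * p i - 1)`. -/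
noncomputable def divisorJointLimit (β : ℝ) {m : ℕ} (p u : Fin m → ℝ) (J : Fin m) (i : Fin m) :
    ℝ :=
  p i * ∑ j, (if J ≠ j then u j else 0) - (if J ≠ i then u i else 0) + (β - 1) * (m * p i - 1)

/-- The limit of the seat excess of a single party of size `x`, for the `γ`-quota
method with `m` parties, as a function of the values `t` of the uniform variables. -/
noncomputable def quotaLimit (γ : ℝ) (m : ℕ) (x : ℝ) (t : ℕ → ℝ) : ℝ :=
  γ * (x - 1 / m) + t 0 + 1 / m * ∑ k ∈ Finset.Icc 1 (m - 2), t k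

/-- The sum of `1 / i ^ r` over `i = j, …, m`, where `j : Fin m` stands for the position `j + 1`
counted from `1`. -/
noncomputable def tailSum {m : ℕ} (j : Fin m) (r : ℕ) : ℝ :=
  ∑ i ∈ Finset.Icc ((j : ℕ) + 1) m, 1 / (i : ℝ) ^ r

/-!
The divisor and the quota methods are instances of one geometric picture. The vector `Δ` of seat
excesses has coordinate sum `0` and is congruent to `-N p` modulo the integer vectors; two such
vectors differ by an element of the lattice of integer vectors with sum `0`. When `N` is large for
the given `p`, no rounding is negative, and `Δ` also lies in the projection of the cube
`c p - [0, 1] ^ m`, along a probability vector `q p`, to the hyperplane of vectors with sum `0`. For divisor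
methods `q p = p` and `c p = (β - 1) (m p - 1)`, since a change of the divisor moves all quotients
along `p`; for quota methods `q p = 1 / m` and `c p = γ (p - 1 / m)`, since a change of the shift
moves all quotas along the diagonal (`IsDivisorAllocation.mem_shadowSet`,
`IsQuotaAllocation.mem_shadowSet`).

The projected cube is a fundamental domain of the lattice, in the sense that a projected point of
the half-open cube has no other representative in the projection of the closed cube
(`shadow_injective`). Hence the limit law of `Δ` is determined by the limit law of `(p, N p)`
modulo `1`. By the Riemann–Lebesgue lemma (`tendsto_integral_exp_shareSimplex`), `N p` is in the
limit uniform modulo the lattice and independent of `p`. The uniform law on the fundamental domain is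
realised by the projection of a random point of the lower boundary of the cube: choose the face
`u J = 0` with probability `q p J`, and then a uniform point on it. Indeed the nontrivial Fourier
coefficients of the projected point vanish (`shadowChar_eq_zero`). As the projected cube is compact,
weak convergence on the torus lifts to weak convergence of `Δ` (`tendsto_law_of_mem_shadowSet`). The
joint limits are read off from this: for divisor methods `J` has law `p` and the limit is `X`; for
quota methods the limit is a sum of `γ p` and an exchangeable vector independent of `p`
(`hasLaw_add_quotaLaw`).

The law of a single coordinate follows from its characteristic function (`shadowChar_single`). The
choice between the face `J = i` and the other faces merges one uniform variable on `(0, q i)` and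
one on `(q i - 1, 0)` into a uniform variable on an interval of length `1`, and `m - 2` independent
uniform variables with coefficient `q i` remain.

Sorting the parties maps allocations to allocations and preserves absolute continuity, so the
limits for ordered parties are the limits for single parties applied to the sorted proportions. The
excesses are bounded uniformly in `p` and in all large `N`, whence the mean and the variance converge
(`TendstoInDistribution.tendsto_moments`). The moments of the sorted uniform proportions come from
the fact that sorting has the same effect on the uniform law as a linear map between two simplices
(`map_orderedShare_eq_map_vertexMap`); the second moments of the uniform law itself are found from
exchangeability, `∑ i, p i = 1`, and the invariance of `∑ i, p i ^ 2` under sorting.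
-/

/-! ### Weak convergence of a vector and its fractional parts -/

/-- Weak convergence of probability measures on a torus follows from convergence of the Fourier
coefficients. -/
theorem tendsto_of_tendsto_integral_mFourier {d : Type*} [Fintype d]
    {ν : ℕ → ProbabilityMeasure (UnitAddTorus d)} {ν₀ : ProbabilityMeasure (UnitAddTorus d)}
    (h : ∀ k : d → ℤ, Tendsto (fun N => ∫ x, UnitAddTorus.mFourier k x ∂(ν N : Measure _)) atTop
      (𝓝 (∫ x, UnitAddTorus.mFourier k x ∂(ν₀ : Measure _)))) :
    Tendsto ν atTop (𝓝 ν₀) := by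
  have hint : ∀ (f : C(UnitAddTorus d, ℂ)) (ρ : Measure (UnitAddTorus d)) [IsProbabilityMeasure ρ],
      Integrable f ρ := fun f ρ _ =>
    Integrable.of_bound f.continuous.aestronglyMeasurable ‖f‖ (ae_of_all _ f.norm_coe_le_norm)
  let S : Submodule ℂ C(UnitAddTorus d, ℂ) :=
    { carrier := {f | Tendsto (fun N => ∫ x, f x ∂(ν N : Measure _)) atTop
        (𝓝 (∫ x, f x ∂(ν₀ : Measure _)))}
      zero_mem' := by simp
      add_mem' := by
        intro f g hf hg
        simp only [Set.mem_ofPred_eq, ContinuousMap.add_apply] at *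
        simp_rw [integral_add (hint f _) (hint g _)]
        exact hf.add hg
      smul_mem' := by
        intro a f hf
        simp only [Set.mem_ofPred_eq, ContinuousMap.smul_apply] at *
        simp_rw [integral_smul]
        exact hf.const_smul a }
  have hS : ∀ f : C(UnitAddTorus d, ℂ), Tendsto (fun N => ∫ x, f x ∂(ν N : Measure _)) atTop
        (𝓝 (∫ x, f x ∂(ν₀ : Measure _))) := by
    intro f
    have hspan : Submodule.span ℂ (Set.range (UnitAddTorus.mFourier (d := d))) ≤ S := by
      rw [Submodule.span_le]
      rintro _ ⟨k, rfl⟩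
      exact h k
    have hf : f ∈ (Submodule.span ℂ (Set.range (UnitAddTorus.mFourier (d := d)))).topologicalClosure
        := by
      rw [UnitAddTorus.span_mFourier_closure_eq_top]; trivial
    rw [Metric.tendsto_atTop]
    intro ε hε
    obtain ⟨g, hg, hfg⟩ := Metric.mem_closure_iff.1 hf (ε / 3) (by positivity)
    have hgS := hspan hg
    obtain ⟨N₀, hN₀⟩ := Metric.tendsto_atTop.1 hgS (ε / 3) (by positivity)
    refine ⟨N₀, fun N hN => ?_⟩
    have key : ∀ (ρ : Measure (UnitAddTorus d)) [IsProbabilityMeasure ρ],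
        dist (∫ x, f x ∂ρ) (∫ x, g x ∂ρ) < ε / 3 := by
      intro ρ _
      rw [dist_eq_norm, ← integral_sub (hint f ρ) (hint g ρ)]
      refine lt_of_le_of_lt (norm_integral_le_of_norm_le_const (C := dist f g) (ae_of_all _ ?_)) ?_
      · intro x
        rw [← dist_eq_norm]
        exact ContinuousMap.dist_apply_le_dist x
      · simpa using hfg
    have h1 := key (ν N : Measure _)
    have h2 := key (ν₀ : Measure _)
    have h3 := hN₀ N hN
    rw [dist_comm] at h2
    have h4 := dist_triangle4 (∫ x, f x ∂(ν N : Measure _)) (∫ x, g x ∂(ν N : Measure _))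
      (∫ x, g x ∂(ν₀ : Measure _)) (∫ x, f x ∂(ν₀ : Measure _))
    linarith
  rw [ProbabilityMeasure.tendsto_iff_forall_integral_tendsto]
  intro f
  have h1 := hS ⟨fun x => (f x : ℂ), by fun_prop⟩
  simp only [ContinuousMap.coe_mk, integral_complex_ofReal] at h1
  exact_mod_cast (Complex.continuous_re.tendsto _).comp h1

/-! ### A chart of the simplex and the Riemann–Lebesgue lemma -/

/-- The chart of the hyperplane `∑ i, p i = 1` by the first `n` coordinates. -/
noncomputable def simplexChart (n : ℕ) (x : Fin n → ℝ) : Fin (n + 1) → ℝ :=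
  Fin.snoc (α := fun _ => ℝ) x (1 - ∑ i, x i)

@[simp] theorem simplexChart_castSucc {n : ℕ} (x : Fin n → ℝ) (i : Fin n) :
    simplexChart n x i.castSucc = x i := by simp [simplexChart]

@[simp] theorem simplexChart_last {n : ℕ} (x : Fin n → ℝ) :
    simplexChart n x (Fin.last n) = 1 - ∑ i, x i := by simp [simplexChart]

theorem continuous_simplexChart (n : ℕ) : Continuous (simplexChart n) := by
  refine continuous_pi fun i => ?_
  refine Fin.lastCases ?_ (fun i => ?_) i
  · simp only [simplexChart_last]; fun_prop
  · simp only [simplexChart_castSucc]; fun_prop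

theorem measurable_simplexChart (n : ℕ) : Measurable (simplexChart n) :=
  (continuous_simplexChart n).measurable

@[simp] theorem init_simplexChart {n : ℕ} (x : Fin n → ℝ) :
    Fin.init (simplexChart n x) = x := by
  ext i; simp [Fin.init]

theorem simplexChart_init {n : ℕ} {p : Fin (n + 1) → ℝ} (hp : ∑ i, p i = 1) :
    simplexChart n (Fin.init p) = p := by
  ext i
  rw [Fin.sum_univ_castSucc] at hp
  refine Fin.lastCases ?_ (fun i => ?_) i
  · simp [Fin.init]; linarith
  · simp [Fin.init]

theorem sum_simplexChart {n : ℕ} (x : Fin n → ℝ) : ∑ i, simplexChart n x i = 1 := by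
  simp [Fin.sum_univ_castSucc]

theorem measurable_finInit (n : ℕ) :
    Measurable (Fin.init : (Fin (n + 1) → ℝ) → Fin n → ℝ) :=
  measurable_pi_lambda _ fun i => measurable_pi_apply i.castSucc

theorem measurableSet_shareSimplex (m : ℕ) : MeasurableSet (shareSimplex m) := by
  have h1 : MeasurableSet {p : Fin m → ℝ | ∀ i, p i ∈ Set.Ioo (0 : ℝ) 1} := by
    have : {p : Fin m → ℝ | ∀ i, p i ∈ Set.Ioo (0 : ℝ) 1} = ⋂ i, {p | p i ∈ Set.Ioo (0 : ℝ) 1} := by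
      ext; simp
    rw [this]
    exact MeasurableSet.iInter fun i => measurable_pi_apply i measurableSet_Ioo
  have h2 : MeasurableSet {p : Fin m → ℝ | ∑ i, p i = 1} :=
    measurableSet_eq_fun (by fun_prop) measurable_const
  exact h1.inter h2

theorem shareVolume_succ (n : ℕ) : shareVolume (n + 1) =
    ((volume : Measure (Fin n → ℝ)).map (simplexChart n)).restrict (shareSimplex (n + 1)) := rfl

theorem ae_mem_shareSimplex {n : ℕ} {P : Measure (Fin (n + 1) → ℝ)}
    (hP : P ≪ shareVolume (n + 1)) : ∀ᵐ p ∂P, p ∈ shareSimplex (n + 1) := by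
  refine hP.ae_le ?_
  rw [shareVolume_succ]
  exact ae_restrict_mem (measurableSet_shareSimplex _)

theorem map_init_absolutelyContinuous {n : ℕ} {P : Measure (Fin (n + 1) → ℝ)}
    (hP : P ≪ shareVolume (n + 1)) : P.map Fin.init ≪ (volume : Measure (Fin n → ℝ)) := by
  refine (hP.map (measurable_finInit n)).trans ?_
  rw [shareVolume_succ]
  refine ((Measure.restrict_le_self.absolutelyContinuous).map (measurable_finInit n)).trans ?_
  rw [Measure.map_map (measurable_finInit n) (measurable_simplexChart n)]
  have : (Fin.init : (Fin (n + 1) → ℝ) → Fin n → ℝ) ∘ simplexChart n = id := by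
    ext x : 1; simp
  rw [this, Measure.map_id]

theorem map_simplexChart_map_init {n : ℕ} {P : Measure (Fin (n + 1) → ℝ)}
    (hP : P ≪ shareVolume (n + 1)) : (P.map Fin.init).map (simplexChart n) = P := by
  rw [Measure.map_map (measurable_simplexChart n) (measurable_finInit n)]
  conv_rhs => rw [← Measure.map_id (μ := P)]
  refine Measure.map_congr ?_
  filter_upwards [ae_mem_shareSimplex hP] with p hp
  exact simplexChart_init hp.2

open scoped FourierTransform in
/-- The Riemann–Lebesgue lemma on the simplex: a frequency that is not constant on the parties
is not constant on the simplex. -/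
theorem tendsto_integral_exp_shareSimplex {n : ℕ} {P : Measure (Fin (n + 1) → ℝ)}
    [IsProbabilityMeasure P] (hP : P ≪ shareVolume (n + 1)) (k l : Fin (n + 1) → ℝ)
    (hl : ∃ i j, l i ≠ l j) :
    Tendsto (fun N : ℕ => ∫ p, (𝐞 (∑ i, k i * p i - N * ∑ i, l i * p i) : ℂ) ∂P) atTop (𝓝 0) := by
  set ν := P.map Fin.init with hν
  have : IsProbabilityMeasure ν :=
    Measure.isProbabilityMeasure_map (measurable_finInit n).aemeasurable
  have hac := map_init_absolutelyContinuous hP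
  set f := ν.rnDeriv volume
  have hνf : ν = volume.withDensity f := (Measure.withDensity_rnDeriv_eq _ _ hac).symm
  -- on the chart, `∑ i, l i * p i` is the linear form `w` plus the constant `l (Fin.last n)`
  let w : StrongDual ℝ (Fin n → ℝ) :=
    ∑ i : Fin n, (l i.castSucc - l (Fin.last n)) • ContinuousLinearMap.proj i
  have hw : ∀ x, w x = ∑ i : Fin n, (l i.castSucc - l (Fin.last n)) * x i := by
    intro x; simp [w]
  have hw0 : w ≠ 0 := by
    intro h0
    have hcs : ∀ i : Fin n, l i.castSucc = l (Fin.last n) := by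
      intro i
      have := congrArg (fun z => z (Pi.single i 1)) h0
      simp only [hw] at this
      simp [Pi.single_apply] at this
      linarith
    have hall : ∀ i, l i = l (Fin.last n) := fun i => Fin.lastCases rfl hcs i
    obtain ⟨i, j, hij⟩ := hl
    exact hij (by rw [hall i, hall j])
  let g : (Fin n → ℝ) → ℂ := fun x =>
    (f x).toReal • (𝐞 (∑ i, k i * simplexChart n x i) : ℂ)
  have hlim : Tendsto (fun N : ℕ => (N : ℝ) • w) atTop (cocompact _) := by
    rw [← Metric.cobounded_eq_cocompact, ← tendsto_norm_atTop_iff_cobounded]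
    simp only [norm_smul, Real.norm_natCast]
    exact tendsto_natCast_atTop_atTop.atTop_mul_const (norm_pos_iff.2 hw0)
  have hRL := (tendsto_integral_exp_smul_cocompact g (volume : Measure (Fin n → ℝ))).comp hlim
  rw [tendsto_zero_iff_norm_tendsto_zero] at hRL ⊢
  refine hRL.congr fun N => ?_
  have hstep : ∫ p, (𝐞 (∑ i, k i * p i - N * ∑ i, l i * p i) : ℂ) ∂P =
      (𝐞 (-(N * l (Fin.last n))) : ℂ) * ∫ x, 𝐞 (-((N : ℝ) • w) x) • g x := by
    conv_lhs => rw [← map_simplexChart_map_init hP, ← hν]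
    rw [integral_map (measurable_simplexChart n).aemeasurable
      (by
        refine Continuous.aestronglyMeasurable ?_
        exact continuous_subtype_val.comp (Real.continuous_fourierChar.comp (by fun_prop))), hνf,
      integral_withDensity_eq_integral_toReal_smul (Measure.measurable_rnDeriv _ _)
        (Measure.rnDeriv_lt_top _ _), ← integral_const_mul]
    refine integral_congr_ae (ae_of_all _ fun x => ?_)
    have hsum : ∑ i, l i * simplexChart n x i = w x + l (Fin.last n) := by
      rw [Fin.sum_univ_castSucc, hw]
      simp only [simplexChart_castSucc, simplexChart_last, sub_mul, Finset.sum_sub_distrib,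
        mul_sub, Finset.mul_sum]
      ring
    simp only [g, hsum, Circle.smul_def, smul_apply, smul_eq_mul]
    have : (∑ i, k i * simplexChart n x i) - N * (w x + l (Fin.last n)) =
      -(N * l (Fin.last n)) + (-(N * w x) + ∑ i, k i * simplexChart n x i) := by ring
    rw [this, AddChar.map_add_eq_mul, AddChar.map_add_eq_mul]
    simp only [Circle.coe_mul, Complex.real_smul]
    ring
  rw [hstep, norm_mul, Circle.norm_coe, one_mul]
  rfl

/-! ### A random point of the lower boundary of the cube and its Fourier transform -/

/-- The uniform distribution on the unit cube. -/
noncomputable def cubeLaw (m : ℕ) : Measure (Fin m → ℝ) :=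
  Measure.pi fun _ => volume.restrict (Set.Ioo (0 : ℝ) 1)

instance isProbabilityMeasure_restrict_Ioo :
    IsProbabilityMeasure (volume.restrict (Set.Ioo (0 : ℝ) 1)) := ⟨by simp⟩

instance isProbabilityMeasure_cubeLaw (m : ℕ) : IsProbabilityMeasure (cubeLaw m) := by
  unfold cubeLaw; infer_instance

/-- The joint law of `(p, U, J)`, where `p` has law `P`, `U` is uniform on the unit cube and
independent of `(p, J)`, and the index `J` equals `j` with conditional probability `q p j`
given `p`. -/
noncomputable def sourceLaw {m : ℕ} (P : Measure (Fin m → ℝ)) (q : (Fin m → ℝ) → Fin m → ℝ) :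
    Measure ((Fin m → ℝ) × (Fin m → ℝ) × Fin m) :=
  ∑ j, ((P.withDensity fun p => ENNReal.ofReal (q p j)).prod (cubeLaw m)).map
    fun z => (z.1, z.2, j)

/-- The projection along `q p` of the point `-V + c p` to the hyperplane through `c p` on which
the coordinate sum is constant, where `V` arises from the point `u` of the unit cube by setting the
coordinate `J` to `0`. -/
noncomputable def shadowPoint {m : ℕ} (q c : (Fin m → ℝ) → Fin m → ℝ)
    (z : (Fin m → ℝ) × (Fin m → ℝ) × Fin m) (i : Fin m) : ℝ :=
  q z.1 i * ∑ j, (if z.2.2 ≠ j then z.2.1 j else 0) - (if z.2.2 ≠ i then z.2.1 i else 0) + c z.1 i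

/-- `q p` is a probability vector for almost every `p`. -/
structure IsAEWeight {m : ℕ} (P : Measure (Fin m → ℝ)) (q : (Fin m → ℝ) → Fin m → ℝ) : Prop where
  measurable : Measurable q
  nonneg : ∀ᵐ p ∂P, ∀ j, 0 ≤ q p j
  sum_eq_one : ∀ᵐ p ∂P, ∑ j, q p j = 1

theorem measurable_shadowPoint {m : ℕ} {q c : (Fin m → ℝ) → Fin m → ℝ} (hq : Measurable q)
    (hc : Measurable c) : Measurable (shadowPoint q c) := by
  have hJ : Measurable fun z : (Fin m → ℝ) × (Fin m → ℝ) × Fin m => z.2.2 :=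
    measurable_snd.comp measurable_snd
  have hV : ∀ i, Measurable fun z : (Fin m → ℝ) × (Fin m → ℝ) × Fin m =>
      if z.2.2 ≠ i then z.2.1 i else 0 := fun i =>
    Measurable.ite (hJ (MeasurableSet.of_discrete (s := {j | j ≠ i}))) (by fun_prop)
      measurable_const
  refine measurable_pi_lambda _ fun i => ?_
  have h1 : Measurable fun z : (Fin m → ℝ) × (Fin m → ℝ) × Fin m => q z.1 i := by fun_prop
  have h2 : Measurable fun z : (Fin m → ℝ) × (Fin m → ℝ) × Fin m => c z.1 i := by fun_prop
  exact ((h1.mul (Finset.measurable_sum _ fun j _ => hV j)).sub (hV i)).add h2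

namespace IsAEWeight

variable {m : ℕ} {P : Measure (Fin m → ℝ)} {q : (Fin m → ℝ) → Fin m → ℝ}

theorem le_one (h : IsAEWeight P q) : ∀ᵐ p ∂P, ∀ j, q p j ≤ 1 := by
  filter_upwards [h.nonneg, h.sum_eq_one] with p h0 h1 j
  rw [← h1]
  exact Finset.single_le_sum (fun i _ => h0 i) (Finset.mem_univ j)

theorem isProbabilityMeasure_sourceLaw [IsProbabilityMeasure P] (h : IsAEWeight P q) :
    IsProbabilityMeasure (sourceLaw P q) := by
  have hqm : ∀ j, Measurable fun p => q p j := fun j => (measurable_pi_apply j).comp h.measurable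
  constructor
  simp only [sourceLaw, Measure.coe_finsetSum, Finset.sum_apply]
  have : ∀ j : Fin m, ((P.withDensity fun p => ENNReal.ofReal (q p j)).prod (cubeLaw m)).map
      (fun z => (z.1, z.2, j)) Set.univ = ∫⁻ p, ENNReal.ofReal (q p j) ∂P := by
    intro j
    rw [Measure.map_apply (by fun_prop) MeasurableSet.univ, Set.preimage_univ,
      ← Set.univ_prod_univ, Measure.prod_prod, measure_univ (μ := cubeLaw m), mul_one,
      withDensity_apply _ MeasurableSet.univ, Measure.restrict_univ]
  simp_rw [this]
  rw [← lintegral_finsetSum _ fun j _ => (hqm j).ennreal_ofReal]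
  have h1 : ∀ᵐ p ∂P, ∑ j, ENNReal.ofReal (q p j) = 1 := by
    filter_upwards [h.nonneg, h.sum_eq_one] with p h0 h1
    rw [← ENNReal.ofReal_sum_of_nonneg fun i _ => h0 i, h1, ENNReal.ofReal_one]
  rw [lintegral_congr_ae h1]
  simp

theorem integral_sourceLaw [IsProbabilityMeasure P] (h : IsAEWeight P q)
    {F : (Fin m → ℝ) × (Fin m → ℝ) × Fin m → ℂ} (hF : Measurable F) {C : ℝ}
    (hC : ∀ z, ‖F z‖ ≤ C) :
    ∫ z, F z ∂sourceLaw P q =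
      ∫ p, ∑ j, (q p j : ℂ) * ∫ u, F (p, u, j) ∂cubeLaw m ∂P := by
  have hqm : ∀ j, Measurable fun p => q p j := fun j => (measurable_pi_apply j).comp h.measurable
  have hfin : ∀ j, IsFiniteMeasure (P.withDensity fun p => ENNReal.ofReal (q p j)) := by
    intro j
    refine isFiniteMeasure_withDensity_ofReal (HasFiniteIntegral.of_bounded (C := 1) ?_)
    filter_upwards [h.nonneg, h.le_one] with p h0 h1
    rw [Real.norm_of_nonneg (h0 j)]
    exact h1 j
  have hm : ∀ j : Fin m, Measurable fun z : (Fin m → ℝ) × (Fin m → ℝ) => (z.1, z.2, j) :=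
    fun j => by fun_prop
  have hFj : ∀ j : Fin m, Measurable fun z : (Fin m → ℝ) × (Fin m → ℝ) => F (z.1, z.2, j) :=
    fun j => hF.comp (hm j)
  have hint : ∀ j : Fin m, ∀ ρ : Measure ((Fin m → ℝ) × (Fin m → ℝ)), IsFiniteMeasure ρ →
      Integrable (fun z => F (z.1, z.2, j)) ρ := fun j ρ _ =>
    Integrable.of_bound (hFj j).aestronglyMeasurable C (ae_of_all _ fun z => hC _)
  rw [sourceLaw, integral_finsetSum_measure]
  swap
  · intro j _
    have := hfin j
    refine (integrable_map_measure hF.aestronglyMeasurable (hm j).aemeasurable).2 ?_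
    exact hint j _ inferInstance
  rw [integral_finsetSum]
  · refine Finset.sum_congr rfl fun j _ => ?_
    have := hfin j
    rw [integral_map (hm j).aemeasurable hF.aestronglyMeasurable,
      integral_prod _ (hint j _ inferInstance),
      integral_withDensity_eq_integral_toReal_smul (hqm j).ennreal_ofReal (by simp)]
    refine integral_congr_ae ?_
    filter_upwards [h.nonneg] with p h0
    rw [ENNReal.toReal_ofReal (h0 j), Complex.real_smul]
  · intro j _
    refine Integrable.of_bound (C := 1 * C) ?_ ?_
    · refine ((Complex.measurable_ofReal.comp (hqm j)).aestronglyMeasurable).mul ?_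
      exact ((hFj j).stronglyMeasurable.integral_prod_right').aestronglyMeasurable
    · filter_upwards [h.nonneg, h.le_one] with p h0 h1
      rw [norm_mul]
      refine mul_le_mul ?_ ?_ (norm_nonneg _) zero_le_one
      · rw [Complex.norm_real, Real.norm_of_nonneg (h0 j)]; exact h1 j
      · refine (norm_integral_le_of_norm_le_const (C := C) (ae_of_all _ fun u => hC _)).trans ?_
        simp

end IsAEWeight

/-- The characteristic function of the uniform distribution on `(0, 1)`. -/
noncomputable def unifChar (s : ℝ) : ℂ :=
  ∫ u in Set.Ioo (0 : ℝ) 1, Complex.exp (((s * u : ℝ) : ℂ) * Complex.I)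

@[simp] theorem unifChar_zero : unifChar 0 = 1 := by simp [unifChar]

theorem mul_unifChar (s : ℝ) :
    (s : ℂ) * Complex.I * unifChar s = Complex.exp ((s : ℂ) * Complex.I) - 1 := by
  rcases eq_or_ne s 0 with rfl | hs
  · simp
  have hc : (s : ℂ) * Complex.I ≠ 0 := by simp [hs]
  have h := integral_exp_mul_complex (a := 0) (b := 1) hc
  rw [intervalIntegral.integral_of_le zero_le_one, integral_Ioc_eq_integral_Ioo] at h
  have h2 : unifChar s = ∫ x in Set.Ioo (0 : ℝ) 1, Complex.exp (s * Complex.I * x) := by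
    unfold unifChar
    congr 1; ext u; congr 1; push_cast; ring
  rw [h2, h, mul_div_cancel₀ _ hc]
  simp

theorem integral_exp_sum_pi {ι : Type*} [Fintype ι] (ρ : Measure ℝ) [IsProbabilityMeasure ρ]
    (s : ι → ℝ) :
    ∫ u, Complex.exp (((∑ k, s k * u k : ℝ) : ℂ) * Complex.I) ∂(Measure.pi fun _ : ι => ρ) =
      ∏ k, ∫ x, Complex.exp (((s k * x : ℝ) : ℂ) * Complex.I) ∂ρ := by
  rw [← integral_fintype_prod_eq_prod (𝕜 := ℂ) (μ := fun _ : ι => ρ)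
    (fun k x => Complex.exp (((s k * x : ℝ) : ℂ) * Complex.I))]
  congr 1; ext u
  rw [← Complex.exp_sum, Complex.ofReal_sum, Finset.sum_mul]

theorem integral_exp_sum_face {m : ℕ} (s : Fin m → ℝ) (j : Fin m) :
    ∫ u, Complex.exp (((∑ k, s k * (if j ≠ k then u k else 0) : ℝ) : ℂ) * Complex.I) ∂cubeLaw m =
      ∏ k ∈ Finset.univ.erase j, unifChar (s k) := by
  have h := integral_exp_sum_pi (volume.restrict (Set.Ioo (0 : ℝ) 1))
    (fun k => if j ≠ k then s k else 0)
  rw [cubeLaw]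
  simp only [mul_ite, mul_zero, ite_mul, zero_mul] at h ⊢
  rw [h, ← Finset.mul_prod_erase _ _ (Finset.mem_univ j)]
  simp only [ne_eq, not_true_eq_false, if_false]
  simp only [Complex.ofReal_zero, zero_mul, Complex.exp_zero]
  rw [integral_const, probReal_univ, one_smul, one_mul]
  refine Finset.prod_congr rfl fun k hk => ?_
  rw [unifChar]
  simp [(Finset.ne_of_mem_erase hk).symm]

/-- The characteristic function at `b` of the projection along `q` of a random point of the lower
boundary of the unit cube, where the face is chosen with probabilities `q`. -/
noncomputable def shadowChar {m : ℕ} (q b : Fin m → ℝ) : ℂ :=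
  ∑ j, (q j : ℂ) * ∏ k ∈ Finset.univ.erase j, unifChar ((∑ i, b i * q i) - b k)

/-- The joint characteristic function of `p` and the projected boundary point. -/
theorem IsAEWeight.integral_exp_sourceLaw {m : ℕ} {P : Measure (Fin m → ℝ)}
    {q : (Fin m → ℝ) → Fin m → ℝ} [IsProbabilityMeasure P] (h : IsAEWeight P q)
    {c : (Fin m → ℝ) → Fin m → ℝ} (hc : Measurable c) (a b : Fin m → ℝ) :
    ∫ z, Complex.exp (((∑ i, a i * z.1 i + ∑ i, b i * shadowPoint q c z i : ℝ) : ℂ) * Complex.I)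
        ∂sourceLaw P q =
      ∫ p, Complex.exp (((∑ i, a i * p i + ∑ i, b i * c p i : ℝ) : ℂ) * Complex.I) *
        shadowChar (q p) b ∂P := by
  rw [h.integral_sourceLaw (C := 1)]
  · congr 1; ext p
    rw [shadowChar, Finset.mul_sum]
    refine Finset.sum_congr rfl fun j _ => ?_
    rw [← integral_exp_sum_face, mul_left_comm]
    congr 1
    rw [← integral_const_mul]
    congr 1; ext u
    rw [← Complex.exp_add, ← add_mul, ← Complex.ofReal_add]
    congr 3
    simp only [shadowPoint]
    have : ∀ V : Fin m → ℝ, ∑ i, b i * (q p i * ∑ k, V k - V i + c p i) =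
        (∑ i, b i * c p i) + ∑ k, ((∑ i, b i * q p i) - b k) * V k := by
      intro V
      simp only [mul_add, mul_sub, sub_mul, Finset.sum_add_distrib, Finset.sum_sub_distrib,
        ← Finset.mul_sum, ← mul_assoc, ← Finset.sum_mul]
      ring
    rw [this]
    ring
  · have := measurable_shadowPoint h.measurable hc
    have h2 : ∀ i, Measurable fun z => shadowPoint q c z i := fun i =>
      (measurable_pi_apply i).comp this
    refine Complex.measurable_exp.comp ((Complex.measurable_ofReal.comp ?_).mul_const _)
    exact Measurable.add (by fun_prop) (Finset.measurable_sum _ fun i _ => (h2 i).const_mul _)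
  · intro z
    rw [Complex.norm_exp_ofReal_mul_I]

/-- The projection of the random boundary point is uniformly distributed modulo the integer
lattice: its nontrivial Fourier coefficients vanish. -/
theorem shadowChar_eq_zero {m : ℕ} {q : Fin m → ℝ} (hq0 : ∀ i, 0 < q i) (hq1 : ∑ i, q i = 1)
    {l : Fin m → ℤ} (hl : ∃ i j, l i ≠ l j) :
    shadowChar q (fun i => 2 * Real.pi * l i) = 0 := by
  set a := ∑ i, 2 * Real.pi * l i * q i with ha
  set s : Fin m → ℝ := fun k => a - 2 * Real.pi * l k with hs
  set θ := Complex.exp ((a : ℂ) * Complex.I) - 1 with hθ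
  -- all the `s k` agree modulo `2 * π`, so that `s k * unifChar (s k)` does not depend on `k`
  have hφ : ∀ k, (s k : ℂ) * Complex.I * unifChar (s k) = θ := by
    intro k
    rw [mul_unifChar, hθ, hs]
    congr 1
    rw [Complex.exp_eq_exp_iff_exists_int]
    exact ⟨-l k, by push_cast; ring⟩
  have hsum : ∑ j, q j * s j = 0 := by
    simp only [hs, mul_sub, Finset.sum_sub_distrib, ← Finset.sum_mul, hq1, one_mul]
    rw [ha, sub_eq_zero]
    exact Finset.sum_congr rfl fun i _ => by ring
  -- after multiplication by `∏ k, s k * I`, the `j`th summand is `q j * s j` times a constant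
  change ∑ j, (q j : ℂ) * ∏ k ∈ Finset.univ.erase j, unifChar (s k) = 0
  by_cases hall : ∀ k, s k ≠ 0
  · have hprod : (∏ k, ((s k : ℂ) * Complex.I)) ≠ 0 := by
      refine Finset.prod_ne_zero_iff.2 fun k _ => ?_
      simp [hall k]
    have hj : ∀ j, (∏ k, ((s k : ℂ) * Complex.I)) *
        ((q j : ℂ) * ∏ k ∈ Finset.univ.erase j, unifChar (s k)) =
        (q j * s j : ℝ) * (Complex.I * θ ^ (m - 1)) := by
      intro j
      rw [← Finset.mul_prod_erase _ _ (Finset.mem_univ j)]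
      have : (∏ k ∈ Finset.univ.erase j, ((s k : ℂ) * Complex.I)) *
          ∏ k ∈ Finset.univ.erase j, unifChar (s k) = θ ^ (m - 1) := by
        rw [← Finset.prod_mul_distrib, Finset.prod_congr rfl fun k _ => hφ k, Finset.prod_const,
          Finset.card_erase_of_mem (Finset.mem_univ j), Finset.card_univ, Fintype.card_fin]
      rw [← this]; push_cast; ring
    refine (mul_eq_zero.1 ?_).resolve_left hprod
    rw [Finset.mul_sum, Finset.sum_congr rfl fun j _ => hj j, ← Finset.sum_mul,
      ← Complex.ofReal_sum, hsum]
    simp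
  · push Not at hall
    obtain ⟨k₀, hk₀⟩ := hall
    -- if some `s k` is `0`, then `θ = 0`, and so `unifChar (s k) = 0` whenever `s k ≠ 0`; as the
    -- weighted mean of the `s k` is `0`, at least two of them are nonzero, and every product
    -- contains a factor `0`
    have hθ0 : θ = 0 := by rw [← hφ k₀, hk₀]; simp
    refine Finset.sum_eq_zero fun j _ => ?_
    have : ∃ k, k ≠ j ∧ s k ≠ 0 := by
      by_contra! hcon
      have h1 : ∑ i, q i * s i = q j * s j :=
        Finset.sum_eq_single j (fun k _ hk => by rw [hcon k hk, mul_zero]) (by simp)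
      have h2 : s j = 0 := by
        rw [h1] at hsum
        exact (mul_eq_zero.1 hsum).resolve_left (hq0 j).ne'
      have h3 : ∀ k, 2 * Real.pi * (l k : ℝ) = a := by
        intro k
        have : s k = 0 := by
          by_cases hk : k = j
          · rw [hk, h2]
          · exact hcon k hk
        simp only [hs] at this
        linarith
      obtain ⟨i, i', hii⟩ := hl
      have h4 := (h3 i).trans (h3 i').symm
      have h5 : (l i : ℝ) = l i' := mul_left_cancel₀ (by positivity) h4
      exact hii (by exact_mod_cast h5)
    obtain ⟨k, hkj, hk⟩ := this
    have hk0 : unifChar (s k) = 0 := by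
      have := hφ k
      rw [hθ0] at this
      simpa [hk] using this
    rw [Finset.prod_eq_zero (Finset.mem_erase.2 ⟨hkj, Finset.mem_univ k⟩) hk0, mul_zero]

/-! ### Convergence in law to the projected cube -/

/-- The reduction modulo `1` of a pair of real vectors. -/
noncomputable def pairTorus (m : ℕ) (z : (Fin m → ℝ) × (Fin m → ℝ)) :
    UnitAddTorus (Fin m ⊕ Fin m) :=
  Sum.elim (fun i => (z.1 i : UnitAddCircle)) (fun i => (z.2 i : UnitAddCircle))

theorem continuous_pairTorus (m : ℕ) : Continuous (pairTorus m) := by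
  refine continuous_pi fun i => ?_
  rcases i with i | i
  · exact (AddCircle.continuous_mk' 1).comp (by fun_prop)
  · exact (AddCircle.continuous_mk' 1).comp (by fun_prop)

theorem mFourier_pairTorus {m : ℕ} (k : Fin m ⊕ Fin m → ℤ) (z : (Fin m → ℝ) × (Fin m → ℝ)) :
    UnitAddTorus.mFourier k (pairTorus m z) =
      Complex.exp (((∑ i, 2 * Real.pi * k (Sum.inl i) * z.1 i +
        ∑ i, 2 * Real.pi * k (Sum.inr i) * z.2 i : ℝ) : ℂ) * Complex.I) := by
  simp only [UnitAddTorus.mFourier, ContinuousMap.coe_mk, pairTorus, Fintype.prod_sum_type,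
    Sum.elim_inl, Sum.elim_inr, fourier_coe_apply]
  rw [← Complex.exp_sum, ← Complex.exp_sum, ← Complex.exp_add]
  congr 1
  push_cast
  rw [add_mul, Finset.sum_mul, Finset.sum_mul]
  congr 1 <;> refine Finset.sum_congr rfl fun i _ => ?_ <;> ring

/-- The pairs `(p, x)` where `p` is in the closed simplex and `x` is in the projection along `q p`
of the cube `c p - [0, 1] ^ m`. -/
def shadowSet {m : ℕ} (q c : (Fin m → ℝ) → Fin m → ℝ) : Set ((Fin m → ℝ) × (Fin m → ℝ)) :=
  (fun z : (Fin m → ℝ) × (Fin m → ℝ) =>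
    (z.1, fun i => q z.1 i * ∑ j, z.2 j - z.2 i + c z.1 i)) '' (stdSimplex ℝ (Fin m) ×ˢ Set.Icc 0 1)

theorem isCompact_shadowSet {m : ℕ} {q c : (Fin m → ℝ) → Fin m → ℝ} (hq : Continuous q)
    (hc : Continuous c) : IsCompact (shadowSet q c) := by
  refine ((isCompact_stdSimplex ℝ (Fin m)).prod isCompact_Icc).image ?_
  fun_prop

theorem shareSimplex_subset_stdSimplex (m : ℕ) : shareSimplex m ⊆ stdSimplex ℝ (Fin m) :=
  fun _ hp => ⟨fun i => (hp.1 i).1.le, hp.2⟩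

/-- A projected point of the half-open cube is the only point of its class modulo the integer
lattice in the projection of the closed cube. -/
theorem shadow_injective {m : ℕ} {q : Fin m → ℝ} (hq0 : ∀ i, 0 < q i)
    {v w c : Fin m → ℝ} (hv : ∀ i, 0 ≤ v i ∧ v i < 1) (hw : ∀ i, 0 ≤ w i ∧ w i ≤ 1)
    {k : Fin m → ℤ} (hk : ∑ i, k i = 0)
    (h : ∀ i, (q i * ∑ j, v j - v i + c i) - (q i * ∑ j, w j - w i + c i) = k i) : k = 0 := by
  by_contra hne
  have hpos : ∃ a, 0 < k a := by
    by_contra! hcon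
    refine hne (funext fun i => ?_)
    exact (Finset.sum_eq_zero_iff_of_nonpos fun i _ => hcon i).1 hk i (Finset.mem_univ i)
  have hneg : ∃ b, k b < 0 := by
    by_contra! hcon
    refine hne (funext fun i => ?_)
    exact (Finset.sum_eq_zero_iff_of_nonneg fun i _ => hcon i).1 hk i (Finset.mem_univ i)
  obtain ⟨a, ha⟩ := hpos
  obtain ⟨b, hb⟩ := hneg
  have ha' : (1 : ℝ) ≤ k a := by exact_mod_cast ha
  have hb' : (k b : ℝ) ≤ -1 := by exact_mod_cast (by omega : k b ≤ -1)
  set t := ∑ j, w j - ∑ j, v j with ht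
  have h1 : w a - v a = k a + t * q a := by have := h a; rw [ht]; linarith
  have h2 : w b - v b = k b + t * q b := by have := h b; rw [ht]; linarith
  have h3 : 0 < t * q b := by have := hv b; have := hw b; linarith
  have h4 : 0 < t := pos_of_mul_pos_left h3 (hq0 b).le
  have h5 : t * q a ≤ 0 := by have := hv a; have := hw a; linarith
  have := mul_pos h4 (hq0 a)
  linarith

theorem ae_cubeLaw_mem (m : ℕ) : ∀ᵐ u ∂cubeLaw m, ∀ i, u i ∈ Set.Ioo (0 : ℝ) 1 := by
  rw [ae_all_iff]
  intro i
  have h : ∀ᵐ x ∂(volume.restrict (Set.Ioo (0 : ℝ) 1)), x ∈ Set.Ioo (0 : ℝ) 1 :=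
    ae_restrict_mem measurableSet_Ioo
  exact (measurePreserving_eval (fun _ : Fin m => volume.restrict (Set.Ioo (0 : ℝ) 1)) i
    ).quasiMeasurePreserving.ae h

theorem ae_sourceLaw_mem {m : ℕ} (P : Measure (Fin m → ℝ)) [IsProbabilityMeasure P]
    (q : (Fin m → ℝ) → Fin m → ℝ) :
    ∀ᵐ z ∂sourceLaw P q, ∀ i, z.2.1 i ∈ Set.Ioo (0 : ℝ) 1 := by
  rw [sourceLaw, ← Measure.sum_fintype, Measure.ae_sum_iff]
  intro j
  have hm : Measurable fun z : (Fin m → ℝ) × (Fin m → ℝ) => (z.1, z.2, j) := by fun_prop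
  refine (ae_map_iff hm.aemeasurable ?_).2 ?_
  · have : {z : (Fin m → ℝ) × (Fin m → ℝ) × Fin m | ∀ i, z.2.1 i ∈ Set.Ioo (0 : ℝ) 1} =
        ⋂ i, {z | z.2.1 i ∈ Set.Ioo (0 : ℝ) 1} := by ext; simp
    rw [this]
    refine MeasurableSet.iInter fun i => ?_
    have hi : Measurable fun z : (Fin m → ℝ) × (Fin m → ℝ) × Fin m => z.2.1 i := by fun_prop
    exact hi measurableSet_Ioo
  · exact Measure.quasiMeasurePreserving_snd.ae (ae_cubeLaw_mem m)

theorem ae_sourceLaw_fst {m : ℕ} {P : Measure (Fin m → ℝ)} [IsProbabilityMeasure P]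
    {q : (Fin m → ℝ) → Fin m → ℝ} {S : Set (Fin m → ℝ)} (hS : MeasurableSet S)
    (h : ∀ᵐ p ∂P, p ∈ S) : ∀ᵐ z ∂sourceLaw P q, z.1 ∈ S := by
  rw [sourceLaw, ← Measure.sum_fintype, Measure.ae_sum_iff]
  intro j
  have hm : Measurable fun z : (Fin m → ℝ) × (Fin m → ℝ) => (z.1, z.2, j) := by fun_prop
  refine (ae_map_iff hm.aemeasurable (measurable_fst hS)).2 ?_
  exact Measure.quasiMeasurePreserving_fst.ae
    ((withDensity_absolutelyContinuous _ _).ae_le h)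

open scoped FourierTransform in
theorem fourierChar_eq_exp (x : ℝ) :
    ((𝐞 x : Circle) : ℂ) = Complex.exp (((2 * Real.pi * x : ℝ) : ℂ) * Complex.I) := by
  rw [Real.fourierChar_apply]

open scoped FourierTransform in
/-- If `Δ N + N p` is an integer vector with sum `N`, then `(p, Δ N)` modulo `1` converges in
distribution to `(p, X)` modulo `1`, where `X` is the projection of the random boundary point. -/
theorem tendsto_integral_mFourier_pairTorus {n : ℕ} {Ω : Type*} [MeasurableSpace Ω] {μ : Measure Ω}
    [IsProbabilityMeasure μ] {p : Ω → Fin (n + 1) → ℝ} (hp : Measurable p)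
    (hac : μ.map p ≪ shareVolume (n + 1)) {q c : (Fin (n + 1) → ℝ) → Fin (n + 1) → ℝ}
    (hq : Measurable q) (hc : Measurable c)
    (hq0 : ∀ x ∈ shareSimplex (n + 1), ∀ i, 0 < q x i)
    (hq1 : ∀ x ∈ shareSimplex (n + 1), ∑ i, q x i = 1)
    (hc0 : ∀ x ∈ shareSimplex (n + 1), ∑ i, c x i = 0)
    {Δ : ℕ → Ω → Fin (n + 1) → ℝ}
    (hΔ : ∀ᶠ N : ℕ in atTop, ∀ᵐ ω ∂μ, ∑ i, Δ N ω i = 0 ∧ ∀ i, ∃ a : ℤ, Δ N ω i = a - N * p ω i)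
    (k : Fin (n + 1) ⊕ Fin (n + 1) → ℤ) :
    Tendsto (fun N => ∫ ω, UnitAddTorus.mFourier k (pairTorus _ (p ω, Δ N ω)) ∂μ) atTop
      (𝓝 (∫ z, UnitAddTorus.mFourier k (pairTorus _ (z.1, shadowPoint q c z))
        ∂sourceLaw (μ.map p) q)) := by
  set P := μ.map p with hP
  have : IsProbabilityMeasure P := Measure.isProbabilityMeasure_map hp.aemeasurable
  have hS := ae_mem_shareSimplex hac
  have hw : IsAEWeight P q := ⟨hq, hS.mono fun x hx i => (hq0 x hx i).le, hS.mono hq1⟩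
  simp only [mFourier_pairTorus]
  rw [hw.integral_exp_sourceLaw hc (fun i => 2 * Real.pi * k (Sum.inl i))
    (fun i => 2 * Real.pi * k (Sum.inr i))]
  have hpS : ∀ᵐ ω ∂μ, p ω ∈ shareSimplex (n + 1) := by
    have := (ae_map_iff hp.aemeasurable (measurableSet_shareSimplex (n + 1))).1 hS
    exact this
  by_cases hl : ∃ i j, k (Sum.inr i) ≠ k (Sum.inr j)
  · -- a nontrivial character: both sides vanish in the limit
    have h0 : ∫ x, Complex.exp (((∑ i, 2 * Real.pi * k (Sum.inl i) * x i +
        ∑ i, 2 * Real.pi * k (Sum.inr i) * c x i : ℝ) : ℂ) * Complex.I) *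
        shadowChar (q x) (fun i => 2 * Real.pi * k (Sum.inr i)) ∂P = 0 := by
      refine integral_eq_zero_of_ae ?_
      filter_upwards [hS] with x hx
      rw [shadowChar_eq_zero (hq0 x hx) (hq1 x hx) hl]
      simp
    rw [h0]
    have hl' : ∃ i j, (k (Sum.inr i) : ℝ) ≠ k (Sum.inr j) := by
      obtain ⟨i, j, hij⟩ := hl
      exact ⟨i, j, by exact_mod_cast hij⟩
    refine (tendsto_integral_exp_shareSimplex hac (fun i => (k (Sum.inl i) : ℝ))
      (fun i => (k (Sum.inr i) : ℝ)) hl').congr' ?_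
    filter_upwards [hΔ] with N hN
    rw [hP, integral_map hp.aemeasurable
      (by
        refine Continuous.aestronglyMeasurable ?_
        exact continuous_subtype_val.comp (Real.continuous_fourierChar.comp (by fun_prop)))]
    refine integral_congr_ae ?_
    filter_upwards [hN] with ω hω
    choose a ha using hω.2
    rw [fourierChar_eq_exp, Complex.exp_eq_exp_iff_exists_int]
    refine ⟨-∑ i, k (Sum.inr i) * a i, ?_⟩
    have h1 : ∑ i, 2 * Real.pi * (k (Sum.inr i) : ℝ) * Δ N ω i =
        2 * Real.pi * ((∑ i, k (Sum.inr i) * a i : ℤ) : ℝ) -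
          2 * Real.pi * (N * ∑ i, (k (Sum.inr i) : ℝ) * p ω i) := by
      push_cast
      simp only [Finset.mul_sum, ← Finset.sum_sub_distrib]
      exact Finset.sum_congr rfl fun i _ => by rw [ha i]; ring
    have h2 : ∑ i, 2 * Real.pi * (k (Sum.inl i) : ℝ) * p ω i =
        2 * Real.pi * ∑ i, (k (Sum.inl i) : ℝ) * p ω i := by
      rw [Finset.mul_sum]; exact Finset.sum_congr rfl fun i _ => by ring
    rw [h1, h2]
    push_cast
    ring
  · -- a character that depends on the coordinate sum only
    push Not at hl
    have hconst : ∀ y : Fin (n + 1) → ℝ, ∑ i, y i = 0 →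
        ∑ i, 2 * Real.pi * (k (Sum.inr i) : ℝ) * y i = 0 := by
      intro y hy
      have : ∀ i, 2 * Real.pi * (k (Sum.inr i) : ℝ) * y i =
          2 * Real.pi * (k (Sum.inr 0) : ℝ) * y i := fun i => by rw [hl i 0]
      rw [Finset.sum_congr rfl fun i _ => this i, ← Finset.mul_sum, hy, mul_zero]
    have hone : ∀ x ∈ shareSimplex (n + 1),
        shadowChar (q x) (fun i => 2 * Real.pi * k (Sum.inr i)) = 1 := by
      intro x hx
      have : ∀ j, (∑ i, 2 * Real.pi * (k (Sum.inr i) : ℝ) * q x i) -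
          2 * Real.pi * k (Sum.inr j) = 0 := by
        intro j
        have : ∀ i, 2 * Real.pi * (k (Sum.inr i) : ℝ) * q x i =
          2 * Real.pi * (k (Sum.inr j) : ℝ) * q x i := fun i => by rw [hl i j]
        rw [Finset.sum_congr rfl fun i _ => this i, ← Finset.mul_sum, hq1 x hx]
        ring
      simp only [shadowChar, this, unifChar_zero, Finset.prod_const_one, mul_one]
      rw [← Complex.ofReal_sum, hq1 x hx, Complex.ofReal_one]
    refine tendsto_const_nhds.congr' ?_
    filter_upwards [hΔ] with N hN
    rw [hP, integral_map hp.aemeasurable]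
    · refine integral_congr_ae ?_
      filter_upwards [hN, hpS] with ω hω hx
      rw [hone _ hx, hconst _ hω.1, hconst _ (hc0 _ hx), mul_one]
    · refine AEStronglyMeasurable.congr (f := fun x : Fin (n + 1) → ℝ =>
        Complex.exp (((∑ i, 2 * Real.pi * k (Sum.inl i) * x i : ℝ) : ℂ) * Complex.I)) ?_ ?_
      · exact Continuous.aestronglyMeasurable (by fun_prop)
      · filter_upwards [hS] with x hx
        rw [hone _ hx, hconst _ (hc0 _ hx), mul_one, add_zero]

theorem exists_int_sub_eq_of_coe_eq {x y : ℝ} (h : (x : UnitAddCircle) = y) :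
    ∃ a : ℤ, x - y = a := by
  rw [← sub_eq_zero, ← AddCircle.coe_sub, AddCircle.coe_eq_zero_iff] at h
  obtain ⟨a, ha⟩ := h
  exact ⟨a, by rw [← ha]; simp⟩

/-- The master limit theorem. An excess vector that is determined modulo `1` by `N p`, and
that eventually lies in the projection along `q p` of the cube `c p - [0, 1] ^ m`, converges in
distribution to the projection of a random point of the lower boundary of the cube. -/
theorem tendsto_law_of_mem_shadowSet {n : ℕ} {Ω : Type*} [MeasurableSpace Ω] {μ : Measure Ω}
    [IsProbabilityMeasure μ] {p : Ω → Fin (n + 1) → ℝ} (hp : Measurable p)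
    (hac : μ.map p ≪ shareVolume (n + 1)) {q c : (Fin (n + 1) → ℝ) → Fin (n + 1) → ℝ}
    (hq : Continuous q) (hc : Continuous c)
    (hq0 : ∀ x ∈ shareSimplex (n + 1), ∀ i, 0 < q x i)
    (hq1 : ∀ x ∈ shareSimplex (n + 1), ∑ i, q x i = 1)
    (hc0 : ∀ x ∈ shareSimplex (n + 1), ∑ i, c x i = 0)
    {Δ : ℕ → Ω → Fin (n + 1) → ℝ} (hΔm : ∀ N, Measurable (Δ N))
    (hΔ : ∀ᶠ N : ℕ in atTop, ∀ᵐ ω ∂μ, ∑ i, Δ N ω i = 0 ∧ ∀ i, ∃ a : ℤ, Δ N ω i = a - N * p ω i)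
    (hΔK : ∀ᵐ ω ∂μ, ∀ᶠ N : ℕ in atTop, (p ω, Δ N ω) ∈ shadowSet q c)
    {Ω' : Type*} [MeasurableSpace Ω'] {μ' : Measure Ω'} [IsProbabilityMeasure μ']
    {X : Ω' → Fin (n + 1) → ℝ}
    (hX : HasLaw X ((sourceLaw (μ.map p) q).map (shadowPoint q c)) μ') :
    TendstoInDistribution Δ atTop X (fun _ => μ) μ' := by
  set P := μ.map p with hP
  have : IsProbabilityMeasure P := Measure.isProbabilityMeasure_map hp.aemeasurable
  have hS := ae_mem_shareSimplex hac
  have hw : IsAEWeight P q := ⟨hq.measurable, hS.mono fun x hx i => (hq0 x hx i).le, hS.mono hq1⟩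
  have : IsProbabilityMeasure (sourceLaw P q) := hw.isProbabilityMeasure_sourceLaw
  have hsm := measurable_shadowPoint hq.measurable hc.measurable
  have hKc := isCompact_shadowSet hq hc
  have hT := continuous_pairTorus (n + 1)
  have hW : ∀ N, Measurable fun ω => pairTorus _ (p ω, Δ N ω) := fun N =>
    hT.measurable.comp (hp.prodMk (hΔm N))
  have hW0 : Measurable fun z : (Fin (n + 1) → ℝ) × (Fin (n + 1) → ℝ) × Fin (n + 1) =>
      pairTorus _ (z.1, shadowPoint q c z) := hT.measurable.comp (measurable_fst.prodMk hsm)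
  have htor : TendstoInDistribution (fun N ω => pairTorus _ (p ω, Δ N ω)) atTop
      (fun z => pairTorus _ (z.1, shadowPoint q c z)) (fun _ => μ) (sourceLaw P q) := by
    refine ⟨fun N => (hW N).aemeasurable, hW0.aemeasurable, ?_⟩
    refine tendsto_of_tendsto_integral_mFourier fun k => ?_
    simp only [ProbabilityMeasure.coe_mk]
    have := tendsto_integral_mFourier_pairTorus hp hac hq.measurable hc.measurable hq0 hq1 hc0 hΔ k
    rw [integral_map hW0.aemeasurable (ContinuousMap.continuous _).aestronglyMeasurable]
    refine this.congr fun N => ?_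
    rw [integral_map (hW N).aemeasurable (ContinuousMap.continuous _).aestronglyMeasurable]
  -- the probability that the excess is not in the projected cube tends to `0`
  have hbad : Tendsto (fun N => μ {ω | (p ω, Δ N ω) ∉ shadowSet q c}) atTop (𝓝 0) := by
    have hms : ∀ N, MeasurableSet {ω | (p ω, Δ N ω) ∉ shadowSet q c} := fun N =>
      (hp.prodMk (hΔm N)) hKc.isClosed.measurableSet.compl
    have := tendsto_measure_of_ae_tendsto_indicator_of_isFiniteMeasure (μ := μ) atTop
      (A := ∅) MeasurableSet.empty hms ?_
    · simpa using this
    · filter_upwards [hΔK] with ω hω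
      filter_upwards [hω] with N hN
      simpa using hN
  refine ⟨fun N => (hΔm N).aemeasurable, hX.aemeasurable, ?_⟩
  refine tendsto_of_forall_isClosed_limsup_le' fun F hF => ?_
  simp only [ProbabilityMeasure.coe_mk]
  -- the image in the torus of the part over `F` of the projected cube, which is closed as the
  -- projected cube is compact
  set G := pairTorus (n + 1) '' (shadowSet q c ∩ Set.univ ×ˢ F) with hG
  have hGc : IsClosed G :=
    ((hKc.inter_right (isClosed_univ.prod hF)).image hT).isClosed
  have hlim := ProbabilityMeasure.limsup_measure_closed_le_of_tendsto htor.tendsto hGc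
  simp only [ProbabilityMeasure.coe_mk] at hlim
  have h1 : ∀ N, (μ.map (Δ N)) F ≤ (μ.map fun ω => pairTorus _ (p ω, Δ N ω)) G +
      μ {ω | (p ω, Δ N ω) ∉ shadowSet q c} := by
    intro N
    rw [Measure.map_apply (hΔm N) hF.measurableSet, Measure.map_apply (hW N) hGc.measurableSet]
    refine (measure_mono ?_).trans (measure_union_le _ _)
    intro ω hω
    by_cases hmem : (p ω, Δ N ω) ∈ shadowSet q c
    · exact Or.inl ⟨_, ⟨hmem, trivial, hω⟩, rfl⟩
    · exact Or.inr hmem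
  -- the limit point has no other representative in the projected closed cube, so that `G` is hit
  -- only if `F` is
  have h2 : ((sourceLaw P q).map fun z => pairTorus _ (z.1, shadowPoint q c z)) G ≤
      (μ'.map X) F := by
    rw [hX.map_eq, Measure.map_apply hW0 hGc.measurableSet, Measure.map_apply hsm hF.measurableSet]
    refine measure_mono_ae ?_
    filter_upwards [ae_sourceLaw_mem P q,
      ae_sourceLaw_fst (q := q) (measurableSet_shareSimplex _) hS]
      with z hu hz hmem
    obtain ⟨y, ⟨⟨⟨x, w⟩, ⟨hx, hwI⟩, rfl⟩, -, hyF⟩, heq⟩ := hmem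
    simp only at hx hwI hyF heq ⊢
    have hl : ∀ i, ((x i : ℝ) : UnitAddCircle) = z.1 i := fun i => by
      simpa [pairTorus] using congrFun heq (Sum.inl i)
    have hr : ∀ i, ((q x i * ∑ j, w j - w i + c x i : ℝ) : UnitAddCircle) =
        shadowPoint q c z i := fun i => by
      simpa only [pairTorus, Sum.elim_inr] using congrFun heq (Sum.inr i)
    -- `x` and `z.1` agree modulo `1`, with entries in `[0, 1]` and in `(0, 1)`
    have hxz : x = z.1 := by
      ext i
      obtain ⟨a, ha⟩ := exists_int_sub_eq_of_coe_eq (hl i)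
      have hx1 : x i ≤ 1 := (mem_Icc_of_mem_stdSimplex hx i).2
      have h1 : (a : ℝ) < 1 := by have := (hz.1 i).1; linarith
      have h2 : (-1 : ℝ) < a := by have := (hz.1 i).2; have := hx.1 i; linarith
      have h3 : a < 1 := by exact_mod_cast h1
      have h4 : -1 < a := by exact_mod_cast h2
      have h5 : a = 0 := by omega
      rw [h5, Int.cast_zero] at ha
      linarith
    subst hxz
    choose a ha using fun i => exists_int_sub_eq_of_coe_eq (hr i).symm
    have hsumz : ∀ V : Fin (n + 1) → ℝ,
        ∑ i, (q z.1 i * ∑ j, V j - V i + c z.1 i) = 0 := by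
      intro V
      rw [Finset.sum_add_distrib, Finset.sum_sub_distrib, ← Finset.sum_mul, hq1 _ hz, hc0 _ hz]
      ring
    have hasum : ∑ i, a i = 0 := by
      have : ((∑ i, a i : ℤ) : ℝ) = 0 := by
        push_cast
        rw [← Finset.sum_congr rfl fun i _ => ha i, Finset.sum_sub_distrib, hsumz]
        simp only [shadowPoint]
        rw [hsumz]
        ring
      exact_mod_cast this
    -- setting the coordinate `J` to `0` leaves a point of the half-open cube
    have ha0 : a = 0 := by
      refine shadow_injective (hq0 _ hz) (v := fun i => if z.2.2 ≠ i then z.2.1 i else 0) (w := w)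
        (c := c z.1) (fun i => ?_) (fun i => ⟨hwI.1 i, hwI.2 i⟩) hasum ha
      have := hu i
      split_ifs
      · exact ⟨this.1.le, this.2⟩
      · exact ⟨le_rfl, one_pos⟩
    have hyX : (fun i => q z.1 i * ∑ j, w j - w i + c z.1 i) = shadowPoint q c z := by
      ext i
      have := ha i
      rw [ha0] at this
      simp only [Pi.zero_apply, Int.cast_zero] at this
      linarith
    rw [hyX] at hyF
    exact hyF
  calc limsup (fun N => (μ.map (Δ N)) F) atTop
      ≤ limsup (fun N => (μ.map fun ω => pairTorus _ (p ω, Δ N ω)) G +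
          μ {ω | (p ω, Δ N ω) ∉ shadowSet q c}) atTop := limsup_le_limsup (Eventually.of_forall h1)
    _ = limsup (fun N => (μ.map fun ω => pairTorus _ (p ω, Δ N ω)) G) atTop :=
        ENNReal.limsup_add_of_right_tendsto_zero hbad _
    _ ≤ _ := hlim.trans h2

/-! ### Allocations lie in the projected cube -/

/-- The offset of the limiting seat excess for the `β`-linear divisor method. -/
noncomputable def divisorOffset (β : ℝ) (m : ℕ) (p : Fin m → ℝ) (i : Fin m) : ℝ :=
  (β - 1) * (m * p i - 1)

/-- The offset of the limiting seat excess for the `γ`-quota method. -/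
noncomputable def quotaOffset (γ : ℝ) (m : ℕ) (p : Fin m → ℝ) (i : Fin m) : ℝ :=
  γ * (p i - 1 / m)

theorem sum_seatExcess {m N : ℕ} {p : Fin m → ℝ} {s : Fin m → ℤ} (hs : ∑ i, s i = N)
    (hp : ∑ i, p i = 1) : ∑ i, seatExcess N p s i = 0 := by
  have : ∑ i, (s i : ℝ) = N := by exact_mod_cast hs
  simp only [seatExcess, Finset.sum_sub_distrib, ← Finset.mul_sum, hp, this]
  ring

/-- The seats of a divisor method stay within a bounded distance of the proportional seats for the
reciprocal of the divisor, which in turn is within a bounded distance of the house size. -/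
theorem IsDivisorAllocation.exists_multiplier {m N : ℕ} {β : ℝ} {p : Fin m → ℝ} {s : Fin m → ℤ}
    (h : IsDivisorAllocation β N p s) (hp0 : ∀ i, 0 ≤ p i) (hp1 : ∑ i, p i = 1) :
    ∃ t : ℝ, |N - t| ≤ m * (|β| + 1) ∧ ∀ i, |s i - t * p i| ≤ |β| + 1 ∧
      ∃ n : ℤ, IsRounding β (t * p i) n ∧ s i = max n 0 := by
  obtain ⟨hs, D, hD, hr⟩ := h
  have hbd : ∀ i, |s i - D⁻¹ * p i| ≤ |β| + 1 := by
    intro i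
    obtain ⟨n, ⟨h1, h2⟩, h3⟩ := hr i
    have h3' : (s i : ℝ) = max (n : ℝ) 0 := by rw [h3]; push_cast; rfl
    have h0 : 0 ≤ D⁻¹ * p i := mul_nonneg (inv_nonneg.2 hD.le) (hp0 i)
    rw [div_eq_inv_mul] at h1 h2
    have hb := abs_le.1 (le_refl |β|)
    rw [h3', abs_le]
    refine ⟨?_, ?_⟩
    · have := le_max_left (n : ℝ) 0; linarith
    · have : max (n : ℝ) 0 ≤ D⁻¹ * p i + (|β| + 1) := max_le (by linarith) (by linarith)
      linarith
  refine ⟨D⁻¹, ?_, fun i => ⟨hbd i, ?_⟩⟩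
  · have h1 : (N : ℝ) - D⁻¹ = ∑ i, ((s i : ℝ) - D⁻¹ * p i) := by
      have : ∑ i, (s i : ℝ) = N := by exact_mod_cast hs
      rw [Finset.sum_sub_distrib, ← Finset.mul_sum, hp1, this, mul_one]
    rw [h1]
    refine (Finset.abs_sum_le_sum_abs _ _).trans ((Finset.sum_le_sum fun i _ => hbd i).trans ?_)
    simp [mul_add]
  · obtain ⟨n, hn, hsn⟩ := hr i
    exact ⟨n, by rwa [← div_eq_inv_mul], hsn⟩

theorem IsDivisorAllocation.abs_seatExcess_le {m N : ℕ} {β : ℝ} {p : Fin m → ℝ} {s : Fin m → ℤ}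
    (h : IsDivisorAllocation β N p s) (hp0 : ∀ i, 0 ≤ p i) (hp1 : ∑ i, p i = 1) (i : Fin m) :
    |seatExcess N p s i| ≤ (m + 1) * (|β| + 1) := by
  obtain ⟨t, ht, hi⟩ := h.exists_multiplier hp0 hp1
  have h1 : seatExcess N p s i = (s i - t * p i) - (N - t) * p i := by rw [seatExcess]; ring
  have h2 : p i ≤ 1 := by
    rw [← hp1]; exact Finset.single_le_sum (fun j _ => hp0 j) (Finset.mem_univ i)
  have h3 : |(N - t) * p i| ≤ m * (|β| + 1) := by
    rw [abs_mul, abs_of_nonneg (hp0 i)]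
    exact (mul_le_of_le_one_right (abs_nonneg _) h2).trans ht
  rw [h1]
  have := abs_sub (s i - t * p i) ((N - t) * p i)
  have := (hi i).1
  linarith

/-- In a large house no rounding is negative, and the excess lies in the projected cube. -/
theorem IsDivisorAllocation.mem_shadowSet {m N : ℕ} {β : ℝ} {p : Fin m → ℝ} {s : Fin m → ℤ}
    (h : IsDivisorAllocation β N p s) (hp : p ∈ shareSimplex m)
    (hN : ∀ i, β ≤ (N - m * (|β| + 1)) * p i) :
    (p, seatExcess N p s) ∈ shadowSet id (divisorOffset β m) := by
  obtain ⟨t, ht, hi⟩ := h.exists_multiplier (fun i => (hp.1 i).1.le) hp.2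
  have hround : ∀ i, IsRounding β (t * p i) (s i) := by
    intro i
    obtain ⟨n, hn, hsn⟩ := (hi i).2
    have h1 : (N - m * (|β| + 1)) * p i ≤ t * p i :=
      mul_le_mul_of_nonneg_right (by have := (abs_le.1 ht).2; linarith) (hp.1 i).1.le
    have h2 : (0 : ℝ) ≤ n := by have := hn.1; have := hN i; linarith
    have h3 : s i = n := by rw [hsn, max_eq_left (by exact_mod_cast h2)]
    rw [h3]; exact hn
  -- the point of the cube consists of the rounding errors
  refine ⟨(p, fun i => t * p i - β + 1 - s i), ⟨shareSimplex_subset_stdSimplex m hp, ?_, ?_⟩, ?_⟩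
  · intro i; have := (hround i).2; simp only [Pi.zero_apply]; linarith
  · intro i; have := (hround i).1; simp only [Pi.one_apply]; linarith
  · have hs : ∑ i, (s i : ℝ) = N := by exact_mod_cast h.1
    have hsum : ∑ i, (t * p i - β + 1 - s i) = t - m * (β - 1) - N := by
      simp only [Finset.sum_sub_distrib, Finset.sum_add_distrib, ← Finset.mul_sum, hp.2, hs,
        Finset.sum_const, Finset.card_univ, Fintype.card_fin, nsmul_eq_mul]
      ring
    ext i
    · rfl
    · simp only [hsum, id, divisorOffset, seatExcess]
      ring

/-- For a large house the shift `α` of a quota method is bounded, also when negative seat numbers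
are replaced by `0`. -/
theorem IsQuotaAllocation.exists_shift {m N : ℕ} {γ : ℝ} {p : Fin m → ℝ} {s : Fin m → ℤ}
    (h : IsQuotaAllocation γ N p s) (hm : 0 < m) (hp0 : ∀ i, 0 ≤ p i) (hp1 : ∑ i, p i = 1)
    (hN : m * |γ| + 1 ≤ N + γ) :
    ∃ α : ℝ, |α| ≤ |γ| + 1 ∧ ∀ i, ∃ n : ℤ, IsRounding α ((N + γ) * p i) n ∧
      (s i = n ∨ s i = max n 0) := by
  obtain ⟨hs, hr⟩ := h
  have hs' : ∑ i, (s i : ℝ) = N := by exact_mod_cast hs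
  have hγ := abs_le.1 (le_refl |γ|)
  have hm1 : (1 : ℝ) ≤ m := by exact_mod_cast hm
  have hsum : ∀ b : ℝ, ∑ i, ((N + γ) * p i + b) = N + γ + m * b := by
    intro b
    rw [Finset.sum_add_distrib, ← Finset.mul_sum, hp1, mul_one]
    simp
  -- the lower bound for the seats bounds the shift from below
  have hlow : ∀ α : ℝ, (∀ i, (N + γ) * p i - α ≤ s i) → -(|γ| + 1) ≤ α := by
    intro α hα
    have h1 := Finset.sum_le_sum fun i (_ : i ∈ Finset.univ) => hα i
    simp only [sub_eq_add_neg, hsum, hs'] at h1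
    by_contra! hcon
    nlinarith
  rcases hr with ⟨α, hα⟩ | ⟨α, hα⟩
  · refine ⟨α, abs_le.2 ⟨hlow α fun i => (hα i).1, ?_⟩, fun i => ⟨s i, hα i, Or.inl rfl⟩⟩
    have h1 := Finset.sum_le_sum fun i (_ : i ∈ Finset.univ) => (hα i).2
    simp only [sub_eq_add_neg, add_assoc _ (-α), hsum, hs'] at h1
    by_contra! hcon
    nlinarith
  · refine ⟨α, abs_le.2 ⟨hlow α fun i => ?_, ?_⟩, fun i => ?_⟩
    · obtain ⟨n, hn, hsn⟩ := hα i
      have : (n : ℝ) ≤ s i := by rw [hsn]; exact_mod_cast le_max_left n 0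
      linarith [hn.1]
    · -- with a larger shift no party would exceed its quota `(N + γ) * p i`, and a party
      -- with `1 / m ≤ p i` would stay more than `|γ|` below it, so that the total would be
      -- below `N`
      by_contra! hcon
      have ha : 0 ≤ N + γ := by nlinarith [abs_nonneg γ]
      have hub : ∀ i, (s i : ℝ) ≤ max ((N + γ) * p i - α + 1) 0 := by
        intro i
        obtain ⟨n, hn, hsn⟩ := hα i
        rw [hsn]
        push_cast
        exact max_le_max hn.2 le_rfl
      have hle : ∀ i, (s i : ℝ) ≤ (N + γ) * p i := fun i =>
        (hub i).trans (max_le (by linarith) (mul_nonneg ha (hp0 i)))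
      have : ∃ i, 1 / (m : ℝ) ≤ p i := by
        by_contra! hlt
        have : Nonempty (Fin m) := ⟨⟨0, hm⟩⟩
        have := Finset.sum_lt_sum_of_nonempty Finset.univ_nonempty fun i _ => hlt i
        rw [hp1] at this
        simp only [Finset.sum_const, Finset.card_univ, Fintype.card_fin, nsmul_eq_mul] at this
        rw [mul_one_div_cancel (by positivity)] at this
        exact lt_irrefl _ this
      obtain ⟨i₀, hi₀⟩ := this
      have hi₀' : |γ| < (N + γ) * p i₀ := by
        have h1 : (N + γ) * (1 / m) ≤ (N + γ) * p i₀ := mul_le_mul_of_nonneg_left hi₀ ha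
        have h2 : |γ| < (N + γ) * (1 / m) := by
          rw [mul_one_div, lt_div_iff₀ (by positivity)]
          linarith
        linarith
      have hlt : (s i₀ : ℝ) < (N + γ) * p i₀ - |γ| :=
        (hub i₀).trans_lt (max_lt (by linarith) (by linarith))
      have h1 : ∑ i, (s i : ℝ) < ∑ i, ((N + γ) * p i - if i = i₀ then |γ| else 0) := by
        refine Finset.sum_lt_sum (fun i _ => ?_) ⟨i₀, Finset.mem_univ _, by simpa using hlt⟩
        split_ifs with hii
        · rw [hii]; exact hlt.le
        · rw [sub_zero]; exact hle i
      rw [Finset.sum_sub_distrib, ← Finset.mul_sum, hp1, hs', Finset.sum_ite_eq' Finset.univ i₀]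
        at h1
      simp only [Finset.mem_univ, if_true] at h1
      linarith
    · obtain ⟨n, hn, hsn⟩ := hα i
      exact ⟨n, hn, Or.inr hsn⟩

theorem IsQuotaAllocation.abs_seatExcess_le {m N : ℕ} {γ : ℝ} {p : Fin m → ℝ} {s : Fin m → ℤ}
    (h : IsQuotaAllocation γ N p s) (hm : 0 < m) (hp0 : ∀ i, 0 ≤ p i) (hp1 : ∑ i, p i = 1)
    (hN : m * |γ| + 1 ≤ N + γ) (i : Fin m) : |seatExcess N p s i| ≤ 2 * |γ| + 2 := by
  obtain ⟨α, hα, hi⟩ := h.exists_shift hm hp0 hp1 hN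
  obtain ⟨n, hn, hsn⟩ := hi i
  have h0 : 0 ≤ (N + γ) * p i := mul_nonneg (by nlinarith [abs_nonneg γ]) (hp0 i)
  have h2 : p i ≤ 1 := by
    rw [← hp1]; exact Finset.single_le_sum (fun j _ => hp0 j) (Finset.mem_univ i)
  have h3 : |γ * p i| ≤ |γ| := by
    rw [abs_mul, abs_of_nonneg (hp0 i)]
    exact mul_le_of_le_one_right (abs_nonneg _) h2
  have hα' := abs_le.1 hα
  have h3' := abs_le.1 h3
  have h4 : (n : ℝ) ≤ s i ∧ (s i : ℝ) ≤ max (n : ℝ) 0 := by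
    rcases hsn with hsn | hsn <;> rw [hsn]
    · exact ⟨le_rfl, le_max_left _ _⟩
    · push_cast; exact ⟨le_max_left _ _, le_rfl⟩
  have h5 : max (n : ℝ) 0 ≤ (N + γ) * p i + (|γ| + 2) :=
    max_le (by have := hn.2; linarith) (by have := abs_nonneg γ; linarith)
  have h6 := hn.1
  rw [seatExcess, abs_le]
  constructor <;> linarith [h4.1, h4.2]

/-- In a large house no rounding is negative, and the excess lies in the projected cube. -/
theorem IsQuotaAllocation.mem_shadowSet {m N : ℕ} {γ : ℝ} {p : Fin m → ℝ} {s : Fin m → ℤ}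
    (h : IsQuotaAllocation γ N p s) (hm : 0 < m) (hp : p ∈ shareSimplex m)
    (hN : m * |γ| + 1 ≤ N + γ) (hN' : ∀ i, |γ| + 1 ≤ (N + γ) * p i) :
    (p, seatExcess N p s) ∈ shadowSet (fun _ _ => 1 / (m : ℝ)) (quotaOffset γ m) := by
  obtain ⟨α, hα, hi⟩ := h.exists_shift hm (fun i => (hp.1 i).1.le) hp.2 hN
  have hround : ∀ i, IsRounding α ((N + γ) * p i) (s i) := by
    intro i
    obtain ⟨n, hn, hsn⟩ := hi i
    have h2 : (0 : ℝ) ≤ n := by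
      have := hn.1; have := hN' i; have := (abs_le.1 hα).2; linarith
    have h3 : s i = n := by
      rcases hsn with hsn | hsn
      · exact hsn
      · rw [hsn, max_eq_left (by exact_mod_cast h2)]
    rw [h3]; exact hn
  have hm0 : (m : ℝ) ≠ 0 := by positivity
  -- the point of the cube consists of the rounding errors
  refine ⟨(p, fun i => (N + γ) * p i - α + 1 - s i),
    ⟨shareSimplex_subset_stdSimplex m hp, ?_, ?_⟩, ?_⟩
  · intro i; have := (hround i).2; simp only [Pi.zero_apply]; linarith
  · intro i; have := (hround i).1; simp only [Pi.one_apply]; linarith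
  · have hs : ∑ i, (s i : ℝ) = N := by exact_mod_cast h.1
    have hsum : ∑ i, ((N + γ) * p i - α + 1 - s i) = γ - m * (α - 1) := by
      simp only [Finset.sum_sub_distrib, Finset.sum_add_distrib, ← Finset.mul_sum, hp.2, hs,
        Finset.sum_const, Finset.card_univ, Fintype.card_fin, nsmul_eq_mul]
      ring
    ext i
    · rfl
    · simp only [hsum, quotaOffset, seatExcess]
      field_simp
      ring

/-! ### Single coordinates of the limit -/

/-- The uniform distribution on `(-1/2, 1/2)`. -/
noncomputable def centredLaw : Measure ℝ := volume.restrict (Set.Ioo (-1 / 2 : ℝ) (1 / 2))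

instance isProbabilityMeasure_centredLaw : IsProbabilityMeasure centredLaw :=
  ⟨by norm_num [centredLaw]⟩

theorem integral_exp_centredLaw (s : ℝ) :
    ∫ x, Complex.exp (((s * x : ℝ) : ℂ) * Complex.I) ∂centredLaw =
      Complex.exp (((-(s / 2) : ℝ) : ℂ) * Complex.I) * unifChar s := by
  have h : centredLaw = (volume.restrict (Set.Ioo (0 : ℝ) 1)).map (fun x => x - 1 / 2) := by
    have hmp : MeasurePreserving (fun x : ℝ => x - 1 / 2) volume volume :=
      measurePreserving_sub_right volume (1 / 2 : ℝ)
    have hpre : (fun x : ℝ => x - 1 / 2) ⁻¹' Set.Ioo (-1 / 2 : ℝ) (1 / 2) = Set.Ioo 0 1 := by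
      rw [Set.preimage_sub_const_Ioo]; norm_num
    have := (hmp.restrict_preimage (measurableSet_Ioo (a := (-1 / 2 : ℝ)) (b := 1 / 2))).map_eq
    rw [hpre] at this
    rw [centredLaw, this]
  rw [h, integral_map (by fun_prop) (Continuous.aestronglyMeasurable (by fun_prop)), unifChar,
    ← integral_const_mul]
  congr 1; ext x
  rw [← Complex.exp_add, ← add_mul, ← Complex.ofReal_add]
  congr 3; ring

/-- For `0 < x < 1`, the mixture with weights `x` and `1 - x` of the uniform distributions on
`(0, x)` and `(x - 1, 0)` is the uniform distribution on `(x - 1, x)`, in terms of characteristic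
functions. -/
theorem mul_unifChar_add_mul_unifChar (t x : ℝ) :
    (x : ℂ) * unifChar (t * x) + (1 - x) * unifChar (t * x - t) =
      Complex.exp (((t * x - t : ℝ) : ℂ) * Complex.I) * unifChar t := by
  rcases eq_or_ne t 0 with rfl | ht
  · simp
  have hc : (t : ℂ) * Complex.I ≠ 0 := by simp [ht]
  refine mul_left_cancel₀ hc ?_
  have h1 := mul_unifChar (t * x)
  have h2 := mul_unifChar (t * x - t)
  have h3 := mul_unifChar t
  have h4 : Complex.exp (((t * x : ℝ) : ℂ) * Complex.I) =
      Complex.exp (((t * x - t : ℝ) : ℂ) * Complex.I) * Complex.exp ((t : ℂ) * Complex.I) := by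
    rw [← Complex.exp_add]; congr 1; push_cast; ring
  rw [h4] at h1
  push_cast at h1 h2 h3 ⊢
  linear_combination h1 - h2 - Complex.exp ((t * x - t) * Complex.I) * h3

/-- The characteristic function of a single coordinate of the projected boundary point. With
probability `q i` the last free coordinate is uniform on `(0, q i)`, and otherwise uniform
on `(q i - 1, 0)`; together these form one uniform variable on `(q i - 1, q i)`. -/
theorem shadowChar_single {m : ℕ} (hm : 2 ≤ m) {q : Fin m → ℝ} (hq1 : ∑ i, q i = 1) (i : Fin m)
    (t : ℝ) : shadowChar q (Pi.single i t) =
      Complex.exp (((t * ((m * q i - 1) / 2) : ℝ) : ℂ) * Complex.I) *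
        ((Complex.exp (((-(t / 2) : ℝ) : ℂ) * Complex.I) * unifChar t) *
        (Complex.exp (((-(t * q i / 2) : ℝ) : ℂ) * Complex.I) * unifChar (t * q i)) ^ (m - 2)) := by
  have hs : ∑ k, (Pi.single i t : Fin m → ℝ) k * q k = t * q i := by
    simp [Pi.single_apply]
  have hcard : (Finset.univ.erase i).card = m - 1 := by
    rw [Finset.card_erase_of_mem (Finset.mem_univ i), Finset.card_univ, Fintype.card_fin]
  have hi : ∏ k ∈ Finset.univ.erase i, unifChar (t * q i - (Pi.single i t : Fin m → ℝ) k) =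
      unifChar (t * q i) * unifChar (t * q i) ^ (m - 2) := by
    rw [Finset.prod_congr rfl fun k hk => by
      rw [Pi.single_eq_of_ne (Finset.ne_of_mem_erase hk), sub_zero]]
    rw [Finset.prod_const, hcard, ← pow_succ']
    congr 1; omega
  have hj : ∀ j ∈ Finset.univ.erase i,
      ∏ k ∈ Finset.univ.erase j, unifChar (t * q i - (Pi.single i t : Fin m → ℝ) k) =
      unifChar (t * q i - t) * unifChar (t * q i) ^ (m - 2) := by
    intro j hj
    have hij : i ∈ Finset.univ.erase j :=
      Finset.mem_erase.2 ⟨(Finset.ne_of_mem_erase hj).symm, Finset.mem_univ i⟩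
    rw [← Finset.mul_prod_erase _ _ hij, Pi.single_eq_same]
    rw [Finset.prod_congr rfl fun k hk => by
      rw [Pi.single_eq_of_ne (Finset.ne_of_mem_erase hk), sub_zero]]
    rw [Finset.prod_const, Finset.card_erase_of_mem hij,
      Finset.card_erase_of_mem (Finset.mem_univ j), Finset.card_univ, Fintype.card_fin]
    rfl
  have hq' : ∑ j ∈ Finset.univ.erase i, q j = 1 - q i := by
    rw [← hq1, ← Finset.add_sum_erase _ _ (Finset.mem_univ i)]; ring
  rw [shadowChar, hs, ← Finset.add_sum_erase _ _ (Finset.mem_univ i), hi,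
    Finset.sum_congr rfl fun j hjm => by rw [hj j hjm], ← Finset.sum_mul, ← Complex.ofReal_sum, hq']
  have hkey := mul_unifChar_add_mul_unifChar t (q i)
  have hexp : Complex.exp (((t * ((m * q i - 1) / 2) : ℝ) : ℂ) * Complex.I) *
      (Complex.exp (((-(t / 2) : ℝ) : ℂ) * Complex.I) *
      Complex.exp (((-(t * q i / 2) : ℝ) : ℂ) * Complex.I) ^ (m - 2)) =
      Complex.exp (((t * q i - t : ℝ) : ℂ) * Complex.I) := by
    rw [← Complex.exp_nat_mul, ← Complex.exp_add, ← Complex.exp_add]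
    congr 1
    push_cast [Nat.cast_sub hm]
    ring
  rw [mul_pow]
  calc _ = ((q i : ℂ) * unifChar (t * q i) + (1 - q i) * unifChar (t * q i - t)) *
        unifChar (t * q i) ^ (m - 2) := by push_cast; ring
    _ = _ := by rw [hkey, ← hexp]; ring

/-- The variables `T 0, …, T r` of a centred uniform sequence, together with the parties' sizes,
have the product law. -/
theorem IsCentredUniforms.hasLaw_prod {Ω : Type*} [MeasurableSpace Ω] {μ : Measure Ω}
    [IsProbabilityMeasure μ] {m : ℕ} {p : Ω → Fin m → ℝ} {T : ℕ → Ω → ℝ}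
    (h : IsCentredUniforms μ p T) {P : Measure (Fin m → ℝ)} (hp : HasLaw p P μ) (r : ℕ) :
    HasLaw (fun ω => (p ω, fun k : Fin (r + 1) => T k ω))
      (P.prod (Measure.pi fun _ : Fin (r + 1) => centredLaw)) μ := by
  have hT : ∀ k, HasLaw (T k) centredLaw μ := by
    intro k
    have hv : volume (Set.Ioo (-1 / 2 : ℝ) (1 / 2)) = 1 := by norm_num
    refine ⟨(h.uniform k).aemeasurable (by rw [hv]; simp) (by rw [hv]; simp), ?_⟩
    rw [h.uniform k, ProbabilityTheory.cond, hv, inv_one, one_smul, centredLaw]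
  have hpi : HasLaw (fun ω (k : Fin (r + 1)) => T k ω)
      (Measure.pi fun _ : Fin (r + 1) => centredLaw) μ :=
    (h.indep.precomp (g := fun k : Fin (r + 1) => (k : ℕ)) Fin.val_injective).hasLaw_pi
      fun k => hT k
  have hind : IndepFun p (fun ω (k : Fin (r + 1)) => T k ω) μ :=
    h.indep_share.comp (φ := id) (ψ := fun (x : ℕ → ℝ) (k : Fin (r + 1)) => x k) measurable_id
      (measurable_pi_lambda _ fun k => measurable_pi_apply _)
  exact (indepFun_iff_hasLaw_prodMk_prod hp hpi).1 hind

theorem sum_Icc_one_eq_sum_fin (r : ℕ) (t : ℕ → ℝ) :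
    ∑ k ∈ Finset.Icc 1 r, t k = ∑ k : Fin r, t (k + 1) := by
  rw [Fin.sum_univ_eq_sum_range (fun k => t (k + 1)), Finset.range_eq_Ico,
    Finset.sum_Ico_add' t 0 r 1]
  rfl

/-- The law of the `i`th coordinate of the projected boundary point, as the law of a sum of
independent centred uniform variables. -/
theorem IsCentredUniforms.map_eq_shadow_eval {Ω : Type*} [MeasurableSpace Ω] {μ : Measure Ω}
    [IsProbabilityMeasure μ] {m : ℕ} (hm : 2 ≤ m) {p : Ω → Fin m → ℝ} {T : ℕ → Ω → ℝ}
    (h : IsCentredUniforms μ p T) {P : Measure (Fin m → ℝ)} [IsProbabilityMeasure P]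
    (hp : HasLaw p P μ) {q c : (Fin m → ℝ) → Fin m → ℝ} (hq : IsAEWeight P q) (hc : Measurable c)
    (i : Fin m) :
    HasLaw (fun ω => (c (p ω) i + (m * q (p ω) i - 1) / 2) + T 0 ω +
        q (p ω) i * ∑ k ∈ Finset.Icc 1 (m - 2), T k ω)
      (((sourceLaw P q).map (shadowPoint q c)).map fun x => x i) μ := by
  have hsrc := hq.isProbabilityMeasure_sourceLaw
  have hsm := measurable_shadowPoint hq.measurable hc
  have hqi : Measurable fun x => q x i := (measurable_pi_apply i).comp hq.measurable
  have hci : Measurable fun x => c x i := (measurable_pi_apply i).comp hc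
  have hlaw := h.hasLaw_prod hp (m - 2)
  let g : (Fin m → ℝ) × (Fin (m - 2 + 1) → ℝ) → ℝ := fun z =>
    (c z.1 i + (m * q z.1 i - 1) / 2) + (z.2 0 + q z.1 i * ∑ k : Fin (m - 2), z.2 k.succ)
  have hg : Measurable g := by
    have h1 : Measurable fun z : (Fin m → ℝ) × (Fin (m - 2 + 1) → ℝ) => q z.1 i :=
      hqi.comp measurable_fst
    have h2 : Measurable fun z : (Fin m → ℝ) × (Fin (m - 2 + 1) → ℝ) => c z.1 i :=
      hci.comp measurable_fst
    have h3 : ∀ k, Measurable fun z : (Fin m → ℝ) × (Fin (m - 2 + 1) → ℝ) => z.2 k :=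
      fun k => (measurable_pi_apply k).comp measurable_snd
    exact (h2.add (((h1.const_mul _).sub_const _).div_const _)).add
      ((h3 0).add (h1.mul (Finset.measurable_sum _ fun k _ => h3 _)))
  have hX : (fun ω => (c (p ω) i + (m * q (p ω) i - 1) / 2) + T 0 ω +
        q (p ω) i * ∑ k ∈ Finset.Icc 1 (m - 2), T k ω) =
      g ∘ fun ω => (p ω, fun k : Fin (m - 2 + 1) => T k ω) := by
    ext ω
    simp only [g, Function.comp, sum_Icc_one_eq_sum_fin (m - 2) fun k => T k ω, Fin.val_succ,
      Fin.val_zero]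
    ring
  rw [hX]
  refine ⟨hg.comp_aemeasurable hlaw.aemeasurable, ?_⟩
  rw [← AEMeasurable.map_map_of_aemeasurable hg.aemeasurable hlaw.aemeasurable, hlaw.map_eq,
    Measure.map_map (measurable_pi_apply i) hsm]
  have hm1 : Measurable ((fun x : Fin m → ℝ => x i) ∘ shadowPoint q c) :=
    (measurable_pi_apply i).comp hsm
  have : IsProbabilityMeasure ((P.prod (Measure.pi fun _ : Fin (m - 2 + 1) => centredLaw)).map g) :=
    Measure.isProbabilityMeasure_map hg.aemeasurable
  have : IsProbabilityMeasure ((sourceLaw P q).map ((fun x => x i) ∘ shadowPoint q c)) :=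
    Measure.isProbabilityMeasure_map hm1.aemeasurable
  refine Measure.ext_of_charFun (funext fun t => ?_)
  rw [charFun_apply_real, charFun_apply_real,
    integral_map hg.aemeasurable (Continuous.aestronglyMeasurable (by fun_prop)),
    integral_map hm1.aemeasurable (Continuous.aestronglyMeasurable (by fun_prop))]
  have hR := hq.integral_exp_sourceLaw hc 0 (Pi.single i t)
  have hsingle : ∀ x : Fin m → ℝ, ∑ k, (Pi.single i t : Fin m → ℝ) k * x k = t * x i := fun x => by
    simp [Pi.single_apply]
  simp only [Pi.zero_apply, zero_mul, Finset.sum_const_zero, zero_add, hsingle] at hR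
  have hR' : ∫ z, Complex.exp ((t : ℂ) * (((fun x : Fin m → ℝ => x i) ∘ shadowPoint q c) z : ℝ) *
      Complex.I) ∂sourceLaw P q = ∫ x, Complex.exp (((t * c x i : ℝ) : ℂ) * Complex.I) *
        shadowChar (q x) (Pi.single i t) ∂P := by
    rw [← hR]
    simp only [Function.comp, Complex.ofReal_mul]
  rw [hR', integral_prod]
  swap
  · refine Integrable.of_bound (C := 1) ?_ (ae_of_all _ fun z => ?_)
    · refine Measurable.aestronglyMeasurable ?_
      exact Complex.measurable_exp.comp
        (((Complex.measurable_ofReal.comp hg).const_mul _).mul_const _)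
    · rw [← Complex.ofReal_mul, Complex.norm_exp_ofReal_mul_I]
  refine integral_congr_ae ?_
  filter_upwards [hq.sum_eq_one] with x hx
  rw [shadowChar_single hm hx]
  have hprod := integral_exp_sum_pi centredLaw
    (Fin.cons t (fun _ => t * q x i) : Fin (m - 2 + 1) → ℝ)
  simp only [Fin.sum_univ_succ, Fin.prod_univ_succ, Fin.cons_zero, Fin.cons_succ,
    integral_exp_centredLaw, Finset.prod_const, Finset.card_univ, Fintype.card_fin] at hprod
  rw [← hprod, ← mul_assoc, ← Complex.exp_add, ← add_mul, ← Complex.ofReal_add,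
    ← integral_const_mul]
  congr 1; ext u
  rw [← Complex.exp_add, ← add_mul, ← Complex.ofReal_add, ← Complex.ofReal_mul]
  congr 3
  simp only [g, ← Finset.mul_sum]
  ring

/-! ### The limit laws of the two methods -/

/-- A finite measure on `ℝ ^ m` is determined by its characteristic function. -/
theorem ext_of_integral_exp {m : ℕ} {ρ₁ ρ₂ : Measure (Fin m → ℝ)} [IsFiniteMeasure ρ₁]
    [IsFiniteMeasure ρ₂]
    (h : ∀ b : Fin m → ℝ, ∫ x, Complex.exp (((∑ i, b i * x i : ℝ) : ℂ) * Complex.I) ∂ρ₁ =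
      ∫ x, Complex.exp (((∑ i, b i * x i : ℝ) : ℂ) * Complex.I) ∂ρ₂) : ρ₁ = ρ₂ := by
  refine Measure.ext_of_charFunDual (funext fun L => ?_)
  have hL : ∀ x, L x = ∑ i, L (Pi.single i 1) * x i := by
    intro x
    conv_lhs => rw [← Finset.univ_sum_single x]
    rw [map_sum]
    refine Finset.sum_congr rfl fun i _ => ?_
    have : (Pi.single i (x i) : Fin m → ℝ) = x i • Pi.single i (1 : ℝ) := by
      rw [← Pi.single_smul]; simp
    rw [this, map_smul, smul_eq_mul, mul_comm]
  have he : ∀ ρ : Measure (Fin m → ℝ), charFunDual ρ L =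
      ∫ x, Complex.exp (((∑ i, L (Pi.single i 1) * x i : ℝ) : ℂ) * Complex.I) ∂ρ := fun ρ => by
    rw [charFunDual_apply]
    congr 1; ext x
    rw [hL x]
  rw [he, he]
  exact h _

/-- Convergence in distribution depends on the limit variable through its law only. -/
theorem TendstoInDistribution.congr_law {Ω Ω' Ω'' E : Type*} [MeasurableSpace Ω]
    [MeasurableSpace Ω'] [MeasurableSpace Ω''] [TopologicalSpace E] [MeasurableSpace E]
    [OpensMeasurableSpace E] {μ : Measure Ω} [IsProbabilityMeasure μ] {μ' : Measure Ω'}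
    [IsProbabilityMeasure μ'] {μ'' : Measure Ω''} [IsProbabilityMeasure μ''] {X : ℕ → Ω → E}
    {Z : Ω' → E} {W : Ω'' → E} (h : TendstoInDistribution X atTop Z (fun _ => μ) μ')
    (hW : HasLaw W (μ'.map Z) μ'') : TendstoInDistribution X atTop W (fun _ => μ) μ'' := by
  refine ⟨h.forall_aemeasurable, hW.aemeasurable, ?_⟩
  have heq : (⟨μ''.map W, Measure.isProbabilityMeasure_map hW.aemeasurable⟩ :
        ProbabilityMeasure E) =
      ⟨μ'.map Z, Measure.isProbabilityMeasure_map h.aemeasurable_limit⟩ := Subtype.ext hW.map_eq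
  rw [heq]
  exact h.tendsto

/-- The joint law of the parties' sizes, the uniform variables and the random party. -/
theorem IsDivisorSource.hasLaw {Ω : Type*} [MeasurableSpace Ω] {μ : Measure Ω}
    [IsProbabilityMeasure μ] {m : ℕ} {p : Ω → Fin m → ℝ} {U : Fin m → Ω → ℝ} {J : Ω → Fin m}
    (h : IsDivisorSource μ p U J) (hpm : Measurable p) {P : Measure (Fin m → ℝ)}
    (hp : HasLaw p P μ) (hP : IsAEWeight P id) :
    HasLaw (fun ω => (p ω, (fun i => U i ω), J ω)) (sourceLaw P id) μ := by
  have : IsProbabilityMeasure P := by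
    rw [← hp.map_eq]; exact Measure.isProbabilityMeasure_map hpm.aemeasurable
  have hsrc := hP.isProbabilityMeasure_sourceLaw
  have hU : ∀ i, HasLaw (U i) (volume.restrict (Set.Ioo (0 : ℝ) 1)) μ := by
    intro i
    have hv : volume (Set.Ioo (0 : ℝ) 1) = 1 := by norm_num
    refine ⟨(h.uniform i).aemeasurable (by rw [hv]; simp) (by rw [hv]; simp), ?_⟩
    rw [h.uniform i, ProbabilityTheory.cond, hv, inv_one, one_smul]
  have hUl : HasLaw (fun ω i => U i ω) (cubeLaw m) μ := h.indep.hasLaw_pi hU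
  have hWm : AEMeasurable (fun ω => (p ω, (fun i => U i ω), J ω)) μ :=
    hpm.aemeasurable.prodMk (hUl.aemeasurable.prodMk h.measurable_index.aemeasurable)
  have hJ : ∀ j, MeasurableSet (J ⁻¹' {j}) := fun j =>
    h.measurable_index (measurableSet_singleton j)
  -- the conditional law of `J` given `p`, integrated over `p ∈ A`
  have hcond : ∀ (j : Fin m) {A : Set (Fin m → ℝ)}, MeasurableSet A →
      μ (p ⁻¹' A ∩ J ⁻¹' {j}) = ∫⁻ x in A, ENNReal.ofReal (x j) ∂P := by
    intro j A hA
    have hle : MeasurableSpace.comap p inferInstance ≤ (inferInstance : MeasurableSpace Ω) :=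
      hpm.comap_le
    have hint : Integrable ((J ⁻¹' {j}).indicator fun _ => (1 : ℝ)) μ :=
      (integrable_const (1 : ℝ)).indicator (hJ j)
    have h1 := setIntegral_condExp hle hint (s := p ⁻¹' A) ⟨A, hA, rfl⟩
    rw [setIntegral_congr_ae (hpm hA) ((h.cond_index j).mono fun ω hω _ => hω),
      setIntegral_indicator (hJ j)] at h1
    simp only [integral_const, smul_eq_mul, mul_one, measureReal_restrict_apply_univ] at h1
    have hae : ∀ᵐ ω ∂μ, ∀ j, 0 ≤ p ω j := by
      refine ae_of_ae_map hpm.aemeasurable (p := fun x : Fin m → ℝ => ∀ j, 0 ≤ x j) ?_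
      rw [hp.map_eq]; exact hP.nonneg
    have hae1 : ∀ᵐ ω ∂μ, ∀ j, p ω j ≤ 1 := by
      refine ae_of_ae_map hpm.aemeasurable (p := fun x : Fin m → ℝ => ∀ j, x j ≤ 1) ?_
      rw [hp.map_eq]; exact hP.le_one
    have hpj : Measurable fun ω => p ω j := (measurable_pi_apply j).comp hpm
    rw [← ofReal_measureReal, ← h1, ofReal_integral_eq_lintegral_ofReal]
    · rw [← hp.map_eq, setLIntegral_map hA (by fun_prop) hpm]
    · refine (Integrable.of_bound (C := 1) hpj.aestronglyMeasurable ?_).integrableOn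
      filter_upwards [hae, hae1] with ω h0 h1
      rw [Real.norm_of_nonneg (h0 j)]; exact h1 j
    · exact ae_restrict_of_ae (hae.mono fun ω hω => hω j)
  refine ⟨hWm, ?_⟩
  have : IsProbabilityMeasure (μ.map fun ω => (p ω, (fun i => U i ω), J ω)) :=
    Measure.isProbabilityMeasure_map hWm
  refine Measure.ext_prod₃ fun {A B C} hA hB hC => ?_
  have hABC : MeasurableSet (A ×ˢ B ×ˢ C) := hA.prod (hB.prod hC)
  have hL : μ ((fun ω => (p ω, (fun i => U i ω), J ω)) ⁻¹' A ×ˢ B ×ˢ C) =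
      μ (p ⁻¹' A ∩ J ⁻¹' C) * cubeLaw m B := by
    have h1 := h.indep_share.measure_inter_preimage_eq_mul _ _ (hA.prod hC) hB
    have h2 : μ ((fun ω i => U i ω) ⁻¹' B) = cubeLaw m B := by
      rw [← hUl.map_eq, Measure.map_apply_of_aemeasurable hUl.aemeasurable hB]
    rw [h2] at h1
    have e1 : (fun ω => (p ω, J ω)) ⁻¹' A ×ˢ C = p ⁻¹' A ∩ J ⁻¹' C := rfl
    rw [e1] at h1
    rw [← h1]
    congr 1; ext ω
    simp only [Set.mem_preimage, Set.mem_prod, Set.mem_inter_iff]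
    tauto
  classical
  have hsum : μ (p ⁻¹' A ∩ J ⁻¹' C) = ∑ j, if j ∈ C then μ (p ⁻¹' A ∩ J ⁻¹' {j}) else 0 := by
    rw [← Finset.sum_filter, ← measure_biUnion_finset]
    · congr 1; ext ω; simp
    · intro i _ j _ hij
      refine Disjoint.mono Set.inter_subset_right Set.inter_subset_right ?_
      exact (Set.disjoint_singleton.2 hij).preimage J
    · exact fun j _ => (hpm hA).inter (hJ j)
  rw [Measure.map_apply_of_aemeasurable hWm hABC, hL, hsum, sourceLaw, Measure.coe_finsetSum,
    Finset.sum_apply, Finset.sum_mul]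
  refine Finset.sum_congr rfl fun j _ => ?_
  rw [Measure.map_apply (by fun_prop) hABC]
  by_cases hj : j ∈ C
  · have : (fun z : (Fin m → ℝ) × (Fin m → ℝ) => (z.1, z.2, j)) ⁻¹' A ×ˢ B ×ˢ C = A ×ˢ B := by
      ext z; simp [hj]
    rw [this, Measure.prod_prod, withDensity_apply _ hA, if_pos hj, hcond j hA]
    rfl
  · have : (fun z : (Fin m → ℝ) × (Fin m → ℝ) => (z.1, z.2, j)) ⁻¹' A ×ˢ B ×ˢ C = ∅ := by
      ext z; simp [hj]
    rw [this, if_neg hj]; simp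

theorem isAEWeight_id {n : ℕ} {P : Measure (Fin (n + 1) → ℝ)} (hP : P ≪ shareVolume (n + 1)) :
    IsAEWeight P id :=
  ⟨measurable_id, (ae_mem_shareSimplex hP).mono fun _ hx i => (hx.1 i).1.le,
    (ae_mem_shareSimplex hP).mono fun _ hx => hx.2⟩

theorem isAEWeight_const {m : ℕ} (hm : 0 < m) (P : Measure (Fin m → ℝ)) :
    IsAEWeight P fun _ _ => 1 / (m : ℝ) :=
  ⟨measurable_const, ae_of_all _ fun _ _ => by positivity, ae_of_all _ fun _ => by
    have : (m : ℝ) ≠ 0 := by positivity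
    simp [this]⟩

/-- The limit law of the seat excesses of a quota method, up to the term `γ * p`. Neither the
projection nor the offset depends on `p`, and the base law `Measure.dirac 0` plays no role. -/
noncomputable def quotaLaw (γ : ℝ) (m : ℕ) : Measure (Fin m → ℝ) :=
  (sourceLaw (Measure.dirac 0) fun _ _ => 1 / (m : ℝ)).map
    (shadowPoint (fun _ _ => 1 / (m : ℝ)) fun _ _ => -(γ / m))

theorem isProbabilityMeasure_quotaLaw (γ : ℝ) {m : ℕ} (hm : 0 < m) :
    IsProbabilityMeasure (quotaLaw γ m) := by
  have := (isAEWeight_const hm (Measure.dirac (0 : Fin m → ℝ))).isProbabilityMeasure_sourceLaw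
  exact Measure.isProbabilityMeasure_map
    (measurable_shadowPoint measurable_const measurable_const).aemeasurable

theorem integral_exp_quotaLaw (γ : ℝ) {m : ℕ} (hm : 0 < m) (b : Fin m → ℝ) :
    ∫ x, Complex.exp (((∑ i, b i * x i : ℝ) : ℂ) * Complex.I) ∂quotaLaw γ m =
      Complex.exp (((∑ i, b i * -(γ / m) : ℝ) : ℂ) * Complex.I) *
        shadowChar (fun _ => 1 / (m : ℝ)) b := by
  have hw := isAEWeight_const hm (Measure.dirac (0 : Fin m → ℝ))
  have h := hw.integral_exp_sourceLaw (c := fun _ _ => -(γ / m)) measurable_const 0 b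
  simp only [Pi.zero_apply, zero_mul, Finset.sum_const_zero, zero_add, integral_const,
    probReal_univ, one_smul] at h
  rw [quotaLaw, integral_map
    (measurable_shadowPoint measurable_const measurable_const).aemeasurable
    (Continuous.aestronglyMeasurable (by fun_prop)), h]

theorem quotaLaw_exchangeable (γ : ℝ) {m : ℕ} (hm : 0 < m) (σ : Equiv.Perm (Fin m)) :
    (quotaLaw γ m).map (fun z => z ∘ σ) = quotaLaw γ m := by
  have := isProbabilityMeasure_quotaLaw γ hm
  have hmσ : Measurable fun z : Fin m → ℝ => z ∘ σ :=
    measurable_pi_lambda _ fun i => measurable_pi_apply (σ i)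
  have : IsProbabilityMeasure ((quotaLaw γ m).map fun z => z ∘ σ) :=
    Measure.isProbabilityMeasure_map hmσ.aemeasurable
  refine ext_of_integral_exp fun b => ?_
  rw [integral_map hmσ.aemeasurable (Continuous.aestronglyMeasurable (by fun_prop))]
  have h1 : ∀ x : Fin m → ℝ, ∑ i, b i * (x ∘ σ) i = ∑ i, (b ∘ σ.symm) i * x i := by
    intro x
    rw [← Equiv.sum_comp σ fun i => (b ∘ σ.symm) i * x i]
    simp
  simp only [h1]
  rw [integral_exp_quotaLaw γ hm, integral_exp_quotaLaw γ hm]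
  congr 1
  · congr 3
    exact Equiv.sum_comp σ.symm fun i => b i * -(γ / m)
  · have h2 : ∑ i, (b ∘ σ.symm) i * (1 / (m : ℝ)) = ∑ i, b i * (1 / (m : ℝ)) :=
      Equiv.sum_comp σ.symm fun i => b i * (1 / (m : ℝ))
    simp only [shadowChar, h2]
    rw [← Equiv.sum_comp σ]
    refine Finset.sum_congr rfl fun j _ => ?_
    congr 1
    refine (Finset.prod_bij (fun k _ => σ k) ?_ ?_ ?_ ?_).symm
    · intro k hk
      simp only [Finset.mem_erase, Finset.mem_univ, and_true] at hk ⊢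
      exact fun h => hk (σ.injective h)
    · exact fun _ _ _ _ h => σ.injective h
    · intro k hk
      refine ⟨σ.symm k, ?_, by simp⟩
      simp only [Finset.mem_erase, Finset.mem_univ, and_true] at hk ⊢
      intro h
      exact hk (by rw [← h]; simp)
    · intro k _; simp

/-- The projection of the random boundary point for a quota method splits into an exchangeable
part that is independent of `p`, and the term `γ * p`. -/
theorem hasLaw_add_quotaLaw (γ : ℝ) {m : ℕ} (hm : 0 < m) {Ω : Type*} [MeasurableSpace Ω]
    {μ : Measure Ω} [IsProbabilityMeasure μ] {p Z : Ω → Fin m → ℝ} (hpm : Measurable p)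
    {P : Measure (Fin m → ℝ)} (hp : HasLaw p P μ) (hZ : HasLaw Z (quotaLaw γ m) μ)
    (hind : IndepFun p Z μ) :
    HasLaw (fun ω i => Z ω i + γ * p ω i) ((sourceLaw P fun _ _ => 1 / (m : ℝ)).map
      (shadowPoint (fun _ _ => 1 / (m : ℝ)) (quotaOffset γ m))) μ := by
  have : IsProbabilityMeasure P := by
    rw [← hp.map_eq]; exact Measure.isProbabilityMeasure_map hpm.aemeasurable
  have := isProbabilityMeasure_quotaLaw γ hm
  have hw := isAEWeight_const hm P
  have := hw.isProbabilityMeasure_sourceLaw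
  have hcm : Measurable (quotaOffset γ m) := by
    refine measurable_pi_lambda _ fun i => ?_
    simp only [quotaOffset]; fun_prop
  have hsm := measurable_shadowPoint (q := fun _ _ => 1 / (m : ℝ)) measurable_const hcm
  have hpair := (indepFun_iff_hasLaw_prodMk_prod hp hZ).1 hind
  let g : (Fin m → ℝ) × (Fin m → ℝ) → Fin m → ℝ := fun z i => z.2 i + γ * z.1 i
  have hg : Continuous g := by fun_prop
  refine ⟨hg.measurable.comp_aemeasurable hpair.aemeasurable, ?_⟩
  have hcomp : (fun ω i => Z ω i + γ * p ω i) = g ∘ fun ω => (p ω, Z ω) := rfl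
  rw [hcomp, ← AEMeasurable.map_map_of_aemeasurable hg.measurable.aemeasurable hpair.aemeasurable,
    hpair.map_eq]
  have : IsProbabilityMeasure ((P.prod (quotaLaw γ m)).map g) :=
    Measure.isProbabilityMeasure_map hg.measurable.aemeasurable
  have : IsProbabilityMeasure ((sourceLaw P fun _ _ => 1 / (m : ℝ)).map
      (shadowPoint (fun _ _ => 1 / (m : ℝ)) (quotaOffset γ m))) :=
    Measure.isProbabilityMeasure_map hsm.aemeasurable
  refine ext_of_integral_exp fun b => ?_
  rw [integral_map hg.measurable.aemeasurable (Continuous.aestronglyMeasurable (by fun_prop)),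
    integral_map hsm.aemeasurable (Continuous.aestronglyMeasurable (by fun_prop))]
  have h := hw.integral_exp_sourceLaw hcm 0 b
  simp only [Pi.zero_apply, zero_mul, Finset.sum_const_zero, zero_add] at h
  rw [h, integral_prod]
  · congr 1; ext x
    have : ∀ y : Fin m → ℝ, Complex.exp (((∑ i, b i * g (x, y) i : ℝ) : ℂ) * Complex.I) =
        Complex.exp (((∑ i, b i * (γ * x i) : ℝ) : ℂ) * Complex.I) *
          Complex.exp (((∑ i, b i * y i : ℝ) : ℂ) * Complex.I) := by
      intro y
      rw [← Complex.exp_add, ← add_mul, ← Complex.ofReal_add, ← Finset.sum_add_distrib]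
      congr 3
      exact Finset.sum_congr rfl fun i _ => by simp only [g]; ring
    simp only [this]
    rw [integral_const_mul, integral_exp_quotaLaw γ hm, ← mul_assoc, ← Complex.exp_add, ← add_mul,
      ← Complex.ofReal_add, ← Finset.sum_add_distrib]
    congr 4
    exact Finset.sum_congr rfl fun i _ => by simp only [quotaOffset]; ring
  · refine Integrable.of_bound (C := 1) (Continuous.aestronglyMeasurable (by fun_prop))
      (ae_of_all _ fun z => ?_)
    rw [Complex.norm_exp_ofReal_mul_I]

/-! ### Convergence in law of the seat excesses -/

theorem measurable_seatExcess {m : ℕ} {Ω : Type*} [MeasurableSpace Ω] {p : Ω → Fin m → ℝ}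
    (hp : Measurable p) {s : ℕ → Ω → Fin m → ℤ} (hs : ∀ N, Measurable (s N)) (N : ℕ) :
    Measurable fun ω => seatExcess N (p ω) (s N ω) := by
  refine measurable_pi_lambda _ fun i => ?_
  have h1 : Measurable fun ω => (s N ω i : ℝ) :=
    (measurable_from_top (f := fun a : ℤ => (a : ℝ))).comp ((measurable_pi_apply i).comp (hs N))
  have h2 : Measurable fun ω => p ω i := (measurable_pi_apply i).comp hp
  exact h1.sub (h2.const_mul _)

theorem ae_mem_shareSimplex_of_map {n : ℕ} {Ω : Type*} [MeasurableSpace Ω] {μ : Measure Ω}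
    {p : Ω → Fin (n + 1) → ℝ} (hp : Measurable p) (hac : μ.map p ≪ shareVolume (n + 1)) :
    ∀ᵐ ω ∂μ, p ω ∈ shareSimplex (n + 1) :=
  ae_of_ae_map hp.aemeasurable (ae_mem_shareSimplex hac)

theorem eventually_le_natCast_add_mul {m : ℕ} (a b : ℝ) {p : Fin m → ℝ} (hp : ∀ i, 0 < p i) :
    ∀ᶠ N : ℕ in atTop, ∀ i, a ≤ (N + b) * p i := by
  rw [eventually_all]
  intro i
  have h : Tendsto (fun N : ℕ => ((N : ℝ) + b) * p i) atTop atTop :=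
    (tendsto_atTop_add_const_right _ b tendsto_natCast_atTop_atTop).atTop_mul_const (hp i)
  exact h.eventually_ge_atTop a

theorem ae_eventually_of_eventually_ae {Ω : Type*} [MeasurableSpace Ω] {μ : Measure Ω}
    {A : ℕ → Ω → Prop} (h : ∀ᶠ N in atTop, ∀ᵐ ω ∂μ, A N ω) : ∀ᵐ ω ∂μ, ∀ᶠ N in atTop, A N ω := by
  obtain ⟨N₀, hN₀⟩ := eventually_atTop.1 h
  have : ∀ᵐ ω ∂μ, ∀ N, N₀ ≤ N → A N ω := by
    rw [ae_all_iff]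
    intro N
    by_cases hN : N₀ ≤ N
    · exact (hN₀ N hN).mono fun ω hω _ => hω
    · exact ae_of_all _ fun ω h => absurd h hN
  exact this.mono fun ω hω => eventually_atTop.2 ⟨N₀, hω⟩

/-- Convergence of a single coordinate in the situation of `tendsto_law_of_mem_shadowSet`. -/
theorem tendsto_eval_of_mem_shadowSet {n : ℕ} (hn : 2 ≤ n + 1) {Ω : Type*} [MeasurableSpace Ω]
    {μ : Measure Ω}
    [IsProbabilityMeasure μ] {p : Ω → Fin (n + 1) → ℝ} (hp : Measurable p)
    (hac : μ.map p ≪ shareVolume (n + 1)) {q c : (Fin (n + 1) → ℝ) → Fin (n + 1) → ℝ}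
    (hq : Continuous q) (hc : Continuous c)
    (hq0 : ∀ x ∈ shareSimplex (n + 1), ∀ i, 0 < q x i)
    (hq1 : ∀ x ∈ shareSimplex (n + 1), ∑ i, q x i = 1)
    (hc0 : ∀ x ∈ shareSimplex (n + 1), ∑ i, c x i = 0)
    {Δ : ℕ → Ω → Fin (n + 1) → ℝ} (hΔm : ∀ N, Measurable (Δ N))
    (hΔ : ∀ᶠ N : ℕ in atTop, ∀ᵐ ω ∂μ, ∑ i, Δ N ω i = 0 ∧ ∀ i, ∃ a : ℤ, Δ N ω i = a - N * p ω i)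
    (hΔK : ∀ᵐ ω ∂μ, ∀ᶠ N : ℕ in atTop, (p ω, Δ N ω) ∈ shadowSet q c)
    {Ω' : Type*} [MeasurableSpace Ω'] {μ' : Measure Ω'} [IsProbabilityMeasure μ']
    {p' : Ω' → Fin (n + 1) → ℝ} (hp' : HasLaw p' (μ.map p) μ') {T : ℕ → Ω' → ℝ}
    (hT : IsCentredUniforms μ' p' T) (i : Fin (n + 1)) :
    TendstoInDistribution (fun N ω => Δ N ω i) atTop
      (fun ω => (c (p' ω) i + ((n + 1 : ℕ) * q (p' ω) i - 1) / 2) + T 0 ω +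
        q (p' ω) i * ∑ k ∈ Finset.Icc 1 (n + 1 - 2), T k ω) (fun _ => μ) μ' := by
  have : IsProbabilityMeasure (μ.map p) := Measure.isProbabilityMeasure_map hp.aemeasurable
  have hS := ae_mem_shareSimplex hac
  have hw : IsAEWeight (μ.map p) q :=
    ⟨hq.measurable, hS.mono fun x hx i => (hq0 x hx i).le, hS.mono hq1⟩
  have := hw.isProbabilityMeasure_sourceLaw
  have hsm := measurable_shadowPoint hq.measurable hc.measurable
  have h1 := tendsto_law_of_mem_shadowSet hp hac hq hc hq0 hq1 hc0 hΔm hΔ hΔK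
    (X := shadowPoint q c) ⟨hsm.aemeasurable, rfl⟩
  have h2 := h1.continuous_comp (continuous_apply i)
  refine TendstoInDistribution.congr_law h2 ?_
  have h3 := hT.map_eq_shadow_eval hn hp' hw hc.measurable i
  rwa [Measure.map_map (measurable_pi_apply i) hsm] at h3

theorem continuous_divisorOffset (β : ℝ) (m : ℕ) : Continuous (divisorOffset β m) := by
  unfold divisorOffset; fun_prop

theorem continuous_quotaOffset (γ : ℝ) (m : ℕ) : Continuous (quotaOffset γ m) := by
  unfold quotaOffset; fun_prop

theorem sum_divisorOffset (β : ℝ) {m : ℕ} {p : Fin m → ℝ} (hp : ∑ i, p i = 1) :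
    ∑ i, divisorOffset β m p i = 0 := by
  simp only [divisorOffset, ← Finset.mul_sum, Finset.sum_sub_distrib, hp]
  simp

theorem sum_quotaOffset (γ : ℝ) {m : ℕ} (hm : 0 < m) {p : Fin m → ℝ} (hp : ∑ i, p i = 1) :
    ∑ i, quotaOffset γ m p i = 0 := by
  have : (m : ℝ) ≠ 0 := by positivity
  simp only [quotaOffset, ← Finset.mul_sum, Finset.sum_sub_distrib, hp]
  simp [this]

theorem eventually_sum_seatExcess {n : ℕ} {Ω : Type*} [MeasurableSpace Ω] {μ : Measure Ω}
    {p : Ω → Fin (n + 1) → ℝ} (hp : Measurable p) (hac : μ.map p ≪ shareVolume (n + 1))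
    {s : ℕ → Ω → Fin (n + 1) → ℤ} (h : ∀ᶠ N : ℕ in atTop, ∀ᵐ ω ∂μ, ∑ i, s N ω i = N) :
    ∀ᶠ N : ℕ in atTop, ∀ᵐ ω ∂μ, ∑ i, seatExcess N (p ω) (s N ω) i = 0 ∧
      ∀ i, ∃ a : ℤ, seatExcess N (p ω) (s N ω) i = a - N * p ω i := by
  filter_upwards [h] with N hN
  filter_upwards [hN, ae_mem_shareSimplex_of_map hp hac] with ω hω hx
  exact ⟨sum_seatExcess hω hx.2, fun i => ⟨s N ω i, rfl⟩⟩

section Allocations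

variable {n : ℕ} {Ω : Type*} [MeasurableSpace Ω] {μ : Measure Ω}
  {p : Ω → Fin (n + 1) → ℝ} {s : ℕ → Ω → Fin (n + 1) → ℤ}

theorem ae_eventually_mem_shadowSet_divisor {β : ℝ} (hp : Measurable p)
    (hac : μ.map p ≪ shareVolume (n + 1))
    (h : ∀ᶠ N : ℕ in atTop, ∀ᵐ ω ∂μ, IsDivisorAllocation β N (p ω) (s N ω)) :
    ∀ᵐ ω ∂μ, ∀ᶠ N : ℕ in atTop,
      (p ω, seatExcess N (p ω) (s N ω)) ∈ shadowSet id (divisorOffset β (n + 1)) := by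
  filter_upwards [ae_eventually_of_eventually_ae h, ae_mem_shareSimplex_of_map hp hac] with ω hω hx
  filter_upwards [hω, eventually_le_natCast_add_mul β (-((n + 1 : ℕ) * (|β| + 1)))
    fun i => (hx.1 i).1] with N hN hN'
  exact hN.mem_shadowSet hx hN'

theorem ae_eventually_mem_shadowSet_quota {γ : ℝ} (hp : Measurable p)
    (hac : μ.map p ≪ shareVolume (n + 1))
    (h : ∀ᶠ N : ℕ in atTop, ∀ᵐ ω ∂μ, IsQuotaAllocation γ N (p ω) (s N ω)) :
    ∀ᵐ ω ∂μ, ∀ᶠ N : ℕ in atTop, (p ω, seatExcess N (p ω) (s N ω)) ∈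
      shadowSet (fun _ _ => 1 / ((n + 1 : ℕ) : ℝ)) (quotaOffset γ (n + 1)) := by
  filter_upwards [ae_eventually_of_eventually_ae h, ae_mem_shareSimplex_of_map hp hac] with ω hω hx
  filter_upwards [hω, eventually_le_natCast_add_mul (|γ| + 1) γ fun i => (hx.1 i).1,
    eventually_le_natCast_add_mul (m := 1) ((n + 1 : ℕ) * |γ| + 1) γ (p := 1)
      (fun _ => one_pos)] with N hN hN' hN1
  exact hN.mem_shadowSet (Nat.succ_pos n) hx (by simpa using hN1 0) hN'

variable [IsProbabilityMeasure μ]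
  {Ω' : Type*} [MeasurableSpace Ω'] {μ' : Measure Ω'} [IsProbabilityMeasure μ']

/-- The joint limit for divisor methods, where the cube is projected along `p`. -/
theorem tendsto_divisor {β : ℝ} (hp : Measurable p) (hs : ∀ N, Measurable (s N))
    (h : ∀ᶠ N : ℕ in atTop, ∀ᵐ ω ∂μ, IsDivisorAllocation β N (p ω) (s N ω))
    (hac : μ.map p ≪ shareVolume (n + 1)) {X : Ω' → Fin (n + 1) → ℝ}
    (hX : HasLaw X
      ((sourceLaw (μ.map p) id).map (shadowPoint id (divisorOffset β (n + 1)))) μ') :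
    TendstoInDistribution (fun (N : ℕ) ω => seatExcess N (p ω) (s N ω)) atTop X (fun _ => μ) μ' :=
  tendsto_law_of_mem_shadowSet hp hac continuous_id (continuous_divisorOffset β _)
    (fun _ hx i => (hx.1 i).1) (fun _ hx => hx.2) (fun _ hx => sum_divisorOffset β hx.2)
    (measurable_seatExcess hp hs)
    (eventually_sum_seatExcess hp hac (h.mono fun _ hN => hN.mono fun _ hω => hω.1))
    (ae_eventually_mem_shadowSet_divisor hp hac h) hX

theorem tendsto_divisor_eval {β : ℝ} (hn : 2 ≤ n + 1) (hp : Measurable p)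
    (hs : ∀ N, Measurable (s N))
    (h : ∀ᶠ N : ℕ in atTop, ∀ᵐ ω ∂μ, IsDivisorAllocation β N (p ω) (s N ω))
    (hac : μ.map p ≪ shareVolume (n + 1)) {p' : Ω' → Fin (n + 1) → ℝ}
    (hp' : HasLaw p' (μ.map p) μ') {T : ℕ → Ω' → ℝ} (hT : IsCentredUniforms μ' p' T)
    (i : Fin (n + 1)) :
    TendstoInDistribution (fun (N : ℕ) ω => seatExcess N (p ω) (s N ω) i) atTop
      (fun ω => divisorLimit β (n + 1) (p' ω i) (fun k => T k ω)) (fun _ => μ) μ' := by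
  have := tendsto_eval_of_mem_shadowSet hn hp hac continuous_id (continuous_divisorOffset β _)
    (fun _ hx i => (hx.1 i).1) (fun _ hx => hx.2) (fun _ hx => sum_divisorOffset β hx.2)
    (measurable_seatExcess hp hs)
    (eventually_sum_seatExcess hp hac (h.mono fun _ hN => hN.mono fun _ hω => hω.1))
    (ae_eventually_mem_shadowSet_divisor hp hac h) hp' hT i
  refine this.congr (fun _ => EventuallyEq.rfl) (ae_of_all _ fun ω => ?_)
  simp only [divisorOffset, divisorLimit, id]
  ring

/-- The joint limit for quota methods, where the cube is projected along the diagonal. -/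
theorem tendsto_quota {γ : ℝ} (hp : Measurable p) (hs : ∀ N, Measurable (s N))
    (h : ∀ᶠ N : ℕ in atTop, ∀ᵐ ω ∂μ, IsQuotaAllocation γ N (p ω) (s N ω))
    (hac : μ.map p ≪ shareVolume (n + 1)) {X : Ω' → Fin (n + 1) → ℝ}
    (hX : HasLaw X ((sourceLaw (μ.map p) fun _ _ => 1 / ((n + 1 : ℕ) : ℝ)).map
      (shadowPoint (fun _ _ => 1 / ((n + 1 : ℕ) : ℝ)) (quotaOffset γ (n + 1)))) μ') :
    TendstoInDistribution (fun (N : ℕ) ω => seatExcess N (p ω) (s N ω)) atTop X (fun _ => μ) μ' :=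
  tendsto_law_of_mem_shadowSet hp hac continuous_const (continuous_quotaOffset γ _)
    (fun _ _ _ => by positivity) (fun _ _ => by simp; field_simp)
    (fun _ hx => sum_quotaOffset γ (Nat.succ_pos n) hx.2)
    (measurable_seatExcess hp hs)
    (eventually_sum_seatExcess hp hac (h.mono fun _ hN => hN.mono fun _ hω => hω.1))
    (ae_eventually_mem_shadowSet_quota hp hac h) hX

theorem tendsto_quota_eval {γ : ℝ} (hn : 2 ≤ n + 1) (hp : Measurable p)
    (hs : ∀ N, Measurable (s N))
    (h : ∀ᶠ N : ℕ in atTop, ∀ᵐ ω ∂μ, IsQuotaAllocation γ N (p ω) (s N ω))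
    (hac : μ.map p ≪ shareVolume (n + 1)) {p' : Ω' → Fin (n + 1) → ℝ}
    (hp' : HasLaw p' (μ.map p) μ') {T : ℕ → Ω' → ℝ} (hT : IsCentredUniforms μ' p' T)
    (i : Fin (n + 1)) :
    TendstoInDistribution (fun (N : ℕ) ω => seatExcess N (p ω) (s N ω) i) atTop
      (fun ω => quotaLimit γ (n + 1) (p' ω i) (fun k => T k ω)) (fun _ => μ) μ' := by
  have := tendsto_eval_of_mem_shadowSet hn hp hac continuous_const (continuous_quotaOffset γ _)
    (q := fun _ _ => 1 / ((n + 1 : ℕ) : ℝ))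
    (fun _ _ _ => by positivity) (fun _ _ => by simp; field_simp)
    (fun _ hx => sum_quotaOffset γ (Nat.succ_pos n) hx.2)
    (measurable_seatExcess hp hs)
    (eventually_sum_seatExcess hp hac (h.mono fun _ hN => hN.mono fun _ hω => hω.1))
    (ae_eventually_mem_shadowSet_quota hp hac h) hp' hT i
  refine this.congr (fun _ => EventuallyEq.rfl) (ae_of_all _ fun ω => ?_)
  have : ((n + 1 : ℕ) : ℝ) ≠ 0 := by positivity
  simp only [quotaOffset, quotaLimit]
  field_simp
  ring

/-- The limit of a single coordinate, realised through the exchangeable law. -/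
theorem identDistrib_quotaLimit {γ : ℝ} {m : ℕ} (hm : 2 ≤ m) {p' Z : Ω' → Fin m → ℝ}
    (hp' : Measurable p')
    (hZ : HasLaw Z (quotaLaw γ m) μ') (hind : IndepFun p' Z μ') {T : ℕ → Ω' → ℝ}
    (hT : IsCentredUniforms μ' p' T) (i : Fin m) :
    IdentDistrib (fun ω => Z ω i + γ * p' ω i)
      (fun ω => quotaLimit γ m (p' ω i) (fun k => T k ω)) μ' μ' := by
  have : IsProbabilityMeasure (μ'.map p') := Measure.isProbabilityMeasure_map hp'.aemeasurable
  have hp : HasLaw p' (μ'.map p') μ' := ⟨hp'.aemeasurable, rfl⟩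
  have h1 := hasLaw_add_quotaLaw γ (by omega) hp' hp hZ hind
  have h2 := hT.map_eq_shadow_eval hm hp (isAEWeight_const (by omega) _)
    (continuous_quotaOffset γ m).measurable i
  have hm0 : (m : ℝ) ≠ 0 := by positivity
  have h3 : (fun ω => quotaLimit γ m (p' ω i) (fun k => T k ω)) =
      fun ω => (quotaOffset γ m (p' ω) i + (m * (1 / (m : ℝ)) - 1) / 2) + T 0 ω +
        1 / (m : ℝ) * ∑ k ∈ Finset.Icc 1 (m - 2), T k ω := by
    ext ω
    rw [mul_one_div_cancel hm0]
    simp only [quotaOffset, quotaLimit]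
    ring
  rw [h3]
  refine ⟨?_, h2.aemeasurable, ?_⟩
  · exact (measurable_pi_apply i).comp_aemeasurable h1.aemeasurable
  · rw [h2.map_eq, ← h1.map_eq, AEMeasurable.map_map_of_aemeasurable
      (measurable_pi_apply i).aemeasurable h1.aemeasurable]
    rfl

end Allocations

/-! ### Linear maps and sorting on the simplex -/

/-- The measure on the hyperplane `∑ i, p i = 1` whose restriction to the simplex
is `shareVolume`. -/
noncomputable def chartVolume (n : ℕ) : Measure (Fin (n + 1) → ℝ) :=
  (volume : Measure (Fin n → ℝ)).map (simplexChart n)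

/-- The linear part of `simplexChart`. -/
noncomputable def chartLinear (n : ℕ) : (Fin n → ℝ) →ₗ[ℝ] (Fin (n + 1) → ℝ) where
  toFun x := Fin.snoc (α := fun _ => ℝ) x (-∑ i, x i)
  map_add' x y := by
    ext i
    refine Fin.lastCases ?_ (fun i => ?_) i
    · simp [Finset.sum_add_distrib]; ring
    · simp
  map_smul' a x := by
    ext i
    refine Fin.lastCases ?_ (fun i => ?_) i
    · simp [Finset.mul_sum]
    · simp

theorem chartLinear_apply {n : ℕ} (x : Fin n → ℝ) :
    chartLinear n x = Fin.snoc (α := fun _ => ℝ) x (-∑ i, x i) := rfl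

theorem simplexChart_eq {n : ℕ} (x : Fin n → ℝ) :
    simplexChart n x = chartLinear n x + Pi.single (Fin.last n) 1 := by
  ext i
  refine Fin.lastCases ?_ (fun i => ?_) i
  · simp [chartLinear_apply]; ring
  · simp [chartLinear_apply]

theorem sum_chartLinear {n : ℕ} (x : Fin n → ℝ) : ∑ i, chartLinear n x i = 0 := by
  simp [chartLinear_apply, Fin.sum_univ_castSucc]

/-- A linear automorphism that preserves the coordinate sum multiplies the volume of the
hyperplane by a constant. -/
theorem exists_map_chartVolume_eq_smul {n : ℕ}
    (L : (Fin (n + 1) → ℝ) →ₗ[ℝ] (Fin (n + 1) → ℝ)) (hinj : Function.Injective L)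
    (hsum : ∀ x, ∑ i, L x i = ∑ i, x i) :
    ∃ a : ENNReal, (chartVolume n).map L = a • chartVolume n := by
  let B : (Fin n → ℝ) →ₗ[ℝ] (Fin n → ℝ) :=
    (LinearMap.funLeft ℝ ℝ (Fin.castSucc : Fin n → Fin (n + 1))) ∘ₗ L ∘ₗ chartLinear n
  have hB : ∀ x i, B x i = L (chartLinear n x) i.castSucc := fun x i => rfl
  have hBinj : Function.Injective B := by
    refine (injective_iff_map_eq_zero B).2 fun x hx => ?_
    have h1 : L (chartLinear n x) = 0 := by
      have hs : ∑ i, L (chartLinear n x) i = 0 := by rw [hsum, sum_chartLinear]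
      have hc : ∀ i : Fin n, L (chartLinear n x) i.castSucc = 0 := fun i => by
        rw [← hB, hx]; rfl
      rw [Fin.sum_univ_castSucc, Finset.sum_eq_zero fun i _ => hc i, zero_add] at hs
      ext i
      exact Fin.lastCases hs hc i
    have h2 : chartLinear n x = 0 := hinj (by rw [h1, map_zero])
    ext i
    have := congrFun h2 i.castSucc
    simpa [chartLinear_apply] using this
  have hdet : LinearMap.det B ≠ 0 := by
    have := (LinearEquiv.ofInjectiveEndo B hBinj).isUnit_det'
    exact this.ne_zero
  let b : Fin n → ℝ := fun i => L (Pi.single (Fin.last n) 1) i.castSucc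
  have hLm : Measurable L := L.continuous_of_finiteDimensional.measurable
  have hBm : Measurable B := B.continuous_of_finiteDimensional.measurable
  have hcomp : L ∘ simplexChart n = simplexChart n ∘ (fun x => x + b) ∘ B := by
    ext x : 1
    have hs : ∑ i, L (simplexChart n x) i = 1 := by rw [hsum, sum_simplexChart]
    have hi : Fin.init (L (simplexChart n x)) = B x + b := by
      ext i
      simp only [Fin.init, simplexChart_eq, map_add, Pi.add_apply, hB, b]
    simp only [Function.comp]
    rw [← simplexChart_init hs, hi]
  refine ⟨ENNReal.ofReal |(LinearMap.det B)⁻¹|, ?_⟩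
  rw [chartVolume, Measure.map_map hLm (measurable_simplexChart n), hcomp,
    ← Measure.map_map (measurable_simplexChart n) ((measurable_add_const b).comp hBm),
    ← Measure.map_map (measurable_add_const b) hBm,
    Measure.map_linearMap_addHaar_eq_smul_addHaar _ hdet, Measure.map_smul, Measure.map_smul,
    map_add_right_eq_self]

/-- Ties are negligible, since `p i = p j` defines a proper affine subspace of the hyperplane. -/
theorem chartVolume_tie {n : ℕ} {i j : Fin (n + 1)} (hij : i ≠ j) :
    chartVolume n {p | p i = p j} = 0 := by
  let ℓ : (Fin n → ℝ) →ₗ[ℝ] ℝ :=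
    ((LinearMap.proj i : (Fin (n + 1) → ℝ) →ₗ[ℝ] ℝ) - LinearMap.proj j) ∘ₗ chartLinear n
  have hℓ : ∀ x, ℓ x = chartLinear n x i - chartLinear n x j := fun x => rfl
  have hne : ℓ ≠ 0 := by
    intro h0
    let v : Fin (n + 1) → ℝ := Pi.single i 1 - Pi.single j 1
    have hv : ∑ k, v k = 0 := by simp [v]
    have hvc : chartLinear n (Fin.init v) = v := by
      ext k
      rw [Fin.sum_univ_castSucc] at hv
      refine Fin.lastCases ?_ (fun k => ?_) k
      · simp [chartLinear_apply, Fin.init]; linarith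
      · simp [chartLinear_apply, Fin.init]
    have := congrArg (fun f => f (Fin.init v)) h0
    simp only [hℓ, hvc, LinearMap.zero_apply, v, Pi.sub_apply, Pi.single_eq_same,
      Pi.single_eq_of_ne hij, Pi.single_eq_of_ne hij.symm] at this
    norm_num at this
  obtain ⟨a, -, ha⟩ := ℓ.exists_map_addHaar_eq_smul_addHaar (volume : Measure (Fin n → ℝ))
    (volume : Measure ℝ) (LinearMap.surjective_iff_ne_zero.2 hne)
  have hℓm : Measurable ℓ := ℓ.continuous_of_finiteDimensional.measurable
  have hms : MeasurableSet {p : Fin (n + 1) → ℝ | p i = p j} :=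
    measurableSet_eq_fun (measurable_pi_apply i) (measurable_pi_apply j)
  set t : ℝ := (Pi.single (Fin.last n) 1 : Fin (n + 1) → ℝ) j -
    (Pi.single (Fin.last n) 1 : Fin (n + 1) → ℝ) i with ht
  have hset : simplexChart n ⁻¹' {p | p i = p j} = ℓ ⁻¹' {t} := by
    ext x
    simp only [Set.mem_preimage, Set.mem_ofPred_eq, Set.mem_singleton_iff, simplexChart_eq, hℓ, ht,
      Pi.add_apply]
    constructor <;> intro h <;> linarith
  rw [chartVolume, Measure.map_apply (measurable_simplexChart n) hms, hset,
    ← Measure.map_apply hℓm (measurableSet_singleton t), ha]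
  simp

theorem mem_shareSimplex_iff {m : ℕ} (hm : 2 ≤ m) {p : Fin m → ℝ} :
    p ∈ shareSimplex m ↔ (∀ i, 0 < p i) ∧ ∑ i, p i = 1 := by
  refine ⟨fun h => ⟨fun i => (h.1 i).1, h.2⟩, fun h => ⟨fun i => ⟨h.1 i, ?_⟩, h.2⟩⟩
  have : Nontrivial (Fin m) := Fin.nontrivial_iff_two_le.2 hm
  obtain ⟨j, hj⟩ := exists_ne i
  rw [← h.2, ← Finset.add_sum_erase _ _ (Finset.mem_univ i)]
  have : 0 < ∑ k ∈ Finset.univ.erase i, p k :=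
    Finset.sum_pos (fun k _ => h.1 k) ⟨j, Finset.mem_erase.2 ⟨hj, Finset.mem_univ j⟩⟩
  linarith

/-- The image of the uniform distribution on the simplex under a linear automorphism that
preserves the coordinate sum. -/
theorem exists_map_shareVolume_eq_smul {n : ℕ}
    (L : (Fin (n + 1) → ℝ) →ₗ[ℝ] (Fin (n + 1) → ℝ)) (hinj : Function.Injective L)
    (hsum : ∀ x, ∑ i, L x i = ∑ i, x i) {D : Set (Fin (n + 1) → ℝ)} (hD : MeasurableSet D)
    (hDS : D ⊆ shareSimplex (n + 1))
    (hL : ∀ x, ∑ i, x i = 1 → (L x ∈ D ↔ x ∈ shareSimplex (n + 1))) :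
    ∃ a : ENNReal, (shareVolume (n + 1)).map L = a • (shareVolume (n + 1)).restrict D := by
  obtain ⟨a, ha⟩ := exists_map_chartVolume_eq_smul L hinj hsum
  have hLm : Measurable L := L.continuous_of_finiteDimensional.measurable
  have hae : shareSimplex (n + 1) =ᵐ[chartVolume n] L ⁻¹' D := by
    have h1 : ∀ᵐ x ∂chartVolume n, ∑ i, x i = 1 := by
      rw [chartVolume, ae_map_iff (measurable_simplexChart n).aemeasurable
        (measurableSet_eq_fun (by fun_prop) measurable_const)]
      exact ae_of_all _ sum_simplexChart
    filter_upwards [h1] with x hx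
    exact propext (hL x hx).symm
  refine ⟨a, ?_⟩
  rw [shareVolume_succ]
  change ((chartVolume n).restrict (shareSimplex (n + 1))).map L =
    a • ((chartVolume n).restrict (shareSimplex (n + 1))).restrict D
  rw [Measure.restrict_restrict hD, Set.inter_eq_left.2 hDS, Measure.restrict_congr_set hae,
    ← Measure.restrict_map hLm hD, ha, Measure.restrict_smul]

theorem exists_map_perm_shareVolume {n : ℕ} (σ : Equiv.Perm (Fin (n + 1))) :
    ∃ a : ENNReal, (shareVolume (n + 1)).map (fun x => x ∘ σ) = a • shareVolume (n + 1) := by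
  have hmem : ∀ x : Fin (n + 1) → ℝ, x ∘ σ ∈ shareSimplex (n + 1) ↔ x ∈ shareSimplex (n + 1) := by
    intro x
    refine and_congr ⟨fun h i => ?_, fun h i => h (σ i)⟩ ?_
    · simpa using h (σ.symm i)
    · simp only [Function.comp, Equiv.sum_comp σ]
  obtain ⟨a, ha⟩ := exists_map_shareVolume_eq_smul (LinearMap.funLeft ℝ ℝ σ)
    (LinearMap.funLeft_injective_of_surjective ℝ ℝ σ σ.surjective)
    (fun x => Equiv.sum_comp σ x) (measurableSet_shareSimplex _) subset_rfl (fun x _ => hmem x)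
  refine ⟨a, ?_⟩
  rw [shareVolume_succ, Measure.restrict_restrict (measurableSet_shareSimplex _), Set.inter_self,
    ← shareVolume_succ] at ha
  exact ha

theorem measurable_comp_perm {m : ℕ} (σ : Equiv.Perm (Fin m)) :
    Measurable fun x : Fin m → ℝ => x ∘ σ :=
  measurable_pi_lambda _ fun i => measurable_pi_apply (σ i)

theorem measurableSet_decreasingOrder_eq {m : ℕ} (σ : Equiv.Perm (Fin m)) :
    MeasurableSet {p : Fin m → ℝ | decreasingOrder p = σ} := by
  have : {p : Fin m → ℝ | decreasingOrder p = σ} =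
      (⋂ i, ⋂ j, {p | i ≤ j → -p (σ i) ≤ -p (σ j)}) ∩
        ⋂ i, ⋂ j, {p | i < j → -p (σ i) = -p (σ j) → σ i < σ j} := by
    ext p
    simp only [Set.mem_ofPred_eq, decreasingOrder, Set.mem_inter_iff, Set.mem_iInter]
    rw [eq_comm, Tuple.eq_sort_iff]
    exact Iff.rfl
  rw [this]
  have hm : ∀ i, Measurable fun p : Fin m → ℝ => -p (σ i) := fun i => (measurable_pi_apply _).neg
  refine MeasurableSet.inter (MeasurableSet.iInter fun i => MeasurableSet.iInter fun j => ?_)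
    (MeasurableSet.iInter fun i => MeasurableSet.iInter fun j => ?_)
  · by_cases h : i ≤ j
    · simp only [h, true_imp_iff]; exact measurableSet_le (hm i) (hm j)
    · simp [h]
  · by_cases h : i < j
    · by_cases h' : σ i < σ j
      · simp [h']
      · simp only [h, h', true_imp_iff, imp_false]
        exact (measurableSet_eq_fun (hm i) (hm j)).compl
    · simp [h]

theorem measurable_decreasingOrder {m : ℕ} (j : Fin m) :
    Measurable fun p : Fin m → ℝ => decreasingOrder p j := by
  refine measurable_to_countable' fun i => ?_
  have : (fun p : Fin m → ℝ => decreasingOrder p j) ⁻¹' {i} =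
      ⋃ σ : Equiv.Perm (Fin m), ⋃ _ : σ j = i, {p | decreasingOrder p = σ} := by
    ext p; simp
  rw [this]
  exact MeasurableSet.iUnion fun σ =>
    MeasurableSet.iUnion fun _ => measurableSet_decreasingOrder_eq σ

theorem measurable_comp_decreasingOrder {m : ℕ} {Ω α : Type*} [MeasurableSpace Ω]
    [MeasurableSpace α] {p : Ω → Fin m → ℝ} (hp : Measurable p) {f : Ω → Fin m → α}
    (hf : Measurable f) : Measurable fun ω j => f ω (decreasingOrder (p ω) j) := by
  refine measurable_pi_lambda _ fun j => ?_
  have h1 : Measurable fun z : (Fin m → α) × Fin m => z.1 z.2 :=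
    measurable_from_prod_countable_left fun i => measurable_pi_apply i
  exact h1.comp (hf.prodMk ((measurable_decreasingOrder j).comp hp))

theorem measurable_orderedShare (m : ℕ) :
    Measurable (orderedShare : (Fin m → ℝ) → Fin m → ℝ) :=
  measurable_comp_decreasingOrder measurable_id measurable_id

/-- Sorting the parties by size preserves absolute continuity. -/
theorem map_orderedShare_absolutelyContinuous {n : ℕ} {P : Measure (Fin (n + 1) → ℝ)}
    (hP : P ≪ shareVolume (n + 1)) : P.map orderedShare ≪ shareVolume (n + 1) := by
  refine Measure.AbsolutelyContinuous.mk fun A hA h0 => ?_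
  rw [Measure.map_apply (measurable_orderedShare _) hA]
  have hsub : orderedShare ⁻¹' A ⊆ ⋃ σ : Equiv.Perm (Fin (n + 1)), (fun x => x ∘ σ) ⁻¹' A :=
    fun p hp => Set.mem_iUnion.2 ⟨decreasingOrder p, hp⟩
  refine measure_mono_null hsub (measure_iUnion_null fun σ => hP ?_)
  obtain ⟨a, ha⟩ := exists_map_perm_shareVolume σ
  rw [← Measure.map_apply (measurable_comp_perm σ) hA, ha, Measure.smul_apply, h0, smul_zero]

/-- The simplex of strictly decreasing proportions. -/
def decreasingSimplex (m : ℕ) : Set (Fin m → ℝ) := {p | p ∈ shareSimplex m ∧ StrictAnti p}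

theorem measurableSet_decreasingSimplex (m : ℕ) : MeasurableSet (decreasingSimplex m) := by
  have : decreasingSimplex m = shareSimplex m ∩ ⋂ i, ⋂ j, {p | i < j → p j < p i} := by
    ext p
    simp only [decreasingSimplex, Set.mem_ofPred_eq, Set.mem_inter_iff, Set.mem_iInter]
    exact Iff.rfl
  rw [this]
  refine (measurableSet_shareSimplex m).inter
    (MeasurableSet.iInter fun i => MeasurableSet.iInter fun j => ?_)
  by_cases h : i < j
  · simp only [h, true_imp_iff]
    exact measurableSet_lt (measurable_pi_apply j) (measurable_pi_apply i)
  · simp [h]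

theorem decreasingOrder_eq_iff {m : ℕ} {p : Fin m → ℝ} (hp : Function.Injective p)
    (σ : Equiv.Perm (Fin m)) : decreasingOrder p = σ ↔ StrictAnti (p ∘ σ) := by
  constructor
  · rintro rfl
    exact (antitone_decreasingOrder p).strictAnti_of_injective
      (hp.comp (decreasingOrder p).injective)
  · intro h
    symm
    rw [decreasingOrder, Tuple.eq_sort_iff]
    refine ⟨fun i j hij => neg_le_neg (h.antitone hij), fun i j hij he => ?_⟩
    exact absurd (neg_injective he) (h hij).ne'

theorem absolutelyContinuous_of_eq_smul {n : ℕ} {P : Measure (Fin (n + 1) → ℝ)} {κ : ENNReal}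
    (hP : P = κ • shareVolume (n + 1)) :
    P ≪ shareVolume (n + 1) := by
  rw [hP]; exact Measure.smul_absolutelyContinuous

section Uniform

variable {n : ℕ} {P : Measure (Fin (n + 1) → ℝ)} [IsProbabilityMeasure P] {κ : ENNReal}

/-- The uniform distribution on the simplex is exchangeable. -/
theorem map_perm_uniform (hP : P = κ • shareVolume (n + 1)) (σ : Equiv.Perm (Fin (n + 1))) :
    P.map (fun x => x ∘ σ) = P := by
  obtain ⟨a, ha⟩ := exists_map_perm_shareVolume σ
  have h1 : P.map (fun x => x ∘ σ) = a • P := by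
    rw [hP, Measure.map_smul, ha, smul_comm]
  have : IsProbabilityMeasure (P.map fun x => x ∘ σ) :=
    Measure.isProbabilityMeasure_map (measurable_comp_perm σ).aemeasurable
  have h2 := congrArg (fun ρ => ρ Set.univ) h1
  simp only [measure_univ, Measure.smul_apply, smul_eq_mul, mul_one] at h2
  rw [h1, ← h2, one_smul]

/-- There are almost surely no ties, and by exchangeability each order of the parties contributes
the same measure to the law of the sorted proportions. -/
theorem map_orderedShare_uniform (hP : P = κ • shareVolume (n + 1)) :
    P.map orderedShare =
      (Fintype.card (Equiv.Perm (Fin (n + 1))) : ENNReal) •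
        P.restrict (decreasingSimplex (n + 1)) := by
  have hac := absolutelyContinuous_of_eq_smul hP
  have hties : ∀ᵐ p ∂P, Function.Injective p := by
    have : ∀ i j : Fin (n + 1), ∀ᵐ p ∂P, p i = p j → i = j := by
      intro i j
      by_cases hij : i = j
      · exact ae_of_all _ fun _ _ => hij
      · have h0 : P {p | p i = p j} = 0 := by
          refine hac ?_
          rw [shareVolume_succ]
          exact Measure.restrict_le_self.absolutelyContinuous (chartVolume_tie hij)
        filter_upwards [measure_eq_zero_iff_ae_notMem.1 h0] with p hp h
        exact absurd h hp
    have h2 : ∀ᵐ p ∂P, ∀ i j : Fin (n + 1), p i = p j → i = j :=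
      ae_all_iff.2 fun i => ae_all_iff.2 fun j => this i j
    exact h2.mono fun p h i j => h i j
  ext A hA
  rw [Measure.map_apply (measurable_orderedShare _) hA, Measure.smul_apply,
    Measure.restrict_apply hA, smul_eq_mul]
  have hpart : orderedShare ⁻¹' A = ⋃ σ : Equiv.Perm (Fin (n + 1)),
      ({p | decreasingOrder p = σ} ∩ orderedShare ⁻¹' A) := by
    ext p; simp
  rw [hpart, measure_iUnion]
  · rw [tsum_fintype]
    have hσ : ∀ σ : Equiv.Perm (Fin (n + 1)),
        P ({p | decreasingOrder p = σ} ∩ orderedShare ⁻¹' A) =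
          P (A ∩ decreasingSimplex (n + 1)) := by
      intro σ
      conv_rhs => rw [← map_perm_uniform hP σ]
      rw [Measure.map_apply (measurable_comp_perm σ)
        (hA.inter (measurableSet_decreasingSimplex _))]
      refine measure_congr ?_
      filter_upwards [hties, ae_mem_shareSimplex hac] with p hp hpS
      refine propext ?_
      have hS : p ∘ σ ∈ shareSimplex (n + 1) :=
        ⟨fun i => hpS.1 (σ i), by rw [← hpS.2]; exact Equiv.sum_comp σ p⟩
      change (decreasingOrder p = σ ∧ p ∘ decreasingOrder p ∈ A) ↔
        (p ∘ σ ∈ A ∧ p ∘ σ ∈ shareSimplex (n + 1) ∧ StrictAnti (p ∘ σ))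
      rw [← decreasingOrder_eq_iff hp]
      constructor
      · rintro ⟨rfl, h⟩; exact ⟨h, hS, rfl⟩
      · rintro ⟨h, -, rfl⟩; exact ⟨rfl, h⟩
    rw [Finset.sum_congr rfl fun σ _ => hσ σ, Finset.sum_const, Finset.card_univ, nsmul_eq_mul]
  · intro σ τ hστ
    refine Set.disjoint_left.2 fun p h1 h2 => hστ ?_
    exact h1.1.symm.trans h2.1
  · exact fun σ => (measurableSet_decreasingOrder_eq σ).inter (measurable_orderedShare _ hA)

end Uniform

/-! ### Moments of the sorted uniform proportions -/

theorem sum_Ici_eq_tailSum {m : ℕ} (j : Fin m) (r : ℕ) :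
    ∑ k ∈ Finset.Ici j, 1 / ((k : ℕ) + 1 : ℝ) ^ r = tailSum j r := by
  rw [tailSum]
  refine Finset.sum_bij (fun k _ => (k : ℕ) + 1) ?_ ?_ ?_ ?_
  · intro k hk
    have : j ≤ k := Finset.mem_Ici.1 hk
    simp only [Finset.mem_Icc]
    have := k.2
    omega
  · intro a _ b _ h
    exact Fin.ext (by simpa using h)
  · intro i hi
    rw [Finset.mem_Icc] at hi
    refine ⟨⟨i - 1, by omega⟩, Finset.mem_Ici.2 (Fin.le_def.2 (by simp; omega)), by simp; omega⟩
  · intro k _; push_cast; rfl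

theorem tail_step (m r : ℕ) {j : ℕ} (hj : j < m) :
    ∑ i ∈ Finset.Icc (j + 1) m, 1 / (i : ℝ) ^ r =
      1 / ((j : ℝ) + 1) ^ r + ∑ i ∈ Finset.Icc (j + 1 + 1) m, 1 / (i : ℝ) ^ r := by
  have : Finset.Icc (j + 1 + 1) m = Finset.Ioc (j + 1) m := by
    ext i; simp only [Finset.mem_Icc, Finset.mem_Ioc]; omega
  rw [this, ← Finset.add_sum_Ioc_eq_sum_Icc (by omega : j + 1 ≤ m)]
  push_cast
  rfl

/-- Summation by parts for the tails of the harmonic series. -/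
theorem sum_tailSum_sq {m : ℕ} (hm : 0 < m) : ∑ j : Fin m, tailSum j 2 = tailSum ⟨0, hm⟩ 1 ∧
    ∑ j : Fin m, tailSum j 1 ^ 2 = 2 * m - tailSum ⟨0, hm⟩ 1 := by
  let H : ℕ → ℕ → ℝ := fun r j => ∑ i ∈ Finset.Icc (j + 1) m, 1 / (i : ℝ) ^ r
  have hstep : ∀ r j, j < m → H r j = 1 / ((j : ℝ) + 1) ^ r + H r (j + 1) := fun r j hj =>
    tail_step m r hj
  have hend : ∀ r, H r m = 0 := fun r => by simp [H]
  -- the sequence `j * H r j ^ a` telescopes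
  have htel : ∀ (r a : ℕ), ∑ j ∈ Finset.range m,
      (((j + 1 : ℕ) : ℝ) * H r (j + 1) ^ a - (j : ℝ) * H r j ^ a) = m * H r m ^ a := by
    intro r a
    rw [Finset.sum_range_sub fun j : ℕ => (j : ℝ) * H r j ^ a]
    simp
  have h0 : tailSum (⟨0, hm⟩ : Fin m) 1 = ∑ j ∈ Finset.range m, 1 / ((j : ℝ) + 1) := by
    have : ∀ j ∈ Finset.range m, 1 / ((j : ℝ) + 1) = -(H 1 (j + 1) - H 1 j) := by
      intro j hj
      rw [hstep 1 j (Finset.mem_range.1 hj)]; ring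
    rw [Finset.sum_congr rfl this, Finset.sum_neg_distrib, Finset.sum_range_sub, hend]
    simp [H, tailSum]
  have hF : ∀ r a, ∑ j : Fin m, tailSum j r ^ a = ∑ j ∈ Finset.range m, H r j ^ a := fun r a =>
    Fin.sum_univ_eq_sum_range (fun j => H r j ^ a) m
  have hne : ∀ j : ℕ, ((j : ℝ) + 1) ≠ 0 := fun j => by positivity
  have e1 : ∑ j ∈ Finset.range m, H 2 j = ∑ j ∈ Finset.range m, 1 / ((j : ℝ) + 1) := by
    have h := htel 2 1
    rw [hend, Finset.sum_congr rfl (g := fun j : ℕ => H 2 j - 1 / ((j : ℝ) + 1))] at h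
    · rw [Finset.sum_sub_distrib] at h
      linarith
    · intro j hj
      rw [hstep 2 j (Finset.mem_range.1 hj)]
      have := hne j
      push_cast
      field_simp
      ring
  have e2 : ∑ j ∈ Finset.range m, H 1 j = m := by
    have h := htel 1 1
    rw [hend, Finset.sum_congr rfl (g := fun j : ℕ => H 1 j - 1)] at h
    · rw [Finset.sum_sub_distrib] at h
      simp at h
      linarith
    · intro j hj
      rw [hstep 1 j (Finset.mem_range.1 hj)]
      have := hne j
      push_cast
      field_simp
      ring
  have e3 : ∑ j ∈ Finset.range m, H 1 j ^ 2 =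
      2 * m - ∑ j ∈ Finset.range m, 1 / ((j : ℝ) + 1) := by
    have h := htel 1 2
    rw [hend, Finset.sum_congr rfl
      (g := fun j : ℕ => H 1 j ^ 2 - 2 * H 1 j + 1 / ((j : ℝ) + 1))] at h
    · rw [Finset.sum_add_distrib, Finset.sum_sub_distrib, ← Finset.mul_sum, e2] at h
      linarith
    · intro j hj
      rw [hstep 1 j (Finset.mem_range.1 hj)]
      have := hne j
      push_cast
      field_simp
      ring
  refine ⟨?_, ?_⟩
  · rw [h0, ← e1]
    simpa using hF 2 1
  · rw [h0, ← e3]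
    exact hF 1 2

theorem tailSum_lt {m : ℕ} (hm : 2 ≤ m) : tailSum (⟨0, by omega⟩ : Fin m) 1 < m := by
  have h : ∑ i ∈ Finset.Icc 1 m, 1 / (i : ℝ) ^ 1 < ∑ i ∈ Finset.Icc 1 m, (1 : ℝ) := by
    refine Finset.sum_lt_sum (fun i hi => ?_) ⟨2, Finset.mem_Icc.2 ⟨by omega, hm⟩, by norm_num⟩
    have : (1 : ℝ) ≤ i := by exact_mod_cast (Finset.mem_Icc.1 hi).1
    rw [pow_one, div_le_one (by linarith)]
    exact this
  simpa [tailSum] using h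

/-- The linear map that sends the vertices of the simplex to those of the simplex of decreasing
proportions, namely the uniform distributions on the `k` largest parties. -/
noncomputable def vertexMap (n : ℕ) : (Fin (n + 1) → ℝ) →ₗ[ℝ] (Fin (n + 1) → ℝ) where
  toFun w j := ∑ k ∈ Finset.Ici j, w k / ((k : ℕ) + 1 : ℝ)
  map_add' x y := by
    ext j
    simp [add_div, Finset.sum_add_distrib]
  map_smul' a x := by
    ext j
    simp [Finset.mul_sum, mul_div_assoc]

theorem vertexMap_apply {n : ℕ} (w : Fin (n + 1) → ℝ) (j : Fin (n + 1)) :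
    vertexMap n w j = ∑ k ∈ Finset.Ici j, w k / ((k : ℕ) + 1 : ℝ) := rfl

theorem vertexMap_last {n : ℕ} (w : Fin (n + 1) → ℝ) :
    vertexMap n w (Fin.last n) = w (Fin.last n) / ((n : ℝ) + 1) := by
  have : Finset.Ici (Fin.last n) = {Fin.last n} := by
    ext k; simp [Fin.last_le_iff]
  rw [vertexMap_apply, this, Finset.sum_singleton, Fin.val_last]

theorem vertexMap_castSucc {n : ℕ} (w : Fin (n + 1) → ℝ) (i : Fin n) :
    vertexMap n w i.castSucc = w i.castSucc / ((i : ℕ) + 1 : ℝ) + vertexMap n w i.succ := by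
  have h : Finset.Ici i.castSucc = insert i.castSucc (Finset.Ici i.succ) := by
    ext k
    simp only [Finset.mem_Ici, Finset.mem_insert, Fin.le_def, Fin.ext_iff, Fin.val_castSucc,
      Fin.val_succ]
    omega
  rw [vertexMap_apply, h, Finset.sum_insert, Fin.val_castSucc, ← vertexMap_apply]
  simp [Fin.le_def]

theorem vertexMap_injective (n : ℕ) : Function.Injective (vertexMap n) := by
  refine (injective_iff_map_eq_zero _).2 fun w hw => ?_
  have h : ∀ i, vertexMap n w i = 0 := fun i => by rw [hw]; rfl
  ext i
  refine Fin.lastCases ?_ (fun i => ?_) i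
  · have := vertexMap_last w
    rw [h, eq_comm, div_eq_zero_iff] at this
    exact this.resolve_right (by positivity)
  · have := vertexMap_castSucc w i
    rw [h, h, add_zero, eq_comm, div_eq_zero_iff] at this
    exact this.resolve_right (by positivity)

theorem sum_vertexMap {n : ℕ} (w : Fin (n + 1) → ℝ) : ∑ j, vertexMap n w j = ∑ j, w j := by
  simp only [vertexMap_apply]
  rw [Finset.sum_comm' (t' := Finset.univ) (s' := fun k => Finset.Iic k)]
  · refine Finset.sum_congr rfl fun k _ => ?_
    rw [Finset.sum_const, Fin.card_Iic, nsmul_eq_mul]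
    push_cast
    field_simp
  · intro x y; simp

theorem vertexMap_mem_iff {n : ℕ} (hn : 2 ≤ n + 1) (w : Fin (n + 1) → ℝ) (hw : ∑ i, w i = 1) :
    vertexMap n w ∈ decreasingSimplex (n + 1) ↔ w ∈ shareSimplex (n + 1) := by
  have hanti : StrictAnti (vertexMap n w) ↔ ∀ i : Fin n, 0 < w i.castSucc := by
    rw [Fin.strictAnti_iff_succ_lt]
    refine forall_congr' fun i => ?_
    rw [vertexMap_castSucc, lt_add_iff_pos_left, div_pos_iff_of_pos_right (by positivity)]
  rw [decreasingSimplex, Set.mem_ofPred_eq, hanti, mem_shareSimplex_iff hn, mem_shareSimplex_iff hn,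
    sum_vertexMap]
  constructor
  · rintro ⟨⟨h1, -⟩, h2⟩
    refine ⟨fun i => Fin.lastCases ?_ h2 i, hw⟩
    have := h1 (Fin.last n)
    rwa [vertexMap_last, div_pos_iff_of_pos_right (by positivity)] at this
  · rintro ⟨h, -⟩
    refine ⟨⟨fun i => ?_, hw⟩, fun i => h _⟩
    rw [vertexMap_apply]
    exact Finset.sum_pos (fun k _ => div_pos (h k) (by positivity)) ⟨i, Finset.mem_Ici.2 le_rfl⟩

section Uniform

variable {n : ℕ} {P : Measure (Fin (n + 1) → ℝ)} [IsProbabilityMeasure P] {κ : ENNReal}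

/-- The sorted uniform distribution on the simplex is the image of the uniform distribution under
a linear map: both are proportional to the volume of the simplex of decreasing proportions. -/
theorem map_orderedShare_eq_map_vertexMap (hn : 2 ≤ n + 1) (hP : P = κ • shareVolume (n + 1)) :
    P.map orderedShare = P.map (vertexMap n) := by
  obtain ⟨a, ha⟩ := exists_map_shareVolume_eq_smul (vertexMap n) (vertexMap_injective n)
    sum_vertexMap (measurableSet_decreasingSimplex _) (fun _ hx => hx.1) (vertexMap_mem_iff hn)
  have hLm : Measurable (vertexMap n) :=
    (vertexMap n).continuous_of_finiteDimensional.measurable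
  have h1 := map_orderedShare_uniform hP
  have h2 : P.map (vertexMap n) = a • P.restrict (decreasingSimplex (n + 1)) := by
    rw [hP, Measure.map_smul, ha, Measure.restrict_smul, smul_comm]
  have hp1 : IsProbabilityMeasure (P.map orderedShare) :=
    Measure.isProbabilityMeasure_map (measurable_orderedShare _).aemeasurable
  have hp2 : IsProbabilityMeasure (P.map (vertexMap n)) :=
    Measure.isProbabilityMeasure_map hLm.aemeasurable
  have e1 := congrArg (fun ρ => ρ Set.univ) h1
  have e2 := congrArg (fun ρ => ρ Set.univ) h2
  simp only [measure_univ, Measure.smul_apply, smul_eq_mul, Measure.restrict_apply_univ] at e1 e2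
  have hne : P (decreasingSimplex (n + 1)) ≠ 0 := fun h0 => by
    rw [h0, mul_zero] at e1; exact one_ne_zero e1
  rw [h1, h2, (ENNReal.mul_left_inj hne (measure_ne_top P _)).1 (e1.symm.trans e2)]

theorem integrable_of_mem_simplex (hP : P = κ • shareVolume (n + 1)) {f : (Fin (n + 1) → ℝ) → ℝ}
    (hf : Measurable f) {C : ℝ} (hC : ∀ x ∈ shareSimplex (n + 1), |f x| ≤ C) : Integrable f P := by
  refine Integrable.of_bound hf.aestronglyMeasurable C ?_
  filter_upwards [ae_mem_shareSimplex (absolutelyContinuous_of_eq_smul hP)] with x hx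
  exact hC x hx

theorem integrable_mul_of_uniform (hP : P = κ • shareVolume (n + 1)) (k l : Fin (n + 1)) :
    Integrable (fun x => x k * x l) P := by
  refine integrable_of_mem_simplex hP (by fun_prop) (C := 1) fun x hx => ?_
  have hk := hx.1 k
  have hl := hx.1 l
  rw [abs_of_pos (mul_pos hk.1 hl.1)]
  nlinarith [hk.1, hk.2, hl.1, hl.2]

theorem integrable_eval_of_uniform (hP : P = κ • shareVolume (n + 1)) (k : Fin (n + 1)) :
    Integrable (fun x => x k) P := by
  refine integrable_of_mem_simplex hP (by fun_prop) (C := 1) fun x hx => ?_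
  rw [abs_of_pos (hx.1 k).1]
  exact (hx.1 k).2.le

theorem integral_comp_perm_uniform (hP : P = κ • shareVolume (n + 1))
    (σ : Equiv.Perm (Fin (n + 1))) {f : (Fin (n + 1) → ℝ) → ℝ} (hf : Measurable f) :
    ∫ x, f (x ∘ σ) ∂P = ∫ x, f x ∂P := by
  conv_rhs => rw [← map_perm_uniform hP σ]
  rw [integral_map (measurable_comp_perm σ).aemeasurable hf.aestronglyMeasurable]

theorem integral_eval_uniform (hP : P = κ • shareVolume (n + 1)) (k : Fin (n + 1)) :
    ∫ x, x k ∂P = 1 / ((n : ℝ) + 1) := by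
  have hsym : ∀ l, ∫ x, x l ∂P = ∫ x, x k ∂P := by
    intro l
    have := integral_comp_perm_uniform hP (Equiv.swap k l) (f := fun x => x k) (by fun_prop)
    simpa using this
  have hsum : ∑ l, ∫ x, x l ∂P = 1 := by
    rw [← integral_finsetSum _ fun l _ => integrable_eval_of_uniform hP l]
    have : ∀ᵐ x ∂P, ∑ l, x l = 1 :=
      (ae_mem_shareSimplex (absolutelyContinuous_of_eq_smul hP)).mono fun x hx => hx.2
    rw [integral_congr_ae this]
    simp
  rw [Finset.sum_congr rfl fun l _ => hsym l, Finset.sum_const, Finset.card_univ, Fintype.card_fin,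
    nsmul_eq_mul] at hsum
  push_cast at hsum
  rw [eq_div_iff (by positivity)]
  linarith

/-- By exchangeability, two numbers determine all the second moments. -/
theorem exists_integral_mul_uniform (hP : P = κ • shareVolume (n + 1)) :
    ∃ A B : ℝ, ∀ k l : Fin (n + 1), ∫ x, x k * x l ∂P = B + if k = l then A - B else 0 := by
  have hmove : ∀ k k' l : Fin (n + 1), k ≠ l → k' ≠ l →
      ∫ x, x k * x l ∂P = ∫ x, x k' * x l ∂P := by
    intro k k' l hk hk'
    have := integral_comp_perm_uniform hP (Equiv.swap k' k) (f := fun x => x k' * x l)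
      (by fun_prop)
    simpa [Equiv.swap_apply_of_ne_of_ne hk'.symm hk.symm] using this
  have hcomm : ∀ k l : Fin (n + 1), ∫ x, x k * x l ∂P = ∫ x, x l * x k ∂P := fun k l => by
    congr 1; ext x; ring
  have hdiag : ∀ k : Fin (n + 1), ∫ x, x k * x k ∂P = ∫ x, x 0 * x 0 ∂P := by
    intro k
    have := integral_comp_perm_uniform hP (Equiv.swap 0 k) (f := fun x => x 0 * x 0)
      (by fun_prop)
    simpa using this
  have hoff : ∃ B : ℝ, ∀ k l : Fin (n + 1), k ≠ l → ∫ x, x k * x l ∂P = B := by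
    by_cases hex : ∃ k l : Fin (n + 1), k ≠ l
    · obtain ⟨a, b, hab⟩ := hex
      refine ⟨∫ x, x a * x b ∂P, fun k l hkl => ?_⟩
      by_cases hl : l = a
      · subst hl
        rw [hmove k b l hkl hab.symm, hcomm]
      · rw [hmove k a l hkl (Ne.symm hl), hcomm, hmove l b a hl hab.symm, hcomm]
    · push Not at hex
      exact ⟨0, fun k l hkl => absurd (hex k l) hkl⟩
  obtain ⟨B, hB⟩ := hoff
  refine ⟨∫ x, x 0 * x 0 ∂P, B, fun k l => ?_⟩
  by_cases hkl : k = l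
  · subst hkl; rw [hdiag]; simp
  · rw [hB k l hkl, if_neg hkl, add_zero]

theorem integral_orderedShare_uniform (hn : 2 ≤ n + 1) (hP : P = κ • shareVolume (n + 1))
    (j : Fin (n + 1)) :
    ∫ x, orderedShare x j ∂P = tailSum j 1 / ((n + 1 : ℕ) : ℝ) := by
  have hLm : Measurable (vertexMap n) :=
    (vertexMap n).continuous_of_finiteDimensional.measurable
  have h1 : ∫ x, orderedShare x j ∂P = ∫ x, vertexMap n x j ∂P := by
    rw [← integral_map (f := fun y : Fin (n + 1) → ℝ => y j)
      (measurable_orderedShare _).aemeasurable (measurable_pi_apply j).aestronglyMeasurable,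
      map_orderedShare_eq_map_vertexMap hn hP,
      integral_map hLm.aemeasurable (measurable_pi_apply j).aestronglyMeasurable]
  rw [h1]
  simp only [vertexMap_apply]
  rw [integral_finsetSum _ fun k _ => (integrable_eval_of_uniform hP k).div_const _,
    ← sum_Ici_eq_tailSum, Finset.sum_div]
  refine Finset.sum_congr rfl fun k _ => ?_
  rw [integral_div, integral_eval_uniform hP]
  push_cast
  rw [pow_one, div_div, div_div, mul_comm]

/-- The second moments of the sorted uniform distribution. The mean square of a single proportion
is found from the invariance of the sum of squares under sorting. -/
theorem integral_orderedShare_sq_uniform (hn : 2 ≤ n + 1) (hP : P = κ • shareVolume (n + 1))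
    (j : Fin (n + 1)) :
    ∫ x, orderedShare x j ^ 2 ∂P =
      (tailSum j 2 + tailSum j 1 ^ 2) / (((n + 1 : ℕ) : ℝ) * (((n + 1 : ℕ) : ℝ) + 1)) := by
  obtain ⟨A, B, hAB⟩ := exists_integral_mul_uniform hP
  have hLm : Measurable (vertexMap n) :=
    (vertexMap n).continuous_of_finiteDimensional.measurable
  have hsort : ∀ {f : (Fin (n + 1) → ℝ) → ℝ}, Measurable f →
      ∫ x, f (orderedShare x) ∂P = ∫ x, f (vertexMap n x) ∂P := by
    intro f hf
    rw [← integral_map (measurable_orderedShare _).aemeasurable hf.aestronglyMeasurable,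
      map_orderedShare_eq_map_vertexMap hn hP,
      integral_map hLm.aemeasurable hf.aestronglyMeasurable]
  have hexp : ∀ j x, vertexMap n x j ^ 2 = ∑ k ∈ Finset.Ici j, ∑ l ∈ Finset.Ici j,
      (1 / (((k : ℕ) + 1 : ℝ)) * (1 / ((l : ℕ) + 1 : ℝ))) * (x k * x l) := by
    intro j x
    rw [pow_two, vertexMap_apply, Finset.sum_mul_sum]
    refine Finset.sum_congr rfl fun k _ => Finset.sum_congr rfl fun l _ => ?_
    ring
  have hsq : ∀ j, ∫ x, vertexMap n x j ^ 2 ∂P = B * tailSum j 1 ^ 2 + (A - B) * tailSum j 2 := by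
    intro j
    simp only [hexp]
    rw [integral_finsetSum _ fun k _ => integrable_finsetSum _ fun l _ =>
      (integrable_mul_of_uniform hP k l).const_mul _]
    simp_rw [integral_finsetSum (Finset.Ici j) fun l _ =>
      (integrable_mul_of_uniform hP _ l).const_mul _, integral_const_mul, hAB, mul_add,
      Finset.sum_add_distrib, mul_ite, mul_zero, Finset.sum_ite_eq]
    congr 1
    · rw [← sum_Ici_eq_tailSum, pow_two, Finset.sum_mul_sum, Finset.mul_sum]
      refine Finset.sum_congr rfl fun k _ => ?_
      rw [Finset.mul_sum]
      refine Finset.sum_congr rfl fun l _ => ?_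
      simp only [pow_one]; ring
    · rw [← sum_Ici_eq_tailSum, Finset.mul_sum]
      refine Finset.sum_congr rfl fun k hk => ?_
      rw [if_pos hk]
      field_simp
  have hint : ∀ j, Integrable (fun x => vertexMap n x j ^ 2) P := by
    intro j
    simp only [hexp]
    exact integrable_finsetSum _ fun k _ => integrable_finsetSum _ fun l _ =>
      (integrable_mul_of_uniform hP k l).const_mul _
  set m : ℝ := ((n + 1 : ℕ) : ℝ) with hm
  have hm2 : (2 : ℝ) ≤ m := by rw [hm]; exact_mod_cast hn
  -- the square of the total is `1`
  have r1 : m * A + m * (m - 1) * B = 1 := by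
    have h1 : ∫ x, (∑ k, x k) * ∑ l, x l ∂P = 1 := by
      have : ∀ᵐ x ∂P, (∑ l, x l) * ∑ l, x l = 1 :=
        (ae_mem_shareSimplex (absolutelyContinuous_of_eq_smul hP)).mono fun x hx => by
          rw [hx.2, one_mul]
      rw [integral_congr_ae this]
      simp
    simp only [Finset.sum_mul_sum] at h1
    rw [integral_finsetSum _ fun k _ => integrable_finsetSum _ fun l _ =>
      integrable_mul_of_uniform hP k l] at h1
    simp_rw [integral_finsetSum Finset.univ fun l _ => integrable_mul_of_uniform hP _ l, hAB,
      Finset.sum_add_distrib, Finset.sum_ite_eq] at h1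
    simp only [Finset.mem_univ, if_true, Finset.sum_const, Finset.card_univ, Fintype.card_fin,
      nsmul_eq_mul, ← hm] at h1
    linear_combination h1
  -- sorting preserves the sum of squares
  have r2 : m * A = ∑ j : Fin (n + 1), (B * tailSum j 1 ^ 2 + (A - B) * tailSum j 2) := by
    rw [← Finset.sum_congr rfl fun j _ => hsq j, ← integral_finsetSum _ fun j _ => hint j,
      ← hsort (f := fun y => ∑ j, y j ^ 2) (by fun_prop)]
    have : ∀ x : Fin (n + 1) → ℝ, ∑ j, orderedShare x j ^ 2 = ∑ j, x j * x j := by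
      intro x
      simp only [orderedShare, ← pow_two]
      exact Equiv.sum_comp (decreasingOrder x) fun i => x i ^ 2
    simp only [this]
    rw [integral_finsetSum _ fun k _ => integrable_mul_of_uniform hP k k]
    simp [hAB, hm]
  obtain ⟨t1, t2⟩ := sum_tailSum_sq (m := n + 1) (Nat.succ_pos n)
  rw [Finset.sum_add_distrib, ← Finset.mul_sum, ← Finset.mul_sum, t1, t2, ← hm] at r2
  have hlt := tailSum_lt hn
  rw [← hm] at hlt
  -- the factor `m - (1 + 1 / 2 + ⋯ + 1 / m)` is nonzero since `2 ≤ m`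
  have r3 : A = 2 * B := by
    have h : (A - 2 * B) * (m - tailSum (⟨0, Nat.succ_pos n⟩ : Fin (n + 1)) 1) = 0 := by
      linear_combination r2
    have := (mul_eq_zero.1 h).resolve_right (sub_ne_zero.2 hlt.ne')
    linarith
  have r4 : B = 1 / (m * (m + 1)) := by
    rw [eq_div_iff (by positivity)]
    rw [r3] at r1
    linear_combination r1
  rw [hsort (f := fun y => y j ^ 2) (by fun_prop), hsq j, r3, r4]
  field_simp
  ring

end Uniform

/-! ### Moments of the limits and convergence of moments -/

theorem ae_centredLaw_abs_le : ∀ᵐ x ∂centredLaw, |x| ≤ 1 / 2 := by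
  have h : ∀ᵐ x ∂centredLaw, x ∈ Set.Ioo (-1 / 2 : ℝ) (1 / 2) := ae_restrict_mem measurableSet_Ioo
  filter_upwards [h] with x hx
  rw [abs_le]
  constructor <;> linarith [hx.1, hx.2]

theorem integral_centredLaw : ∫ x, x ∂centredLaw = 0 := by
  rw [centredLaw, ← integral_Ioc_eq_integral_Ioo, ← intervalIntegral.integral_of_le (by norm_num)]
  simp
  norm_num

theorem integral_sq_centredLaw : ∫ x, x ^ 2 ∂centredLaw = 1 / 12 := by
  rw [centredLaw, ← integral_Ioc_eq_integral_Ioo, ← intervalIntegral.integral_of_le (by norm_num)]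
  simp
  norm_num

section Pi

variable {ι : Type*} [Fintype ι]

theorem ae_pi_centredLaw_abs_le :
    ∀ᵐ t ∂(Measure.pi fun _ : ι => centredLaw), ∀ k, |t k| ≤ 1 / 2 := by
  rw [ae_all_iff]
  intro k
  exact (measurePreserving_eval (fun _ : ι => centredLaw) k).quasiMeasurePreserving.ae
    ae_centredLaw_abs_le

theorem integrable_eval_pi_centredLaw (k : ι) :
    Integrable (fun t => t k) (Measure.pi fun _ : ι => centredLaw) :=
  Integrable.of_bound (Measurable.aestronglyMeasurable (by fun_prop)) (1 / 2)
    (ae_pi_centredLaw_abs_le.mono fun _ h => h k)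

theorem integrable_mul_pi_centredLaw (k l : ι) :
    Integrable (fun t => t k * t l) (Measure.pi fun _ : ι => centredLaw) := by
  refine Integrable.of_bound (Measurable.aestronglyMeasurable (by fun_prop)) (1 / 2 * (1 / 2)) ?_
  filter_upwards [ae_pi_centredLaw_abs_le (ι := ι)] with t ht
  rw [norm_mul]
  exact mul_le_mul (ht k) (ht l) (norm_nonneg _) (by norm_num)

theorem integral_eval_pi_centredLaw (k : ι) :
    ∫ t, t k ∂(Measure.pi fun _ : ι => centredLaw) = 0 := by
  rw [← integral_centredLaw]
  exact integral_comp_eval (μ := fun _ : ι => centredLaw) (f := fun x => x) (by fun_prop)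

theorem integral_mul_pi_centredLaw [DecidableEq ι] (k l : ι) :
    ∫ t, t k * t l ∂(Measure.pi fun _ : ι => centredLaw) = if k = l then 1 / 12 else 0 := by
  split_ifs with hkl
  · subst hkl
    rw [← integral_sq_centredLaw]
    simp only [← pow_two]
    exact integral_comp_eval (μ := fun _ : ι => centredLaw) (f := fun x => x ^ 2) (by fun_prop)
  · have hind : iIndepFun (fun i (t : ι → ℝ) => t i) (Measure.pi fun _ : ι => centredLaw) :=
      iIndepFun_pi (X := fun _ x => x) fun _ => aemeasurable_id
    have := (hind.indepFun hkl).integral_fun_mul_eq_mul_integral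
      (Measurable.aestronglyMeasurable (by fun_prop))
      (Measurable.aestronglyMeasurable (by fun_prop))
    rw [this, integral_eval_pi_centredLaw, zero_mul]

theorem integral_add_sum_pi_centredLaw (a : ℝ) (s : ι → ℝ) :
    ∫ t, (a + ∑ k, s k * t k) ∂(Measure.pi fun _ : ι => centredLaw) = a := by
  rw [integral_add (integrable_const a)
    (integrable_finsetSum _ fun k _ => (integrable_eval_pi_centredLaw k).const_mul _),
    integral_finsetSum _ fun k _ => (integrable_eval_pi_centredLaw k).const_mul _]
  simp [integral_const_mul, integral_eval_pi_centredLaw]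

theorem integral_add_sum_sq_pi_centredLaw (a : ℝ) (s : ι → ℝ) :
    ∫ t, (a + ∑ k, s k * t k) ^ 2 ∂(Measure.pi fun _ : ι => centredLaw) =
      a ^ 2 + 1 / 12 * ∑ k, s k ^ 2 := by
  classical
  have h1 : ∀ t : ι → ℝ, (a + ∑ k, s k * t k) ^ 2 =
      a * (a + ∑ k, (2 * s k) * t k) + ∑ k, ∑ l, (s k * s l) * (t k * t l) := by
    intro t
    have : (∑ k, s k * t k) * ∑ l, s l * t l = ∑ k, ∑ l, (s k * s l) * (t k * t l) := by
      rw [Finset.sum_mul_sum]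
      exact Finset.sum_congr rfl fun k _ => Finset.sum_congr rfl fun l _ => by ring
    rw [← this]
    simp only [mul_assoc, ← Finset.mul_sum]
    ring
  simp only [h1]
  rw [integral_add, integral_const_mul, integral_add_sum_pi_centredLaw, integral_finsetSum _
    fun k _ => integrable_finsetSum _ fun l _ => (integrable_mul_pi_centredLaw k l).const_mul _]
  · simp_rw [integral_finsetSum Finset.univ fun l _ =>
      (integrable_mul_pi_centredLaw _ l).const_mul _, integral_const_mul,
      integral_mul_pi_centredLaw, mul_ite, mul_zero, Finset.sum_ite_eq]
    simp only [Finset.mem_univ, if_true, Finset.mul_sum]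
    congr 1
    · ring
    · exact Finset.sum_congr rfl fun k _ => by ring
  · exact ((integrable_const a).add (integrable_finsetSum _ fun k _ =>
      (integrable_eval_pi_centredLaw k).const_mul _)).const_mul _
  · exact integrable_finsetSum _ fun k _ => integrable_finsetSum _ fun l _ =>
      (integrable_mul_pi_centredLaw k l).const_mul _

end Pi

theorem abs_add_sum_le {r : ℕ} {a y C : ℝ} (ha : |a| ≤ C) (hy : |y| ≤ C) {t : Fin (r + 1) → ℝ}
    (ht : ∀ k, |t k| ≤ 1 / 2) :
    |a + ∑ k, (Fin.cons 1 (fun _ => y) : Fin (r + 1) → ℝ) k * t k| ≤ C + (1 / 2 + r * (C * (1 / 2)))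
    := by
  refine (abs_add_le _ _).trans (add_le_add ha ?_)
  rw [Fin.sum_univ_succ]
  refine (abs_add_le _ _).trans (add_le_add ?_ ?_)
  · simpa using ht 0
  · refine (Finset.abs_sum_le_sum_abs _ _).trans ?_
    have : ∀ k ∈ (Finset.univ : Finset (Fin r)),
        |(Fin.cons 1 (fun _ => y) : Fin (r + 1) → ℝ) k.succ * t k.succ| ≤ C * (1 / 2) := by
      intro k _
      rw [Fin.cons_succ, abs_mul]
      exact mul_le_mul hy (ht _) (abs_nonneg _) ((abs_nonneg _).trans hy)
    refine (Finset.sum_le_sum this).trans ?_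
    simp

/-- Moments of a limit variable: the uniform variables contribute `1 / 12` each to the variance,
weighted by the squares of their coefficients. -/
theorem IsCentredUniforms.moments {Ω : Type*} [MeasurableSpace Ω] {μ : Measure Ω}
    [IsProbabilityMeasure μ] {m : ℕ} {p : Ω → Fin m → ℝ} {T : ℕ → Ω → ℝ}
    (h : IsCentredUniforms μ p T) {P : Measure (Fin m → ℝ)} [IsProbabilityMeasure P]
    (hp : HasLaw p P μ) {a y : (Fin m → ℝ) → ℝ} (ha : Measurable a) (hy : Measurable y) {C : ℝ}
    (haC : ∀ᵐ x ∂P, |a x| ≤ C) (hyC : ∀ᵐ x ∂P, |y x| ≤ C) (r : ℕ) {X : Ω → ℝ}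
    (hX : ∀ ω, X ω = a (p ω) + T 0 ω + y (p ω) * ∑ k ∈ Finset.Icc 1 r, T k ω) :
    AEMeasurable X μ ∧ (∃ K, ∀ᵐ ω ∂μ, |X ω| ≤ K) ∧ ∫ ω, X ω ∂μ = ∫ x, a x ∂P ∧
      Var[X; μ] = Var[a; P] + 1 / 12 * (1 + r * ∫ x, y x ^ 2 ∂P) := by
  set π : Measure (Fin (r + 1) → ℝ) := Measure.pi fun _ => centredLaw with hπ
  have hlaw := h.hasLaw_prod hp r
  let s : (Fin m → ℝ) → Fin (r + 1) → ℝ := fun x => Fin.cons 1 fun _ => y x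
  let g : (Fin m → ℝ) × (Fin (r + 1) → ℝ) → ℝ := fun z => a z.1 + ∑ k, s z.1 k * z.2 k
  have hsm : ∀ k, Measurable fun x => s x k := fun k =>
    Fin.cases (by simp only [s, Fin.cons_zero]; exact measurable_const)
      (fun k => by simp only [s, Fin.cons_succ]; exact hy) k
  have hg : Measurable g := by
    refine (ha.comp measurable_fst).add (Finset.measurable_sum _ fun k _ => ?_)
    exact ((hsm k).comp measurable_fst).mul ((measurable_pi_apply k).comp measurable_snd)
  have hXg : X = g ∘ fun ω => (p ω, fun k : Fin (r + 1) => T k ω) := by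
    ext ω
    rw [hX]
    simp only [g, s, Function.comp, Fin.sum_univ_succ, Fin.cons_zero, Fin.cons_succ, Fin.val_zero,
      Fin.val_succ, ← Finset.mul_sum, sum_Icc_one_eq_sum_fin r fun k => T k ω]
    ring
  have hXm : AEMeasurable X μ := by
    rw [hXg]; exact hg.comp_aemeasurable hlaw.aemeasurable
  have hgK : ∀ᵐ z ∂P.prod π, |g z| ≤ C + (1 / 2 + r * (C * (1 / 2))) := by
    filter_upwards [Measure.quasiMeasurePreserving_fst.ae haC,
      Measure.quasiMeasurePreserving_fst.ae hyC,
      Measure.quasiMeasurePreserving_snd.ae (ae_pi_centredLaw_abs_le (ι := Fin (r + 1)))]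
      with z h1 h2 h3
    exact abs_add_sum_le h1 h2 h3
  have hXK : ∀ᵐ ω ∂μ, |X ω| ≤ C + (1 / 2 + r * (C * (1 / 2))) := by
    rw [hXg]
    rw [← hlaw.map_eq] at hgK
    exact ae_of_ae_map hlaw.aemeasurable hgK
  have hgi : ∀ j : ℕ, Integrable (fun z => g z ^ j) (P.prod π) := fun j => by
    refine Integrable.of_bound (hg.pow_const j).aestronglyMeasurable
      ((C + (1 / 2 + r * (C * (1 / 2)))) ^ j) ?_
    filter_upwards [hgK] with z hz
    rw [norm_pow]
    exact pow_le_pow_left₀ (norm_nonneg _) hz j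
  have hE : ∫ ω, X ω ∂μ = ∫ x, a x ∂P := by
    have := integral_prod (fun z => g z) (by simpa using hgi 1)
    rw [hXg, hlaw.integral_comp hg.aestronglyMeasurable, this]
    simp only [g, integral_add_sum_pi_centredLaw, hπ]
  have hai : ∀ {f : (Fin m → ℝ) → ℝ}, Measurable f → (∀ᵐ x ∂P, |f x| ≤ C) →
      MemLp f 2 P := fun hf hfC => MemLp.of_bound hf.aestronglyMeasurable C hfC
  have hE2 : ∫ ω, X ω ^ 2 ∂μ =
      ∫ x, a x ^ 2 ∂P + 1 / 12 * (1 + r * ∫ x, y x ^ 2 ∂P) := by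
    have h1 := integral_prod (fun z => g z ^ 2) (hgi 2)
    have h2 : ∫ ω, X ω ^ 2 ∂μ = ∫ z, g z ^ 2 ∂P.prod π := by
      rw [hXg]
      exact hlaw.integral_comp (f := fun z => g z ^ 2) (hg.pow_const 2).aestronglyMeasurable
    rw [h2, h1]
    simp only [g, integral_add_sum_sq_pi_centredLaw, hπ]
    have h3 : ∀ x, ∑ k, s x k ^ 2 = 1 + r * y x ^ 2 := by
      intro x
      simp [s, Fin.sum_univ_succ]
    simp only [h3]
    have ia := (hai ha haC).integrable_sq
    have iy := (hai hy hyC).integrable_sq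
    have iy1 : Integrable (fun x => 1 + r * y x ^ 2) P :=
      (integrable_const (1 : ℝ)).add (iy.const_mul _)
    rw [integral_add ia (iy1.const_mul _),
      integral_const_mul, integral_add (integrable_const (1 : ℝ)) (iy.const_mul _),
      integral_const_mul]
    simp
  have hXL : MemLp X 2 μ := MemLp.of_bound hXm.aestronglyMeasurable _ hXK
  refine ⟨hXm, ⟨_, hXK⟩, hE, ?_⟩
  rw [variance_eq_sub hXL, variance_eq_sub (hai ha haC)]
  simp only [Pi.pow_apply]
  rw [hE, hE2]
  ring

/-- Convergence in distribution of uniformly bounded variables gives convergence of moments. -/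
theorem TendstoInDistribution.tendsto_integral_comp {Ω Ω' : Type*} [MeasurableSpace Ω]
    [MeasurableSpace Ω'] {μ : Measure Ω} [IsProbabilityMeasure μ] {μ' : Measure Ω'}
    [IsProbabilityMeasure μ'] {X : ℕ → Ω → ℝ} {Z : Ω' → ℝ}
    (h : TendstoInDistribution X atTop Z (fun _ => μ) μ') {C : ℝ}
    (hX : ∀ᶠ N in atTop, ∀ᵐ ω ∂μ, |X N ω| ≤ C) (hZ : ∀ᵐ ω ∂μ', |Z ω| ≤ C) {φ : ℝ → ℝ}
    (hφ : Continuous φ) :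
    Tendsto (fun N => ∫ ω, φ (X N ω) ∂μ) atTop (𝓝 (∫ ω, φ (Z ω) ∂μ')) := by
  -- clamping to `[-C, C]` makes `φ` bounded and does not change `φ (X N)` and `φ Z`
  have hclamp : Continuous fun x : ℝ => φ (max (-C) (min C x)) := by fun_prop
  obtain ⟨K, hK⟩ := (isCompact_Icc (a := -|C|) (b := |C|)).exists_bound_of_continuousOn
    hφ.continuousOn
  let f : BoundedContinuousFunction ℝ ℝ := BoundedContinuousFunction.ofNormedAddCommGroup
    (fun x => φ (max (-C) (min C x))) hclamp K fun x => hK _ (by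
      have h1 := neg_abs_le C
      have h2 := le_abs_self C
      have h3 := neg_le_abs C
      exact ⟨(neg_le_neg h2).trans (le_max_left _ _),
        max_le h3 ((min_le_left _ _).trans h2)⟩)
  have hf : ∀ x, |x| ≤ C → f x = φ x := by
    intro x hx
    obtain ⟨h1, h2⟩ := abs_le.1 hx
    change φ (max (-C) (min C x)) = φ x
    rw [min_eq_right h2, max_eq_right h1]
  have hlim := (ProbabilityMeasure.tendsto_iff_forall_integral_tendsto.1 h.tendsto) f
  simp only [ProbabilityMeasure.coe_mk] at hlim
  rw [integral_map h.aemeasurable_limit f.continuous.aestronglyMeasurable] at hlim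
  have e1 : ∫ ω, f (Z ω) ∂μ' = ∫ ω, φ (Z ω) ∂μ' :=
    integral_congr_ae (hZ.mono fun ω hω => hf _ hω)
  rw [e1] at hlim
  refine hlim.congr' ?_
  filter_upwards [hX] with N hN
  rw [integral_map (h.forall_aemeasurable N) f.continuous.aestronglyMeasurable]
  exact integral_congr_ae (hN.mono fun ω hω => hf _ hω)

/-- Square integrability, and convergence of mean and variance, of uniformly bounded variables that
converge in distribution. -/
theorem TendstoInDistribution.tendsto_moments {Ω Ω' : Type*} [MeasurableSpace Ω]
    [MeasurableSpace Ω'] {μ : Measure Ω} [IsProbabilityMeasure μ] {μ' : Measure Ω'}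
    [IsProbabilityMeasure μ'] {X : ℕ → Ω → ℝ} {Z : Ω' → ℝ}
    (h : TendstoInDistribution X atTop Z (fun _ => μ) μ') {C C' : ℝ}
    (hX : ∀ᶠ N in atTop, ∀ᵐ ω ∂μ, |X N ω| ≤ C) (hZ : ∀ᵐ ω ∂μ', |Z ω| ≤ C') :
    (∀ᶠ N in atTop, MemLp (X N) 2 μ) ∧ MemLp Z 2 μ' ∧
      Tendsto (fun N => ∫ ω, X N ω ∂μ) atTop (𝓝 (∫ ω, Z ω ∂μ')) ∧
      Tendsto (fun N => Var[X N; μ]) atTop (𝓝 Var[Z; μ']) := by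
  have hL : ∀ᶠ N in atTop, MemLp (X N) 2 μ := hX.mono fun N hN =>
    MemLp.of_bound (h.forall_aemeasurable N).aestronglyMeasurable C hN
  have hZL : MemLp Z 2 μ' := MemLp.of_bound h.aemeasurable_limit.aestronglyMeasurable C' hZ
  have hX' : ∀ᶠ N in atTop, ∀ᵐ ω ∂μ, |X N ω| ≤ max C C' := hX.mono fun N hN =>
    hN.mono fun ω hω => hω.trans (le_max_left _ _)
  have hZ' : ∀ᵐ ω ∂μ', |Z ω| ≤ max C C' := hZ.mono fun ω hω => hω.trans (le_max_right _ _)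
  have h1 := TendstoInDistribution.tendsto_integral_comp h hX' hZ' (φ := id) continuous_id
  have h2 := TendstoInDistribution.tendsto_integral_comp h hX' hZ' (φ := fun x => x ^ 2)
    (by fun_prop)
  simp only [id] at h1
  refine ⟨hL, hZL, h1, ?_⟩
  rw [variance_eq_sub hZL]
  refine (h2.sub (h1.pow 2)).congr' ?_
  filter_upwards [hL] with N hN
  rw [variance_eq_sub hN]
  rfl

/-! ### Sorted parties -/

theorem IsDivisorAllocation.comp_perm {m N : ℕ} {β : ℝ} {p : Fin m → ℝ} {s : Fin m → ℤ}
    (h : IsDivisorAllocation β N p s) (σ : Equiv.Perm (Fin m)) :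
    IsDivisorAllocation β N (fun i => p (σ i)) fun i => s (σ i) := by
  obtain ⟨hs, D, hD, hr⟩ := h
  exact ⟨by rw [← hs]; exact Equiv.sum_comp σ s, D, hD, fun i => hr (σ i)⟩

theorem IsQuotaAllocation.comp_perm {m N : ℕ} {γ : ℝ} {p : Fin m → ℝ} {s : Fin m → ℤ}
    (h : IsQuotaAllocation γ N p s) (σ : Equiv.Perm (Fin m)) :
    IsQuotaAllocation γ N (fun i => p (σ i)) fun i => s (σ i) := by
  obtain ⟨hs, hr⟩ := h
  refine ⟨by rw [← hs]; exact Equiv.sum_comp σ s, ?_⟩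
  exact hr.imp (fun ⟨α, h⟩ => ⟨α, fun i => h (σ i)⟩) fun ⟨α, h⟩ => ⟨α, fun i => h (σ i)⟩

theorem IsCentredUniforms.orderedShare {Ω : Type*} [MeasurableSpace Ω] {μ : Measure Ω} {m : ℕ}
    {p : Ω → Fin m → ℝ} {T : ℕ → Ω → ℝ} (h : IsCentredUniforms μ p T) :
    IsCentredUniforms μ (fun ω => orderedShare (p ω)) T :=
  ⟨h.uniform, h.indep, h.indep_share.comp (measurable_orderedShare m) measurable_id⟩

theorem hasLaw_orderedShare {Ω Ω' : Type*} [MeasurableSpace Ω] [MeasurableSpace Ω'] {μ : Measure Ω}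
    {μ' : Measure Ω'} {m : ℕ} {p : Ω → Fin m → ℝ} (hp : Measurable p) {p' : Ω' → Fin m → ℝ}
    (hp' : HasLaw p' (μ.map p) μ') :
    HasLaw (fun ω => orderedShare (p' ω)) (μ.map fun ω => orderedShare (p ω)) μ' := by
  have hm := measurable_orderedShare m
  refine ⟨hm.comp_aemeasurable hp'.aemeasurable, ?_⟩
  rw [← Function.comp_def orderedShare p', ← AEMeasurable.map_map_of_aemeasurable hm.aemeasurable
    hp'.aemeasurable, hp'.map_eq, Measure.map_map hm hp]
  rfl

theorem map_eq_smul_of_isUniform {Ω : Type*} [MeasurableSpace Ω] {μ : Measure Ω} {n : ℕ}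
    {p : Ω → Fin (n + 1) → ℝ}
    (h : pdf.IsUniform p (shareSimplex (n + 1)) μ (shareVolume (n + 1))) :
    ∃ κ : ENNReal, μ.map p = κ • shareVolume (n + 1) := by
  refine ⟨(shareVolume (n + 1) (shareSimplex (n + 1)))⁻¹, ?_⟩
  rw [h, ProbabilityTheory.cond]
  congr 1
  rw [shareVolume_succ, Measure.restrict_restrict (measurableSet_shareSimplex _), Set.inter_self]

/-- Mean, mean square and variance of the `j`th largest of uniformly distributed proportions. -/
theorem moments_orderedShare {Ω : Type*} [MeasurableSpace Ω] {μ : Measure Ω}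
    [IsProbabilityMeasure μ] {n : ℕ} (hn : 2 ≤ n + 1) {p : Ω → Fin (n + 1) → ℝ} (hp : Measurable p)
    (h : pdf.IsUniform p (shareSimplex (n + 1)) μ (shareVolume (n + 1))) (j : Fin (n + 1)) :
    ∫ ω, orderedShare (p ω) j ∂μ = tailSum j 1 / ((n + 1 : ℕ) : ℝ) ∧
    ∫ ω, orderedShare (p ω) j ^ 2 ∂μ = (tailSum j 2 + tailSum j 1 ^ 2) /
      (((n + 1 : ℕ) : ℝ) * (((n + 1 : ℕ) : ℝ) + 1)) ∧
    Var[fun ω => orderedShare (p ω) j; μ] = (tailSum j 2 + tailSum j 1 ^ 2) /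
      (((n + 1 : ℕ) : ℝ) * (((n + 1 : ℕ) : ℝ) + 1)) - (tailSum j 1 / ((n + 1 : ℕ) : ℝ)) ^ 2 := by
  obtain ⟨κ, hκ⟩ := map_eq_smul_of_isUniform h
  have : IsProbabilityMeasure (μ.map p) := Measure.isProbabilityMeasure_map hp.aemeasurable
  have hmj : Measurable fun x : Fin (n + 1) → ℝ => orderedShare x j :=
    (measurable_pi_apply j).comp (measurable_orderedShare _)
  have h1 : ∫ ω, orderedShare (p ω) j ∂μ = tailSum j 1 / ((n + 1 : ℕ) : ℝ) := by
    rw [← integral_orderedShare_uniform hn hκ j,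
      integral_map hp.aemeasurable hmj.aestronglyMeasurable]
  have h2 : ∫ ω, orderedShare (p ω) j ^ 2 ∂μ = (tailSum j 2 + tailSum j 1 ^ 2) /
      (((n + 1 : ℕ) : ℝ) * (((n + 1 : ℕ) : ℝ) + 1)) := by
    rw [← integral_orderedShare_sq_uniform hn hκ j,
      integral_map hp.aemeasurable (hmj.pow_const 2).aestronglyMeasurable]
  have hL : MemLp (fun ω => orderedShare (p ω) j) 2 μ := by
    refine MemLp.of_bound (hmj.comp hp).aestronglyMeasurable 1 ?_
    filter_upwards [ae_mem_shareSimplex_of_map hp (absolutelyContinuous_of_eq_smul hκ)] with ω hω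
    have hj := hω.1 (decreasingOrder (p ω) j)
    rw [Real.norm_of_nonneg (r := orderedShare (p ω) j) hj.1.le]
    exact hj.2.le
  refine ⟨h1, h2, ?_⟩
  rw [variance_eq_sub hL, h1, ← h2]
  rfl

/-- Absolute continuity passes to the sorted proportions. -/
theorem map_orderedShare_comp_absolutelyContinuous {Ω : Type*} [MeasurableSpace Ω] {μ : Measure Ω}
    {n : ℕ} {p : Ω → Fin (n + 1) → ℝ} (hp : Measurable p)
    (hac : μ.map p ≪ shareVolume (n + 1)) :
    (μ.map fun ω => orderedShare (p ω)) ≪ shareVolume (n + 1) := by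
  have := map_orderedShare_absolutelyContinuous hac
  rwa [Measure.map_map (measurable_orderedShare _) hp] at this

section Ordered

variable {n : ℕ} {Ω : Type*} [MeasurableSpace Ω] {μ : Measure Ω}
  {p : Ω → Fin (n + 1) → ℝ} {s : ℕ → Ω → Fin (n + 1) → ℤ}

theorem eventually_abs_orderedExcess_le_divisor {β : ℝ} (hp : Measurable p)
    (h : ∀ᶠ N : ℕ in atTop, ∀ᵐ ω ∂μ, IsDivisorAllocation β N (p ω) (s N ω))
    (hac : μ.map p ≪ shareVolume (n + 1)) (j : Fin (n + 1)) :
    ∀ᶠ N : ℕ in atTop, ∀ᵐ ω ∂μ,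
      |orderedExcess N (p ω) (s N ω) j| ≤ ((n + 1 : ℕ) + 1) * (|β| + 1) := by
  filter_upwards [h] with N hN
  filter_upwards [hN, ae_mem_shareSimplex_of_map hp hac] with ω hω hx
  exact hω.abs_seatExcess_le (fun i => (hx.1 i).1.le) hx.2 _

theorem eventually_abs_orderedExcess_le_quota {γ : ℝ} (hp : Measurable p)
    (h : ∀ᶠ N : ℕ in atTop, ∀ᵐ ω ∂μ, IsQuotaAllocation γ N (p ω) (s N ω))
    (hac : μ.map p ≪ shareVolume (n + 1)) (j : Fin (n + 1)) :
    ∀ᶠ N : ℕ in atTop, ∀ᵐ ω ∂μ, |orderedExcess N (p ω) (s N ω) j| ≤ 2 * |γ| + 2 := by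
  filter_upwards [h, eventually_le_natCast_add_mul (m := 1) ((n + 1 : ℕ) * |γ| + 1) γ (p := 1)
      (fun _ => one_pos)] with N hN hN1
  filter_upwards [hN, ae_mem_shareSimplex_of_map hp hac] with ω hω hx
  exact hω.abs_seatExcess_le (Nat.succ_pos n) (fun i => (hx.1 i).1.le) hx.2
    (by simpa using hN1 0) _

variable [IsProbabilityMeasure μ]
  {Ω' : Type*} [MeasurableSpace Ω'] {μ' : Measure Ω'} [IsProbabilityMeasure μ']

/-- The sorted parties with their seats are again a divisor allocation for absolutely continuous
proportions, so the limit for a single party applies to them. -/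
theorem tendsto_divisor_ordered {β : ℝ} (hn : 2 ≤ n + 1) (hp : Measurable p)
    (hs : ∀ N, Measurable (s N))
    (h : ∀ᶠ N : ℕ in atTop, ∀ᵐ ω ∂μ, IsDivisorAllocation β N (p ω) (s N ω))
    (hac : μ.map p ≪ shareVolume (n + 1)) {p' : Ω' → Fin (n + 1) → ℝ}
    (hp' : HasLaw p' (μ.map p) μ') {T : ℕ → Ω' → ℝ} (hT : IsCentredUniforms μ' p' T)
    (j : Fin (n + 1)) :
    TendstoInDistribution (fun (N : ℕ) ω => orderedExcess N (p ω) (s N ω) j) atTop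
      (fun ω => divisorLimit β (n + 1) (orderedShare (p' ω) j) (fun k => T k ω)) (fun _ => μ) μ' :=
  tendsto_divisor_eval hn ((measurable_orderedShare _).comp hp)
    (fun N => measurable_comp_decreasingOrder hp (hs N))
    (h.mono fun _ hN => hN.mono fun _ hω => hω.comp_perm _)
    (map_orderedShare_comp_absolutelyContinuous hp hac) (hasLaw_orderedShare hp hp')
    hT.orderedShare j

/-- The sorted parties with their seats are again a quota allocation for absolutely continuous
proportions, so the limit for a single party applies to them. -/
theorem tendsto_quota_ordered {γ : ℝ} (hn : 2 ≤ n + 1) (hp : Measurable p)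
    (hs : ∀ N, Measurable (s N))
    (h : ∀ᶠ N : ℕ in atTop, ∀ᵐ ω ∂μ, IsQuotaAllocation γ N (p ω) (s N ω))
    (hac : μ.map p ≪ shareVolume (n + 1)) {p' : Ω' → Fin (n + 1) → ℝ}
    (hp' : HasLaw p' (μ.map p) μ') {T : ℕ → Ω' → ℝ} (hT : IsCentredUniforms μ' p' T)
    (j : Fin (n + 1)) :
    TendstoInDistribution (fun (N : ℕ) ω => orderedExcess N (p ω) (s N ω) j) atTop
      (fun ω => quotaLimit γ (n + 1) (orderedShare (p' ω) j) (fun k => T k ω)) (fun _ => μ) μ' :=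
  tendsto_quota_eval hn ((measurable_orderedShare _).comp hp)
    (fun N => measurable_comp_decreasingOrder hp (hs N))
    (h.mono fun _ hN => hN.mono fun _ hω => hω.comp_perm _)
    (map_orderedShare_comp_absolutelyContinuous hp hac) (hasLaw_orderedShare hp hp')
    hT.orderedShare j

/-- Mean and variance of a limit variable whose coefficients are functions of the `j`th largest
proportion. -/
theorem moments_ordered_limit (hp : Measurable p)
    (hac : μ.map p ≪ shareVolume (n + 1)) {p' : Ω' → Fin (n + 1) → ℝ}
    (hp' : HasLaw p' (μ.map p) μ') {T : ℕ → Ω' → ℝ} (hT : IsCentredUniforms μ' p' T)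
    (j : Fin (n + 1)) {a y : ℝ → ℝ} (ha : Continuous a) (hy : Continuous y) (r : ℕ) {X : Ω' → ℝ}
    (hX : ∀ ω, X ω = a (orderedShare (p' ω) j) + T 0 ω +
      y (orderedShare (p' ω) j) * ∑ k ∈ Finset.Icc 1 r, T k ω) :
    (∃ K, ∀ᵐ ω ∂μ', |X ω| ≤ K) ∧ ∫ ω, X ω ∂μ' = ∫ ω, a (orderedShare (p ω) j) ∂μ ∧
      Var[X; μ'] = Var[fun ω => a (orderedShare (p ω) j); μ] +
        1 / 12 * (1 + r * ∫ ω, y (orderedShare (p ω) j) ^ 2 ∂μ) := by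
  have : IsProbabilityMeasure (μ.map p) := Measure.isProbabilityMeasure_map hp.aemeasurable
  have hmj : Measurable fun x : Fin (n + 1) → ℝ => orderedShare x j :=
    (measurable_pi_apply j).comp (measurable_orderedShare _)
  have ham : Measurable fun x : Fin (n + 1) → ℝ => a (orderedShare x j) := ha.measurable.comp hmj
  have hym : Measurable fun x : Fin (n + 1) → ℝ => y (orderedShare x j) := hy.measurable.comp hmj
  obtain ⟨Ca, hCa⟩ := (isCompact_Icc (a := (0 : ℝ)) (b := 1)).exists_bound_of_continuousOn
    ha.continuousOn
  obtain ⟨Cy, hCy⟩ := (isCompact_Icc (a := (0 : ℝ)) (b := 1)).exists_bound_of_continuousOn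
    hy.continuousOn
  have hmem : ∀ᵐ x ∂μ.map p, orderedShare x j ∈ Set.Icc (0 : ℝ) 1 :=
    (ae_mem_shareSimplex hac).mono fun x hx => ⟨(hx.1 _).1.le, (hx.1 _).2.le⟩
  obtain ⟨-, h1, h2, h3⟩ := hT.moments hp' ham hym (C := max Ca Cy)
    (hmem.mono fun x hx => (hCa _ hx).trans (le_max_left _ _))
    (hmem.mono fun x hx => (hCy _ hx).trans (le_max_right _ _)) r hX
  refine ⟨h1, ?_, ?_⟩
  · rw [h2, integral_map hp.aemeasurable ham.aestronglyMeasurable]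
  · rw [h3, variance_map ham.aemeasurable hp.aemeasurable,
      integral_map hp.aemeasurable (hym.pow_const 2).aestronglyMeasurable]
    rfl

end Ordered

theorem integrable_orderedShare {Ω : Type*} [MeasurableSpace Ω] {μ : Measure Ω}
    [IsProbabilityMeasure μ] {n : ℕ} {p : Ω → Fin (n + 1) → ℝ} (hp : Measurable p)
    (hac : μ.map p ≪ shareVolume (n + 1)) (j : Fin (n + 1)) :
    Integrable (fun ω => orderedShare (p ω) j) μ ∧ Measurable fun ω => orderedShare (p ω) j := by
  have hm : Measurable fun ω => orderedShare (p ω) j :=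
    (measurable_pi_apply j).comp ((measurable_orderedShare _).comp hp)
  refine ⟨Integrable.of_bound hm.aestronglyMeasurable 1 ?_, hm⟩
  filter_upwards [ae_mem_shareSimplex_of_map hp hac] with ω hω
  have hj := hω.1 (decreasingOrder (p ω) j)
  rw [Real.norm_of_nonneg (r := orderedShare (p ω) j) hj.1.le]
  exact hj.2.le

/-! ### The limits for divisor and quota methods -/

theorem mainTheorem8 (m : ℕ) (hm : 2 ≤ m) :
    -- divisor methods
    (∀ (β : ℝ) (Ω : Type u) [MeasurableSpace Ω] (μ : Measure Ω) [IsProbabilityMeasure μ]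
      (p : Ω → Fin m → ℝ) (s : ℕ → Ω → Fin m → ℤ)
      (Ω' : Type v) [MeasurableSpace Ω'] (μ' : Measure Ω') [IsProbabilityMeasure μ']
      (p' : Ω' → Fin m → ℝ),
      Measurable p → (∀ N, Measurable (s N)) →
      (∀ᶠ N : ℕ in atTop, ∀ᵐ ω ∂μ, IsDivisorAllocation β N (p ω) (s N ω)) →
      Measurable p' → HasLaw p' (μ.map p) μ' →
        -- absolutely continuous party sizes
        (μ.map p ≪ shareVolume m →
          (∀ T : ℕ → Ω' → ℝ, IsCentredUniforms μ' p' T → ∀ i : Fin m,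
            TendstoInDistribution (fun (N : ℕ) ω => seatExcess N (p ω) (s N ω) i) atTop
              (fun ω => divisorLimit β m (p' ω i) (fun k => T k ω)) (fun _ => μ) μ') ∧
          (∀ (U : Fin m → Ω' → ℝ) (J : Ω' → Fin m), IsDivisorSource μ' p' U J →
            TendstoInDistribution (fun (N : ℕ) ω => seatExcess N (p ω) (s N ω)) atTop
              (fun ω => divisorJointLimit β (p' ω) (fun i => U i ω) (J ω)) (fun _ => μ) μ')) ∧
        -- uniformly distributed party sizes, in decreasing order
        (pdf.IsUniform p (shareSimplex m) μ (shareVolume m) →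
          ∀ T : ℕ → Ω' → ℝ, IsCentredUniforms μ' p' T → ∀ j : Fin m,
            TendstoInDistribution (fun (N : ℕ) ω => orderedExcess N (p ω) (s N ω) j) atTop
              (fun ω => divisorLimit β m (orderedShare (p' ω) j) (fun k => T k ω))
              (fun _ => μ) μ' ∧
            (∀ᶠ N : ℕ in atTop, MemLp (fun ω => orderedExcess N (p ω) (s N ω) j) 2 μ) ∧
            MemLp (fun ω => divisorLimit β m (orderedShare (p' ω) j) (fun k => T k ω)) 2 μ' ∧
            -- mean
            Tendsto (fun N : ℕ => ∫ ω, orderedExcess N (p ω) (s N ω) j ∂μ) atTop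
              (𝓝 (∫ ω, divisorLimit β m (orderedShare (p' ω) j) (fun k => T k ω) ∂μ')) ∧
            ∫ ω, divisorLimit β m (orderedShare (p' ω) j) (fun k => T k ω) ∂μ' =
              (β - 1 / 2) * (m * (∫ ω, orderedShare (p ω) j ∂μ) - 1) ∧
            (β - 1 / 2) * (m * (∫ ω, orderedShare (p ω) j ∂μ) - 1) =
              (β - 1 / 2) * (tailSum j 1 - 1) ∧
            -- variance
            Tendsto (fun N : ℕ => Var[fun ω => orderedExcess N (p ω) (s N ω) j; μ]) atTop
              (𝓝 Var[fun ω => divisorLimit β m (orderedShare (p' ω) j) (fun k => T k ω); μ']) ∧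
            Var[fun ω => divisorLimit β m (orderedShare (p' ω) j) (fun k => T k ω); μ'] =
              1 / 12 * (1 + (m - 2) * ∫ ω, orderedShare (p ω) j ^ 2 ∂μ) +
                (β - 1 / 2) ^ 2 * m ^ 2 * Var[fun ω => orderedShare (p ω) j; μ] ∧
            1 / 12 * (1 + (m - 2) * ∫ ω, orderedShare (p ω) j ^ 2 ∂μ) +
                (β - 1 / 2) ^ 2 * m ^ 2 * Var[fun ω => orderedShare (p ω) j; μ] =
              1 / 12 + (m - 2) / (12 * m * (m + 1)) * tailSum j 2 +
                (m - 2) / (12 * m * (m + 1)) * tailSum j 1 ^ 2 +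
                (β - 1 / 2) ^ 2 *
                  (m / (m + 1) * tailSum j 2 - 1 / (m + 1) * tailSum j 1 ^ 2))) ∧
    -- quota methods
    (∀ γ : ℝ, ∃ ν : Measure (Fin m → ℝ), IsProbabilityMeasure ν ∧
      (∀ σ : Equiv.Perm (Fin m), ν.map (fun z => z ∘ σ) = ν) ∧
      ∀ (Ω : Type u) [MeasurableSpace Ω] (μ : Measure Ω) [IsProbabilityMeasure μ]
        (p : Ω → Fin m → ℝ) (s : ℕ → Ω → Fin m → ℤ)
        (Ω' : Type v) [MeasurableSpace Ω'] (μ' : Measure Ω') [IsProbabilityMeasure μ']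
        (p' : Ω' → Fin m → ℝ),
        Measurable p → (∀ N, Measurable (s N)) →
        (∀ᶠ N : ℕ in atTop, ∀ᵐ ω ∂μ, IsQuotaAllocation γ N (p ω) (s N ω)) →
        Measurable p' → HasLaw p' (μ.map p) μ' →
          -- absolutely continuous party sizes
          (μ.map p ≪ shareVolume m →
            (∀ T : ℕ → Ω' → ℝ, IsCentredUniforms μ' p' T → ∀ i : Fin m,
              TendstoInDistribution (fun (N : ℕ) ω => seatExcess N (p ω) (s N ω) i) atTop
                (fun ω => quotaLimit γ m (p' ω i) (fun k => T k ω)) (fun _ => μ) μ') ∧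
            (∀ Z : Ω' → Fin m → ℝ, HasLaw Z ν μ' → IndepFun p' Z μ' →
              TendstoInDistribution (fun (N : ℕ) ω => seatExcess N (p ω) (s N ω)) atTop
                (fun ω i => Z ω i + γ * p' ω i) (fun _ => μ) μ' ∧
              ∀ T : ℕ → Ω' → ℝ, IsCentredUniforms μ' p' T → ∀ i : Fin m,
                IdentDistrib (fun ω => Z ω i + γ * p' ω i)
                  (fun ω => quotaLimit γ m (p' ω i) (fun k => T k ω)) μ' μ')) ∧
          -- uniformly distributed party sizes, in decreasing order
          (pdf.IsUniform p (shareSimplex m) μ (shareVolume m) →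
            ∀ T : ℕ → Ω' → ℝ, IsCentredUniforms μ' p' T → ∀ j : Fin m,
              TendstoInDistribution (fun (N : ℕ) ω => orderedExcess N (p ω) (s N ω) j) atTop
                (fun ω => quotaLimit γ m (orderedShare (p' ω) j) (fun k => T k ω))
                (fun _ => μ) μ' ∧
              (∀ᶠ N : ℕ in atTop, MemLp (fun ω => orderedExcess N (p ω) (s N ω) j) 2 μ) ∧
              MemLp (fun ω => quotaLimit γ m (orderedShare (p' ω) j) (fun k => T k ω)) 2 μ' ∧
              -- mean
              Tendsto (fun N : ℕ => ∫ ω, orderedExcess N (p ω) (s N ω) j ∂μ) atTop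
                (𝓝 (∫ ω, quotaLimit γ m (orderedShare (p' ω) j) (fun k => T k ω) ∂μ')) ∧
              ∫ ω, quotaLimit γ m (orderedShare (p' ω) j) (fun k => T k ω) ∂μ' =
                γ * ((∫ ω, orderedShare (p ω) j ∂μ) - 1 / m) ∧
              γ * ((∫ ω, orderedShare (p ω) j ∂μ) - 1 / m) = γ / m * (tailSum j 1 - 1) ∧
              -- variance
              Tendsto (fun N : ℕ => Var[fun ω => orderedExcess N (p ω) (s N ω) j; μ]) atTop
                (𝓝 Var[fun ω => quotaLimit γ m (orderedShare (p' ω) j) (fun k => T k ω); μ']) ∧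
              Var[fun ω => quotaLimit γ m (orderedShare (p' ω) j) (fun k => T k ω); μ'] =
                1 / 12 * (1 + (m - 2) / m ^ 2) +
                  γ ^ 2 * Var[fun ω => orderedShare (p ω) j; μ] ∧
              1 / 12 * (1 + (m - 2) / m ^ 2) + γ ^ 2 * Var[fun ω => orderedShare (p ω) j; μ] =
                (m + 2) * (m - 1) / (12 * m ^ 2) +
                  γ ^ 2 * (1 / (m * (m + 1)) * tailSum j 2 -
                    1 / (m ^ 2 * (m + 1)) * tailSum j 1 ^ 2))) := by
  obtain ⟨n, rfl⟩ : ∃ n, m = n + 1 := ⟨m - 1, by omega⟩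
  have hm0 : ((n + 1 : ℕ) : ℝ) ≠ 0 := by positivity
  have hm1 : ((n + 1 : ℕ) : ℝ) + 1 ≠ 0 := by positivity
  have hm2 : ((n + 1 - 2 : ℕ) : ℝ) = ((n + 1 : ℕ) : ℝ) - 2 := by
    rw [Nat.cast_sub hm]; norm_num
  refine ⟨?_, fun γ => ⟨quotaLaw γ (n + 1), isProbabilityMeasure_quotaLaw γ (Nat.succ_pos n),
    quotaLaw_exchangeable γ (Nat.succ_pos n), ?_⟩⟩
  · intro β Ω _ μ _ p s Ω' _ μ' _ p' hp hs hall hp'm hp'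
    refine ⟨fun hac => ⟨fun T hT i => tendsto_divisor_eval hm hp hs hall hac hp' hT i,
      fun U J hUJ => tendsto_divisor hp hs hall hac ?_⟩, ?_⟩
    · have hsrc := hUJ.hasLaw hp'm hp' (isAEWeight_id hac)
      have hsm := measurable_shadowPoint (m := n + 1) (q := id) measurable_id
        (continuous_divisorOffset β (n + 1)).measurable
      refine ⟨hsm.comp_aemeasurable hsrc.aemeasurable, ?_⟩
      rw [← hsrc.map_eq, AEMeasurable.map_map_of_aemeasurable hsm.aemeasurable hsrc.aemeasurable]
      rfl
    · intro hunif T hT j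
      have hac : μ.map p ≪ shareVolume (n + 1) := hunif.absolutelyContinuous
      have hconv := tendsto_divisor_ordered hm hp hs hall hac hp' hT j
      obtain ⟨⟨K, hK⟩, hE, hV⟩ := moments_ordered_limit hp hac hp' hT j
        (a := fun x => (β - 1 / 2) * ((n + 1 : ℕ) * x - 1)) (y := fun x => x)
        (by fun_prop) (by fun_prop) (n + 1 - 2)
        (X := fun ω => divisorLimit β (n + 1) (orderedShare (p' ω) j) (fun k => T k ω))
        (fun ω => rfl)
      obtain ⟨c1, c2, c3, c4⟩ := TendstoInDistribution.tendsto_moments hconv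
        (eventually_abs_orderedExcess_le_divisor hp hall hac j) hK
      obtain ⟨m1, m2, m3⟩ := moments_orderedShare hm hp hunif j
      obtain ⟨hint, hmeas⟩ := integrable_orderedShare hp hac j
      refine ⟨hconv, c1, c2, c3, ?_, ?_, c4, ?_, ?_⟩
      · rw [hE, integral_const_mul, integral_sub (hint.const_mul _) (integrable_const _),
          integral_const_mul]
        simp
      · rw [m1]
        field_simp
      · rw [hV, hm2, variance_const_mul,
          variance_sub_const (hmeas.const_mul _).aestronglyMeasurable,
          variance_const_mul]
        ring
      · rw [m2, m3]
        field_simp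
        ring
  · intro Ω _ μ _ p s Ω' _ μ' _ p' hp hs hall hp'm hp'
    refine ⟨fun hac => ⟨fun T hT i => tendsto_quota_eval hm hp hs hall hac hp' hT i,
      fun Z hZ hind => ⟨tendsto_quota hp hs hall hac
        (hasLaw_add_quotaLaw γ (Nat.succ_pos n) hp'm hp' hZ hind),
        fun T hT i => identDistrib_quotaLimit hm hp'm hZ hind hT i⟩⟩, ?_⟩
    intro hunif T hT j
    have hac : μ.map p ≪ shareVolume (n + 1) := hunif.absolutelyContinuous
    have hconv := tendsto_quota_ordered hm hp hs hall hac hp' hT j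
    obtain ⟨⟨K, hK⟩, hE, hV⟩ := moments_ordered_limit hp hac hp' hT j
      (a := fun x => γ * (x - 1 / (n + 1 : ℕ))) (y := fun _ => 1 / ((n + 1 : ℕ) : ℝ))
      (by fun_prop) (by fun_prop) (n + 1 - 2)
      (X := fun ω => quotaLimit γ (n + 1) (orderedShare (p' ω) j) (fun k => T k ω))
      (fun ω => rfl)
    obtain ⟨c1, c2, c3, c4⟩ := TendstoInDistribution.tendsto_moments hconv
      (eventually_abs_orderedExcess_le_quota hp hall hac j) hK
    obtain ⟨m1, m2, m3⟩ := moments_orderedShare hm hp hunif j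
    obtain ⟨hint, hmeas⟩ := integrable_orderedShare hp hac j
    refine ⟨hconv, c1, c2, c3, ?_, ?_, c4, ?_, ?_⟩
    · rw [hE, integral_const_mul, integral_sub hint (integrable_const _)]
      simp
    · rw [m1]
      field_simp
    · rw [hV, hm2, variance_const_mul, variance_sub_const hmeas.aestronglyMeasurable,
        integral_const, probReal_univ, one_smul]
      field_simp
      ring
    · rw [m3]
      field_simp
      ring
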